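/- \textbf{Setting.} Let $d\ge 1$, let $\Omega\subset\mathbb R^d$ be a bounded domain with a $C^2$ boundary, let $\omega\subset\Omega$ be open and nonempty with characteristic function $\chi_\omega$, let $r>0$, and let $B_r(0)$ be the closed ball in $L^2(\Omega)$ with centre $0$ and radius $r$. Write $\mathbb R^+=(0,\infty)$. For $y_0\in L^2(\Omega)$ and $u\in L^2(\mathbb R^+;L^2(\Omega))$, let $y(\cdot;y_0,u)\in C([0,\infty);L^2(\Omega))$ be the weak solution of $$\partial_t y-\Delta y=\chi_\omega u\ \text{ in }\Omega\times\mathbb R^+,\qquad y=0\ \text{ on }\partial\Omega\times\mathbb R^+,\qquad y(0)=y_0 .$$ For $\delta>0$, let $L^2_\delta(\mathbb R^+;L^2(\Omega))$ be the space of those $u\in L^2(\mathbb R^+;L^2(\Omega))$ that are of the form $u=\sum_{i\ge1}\chi_{((i-1)\delta,i\delta]}u^i$ with $u^i\in L^2(\Omega)$, and, for an integer $k\ge1$, let $L^2_\delta(0,k\delta;L^2(\Omega))$ be the space of the restrictions of its elements to $(0,k\delta)$. Let $M\ge0$. \textbf{Problem} $(TP)^{M,y_0}$. Let $T(M,y_0)$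 be the infimum of all $t>0$ such that $y(t;y_0,u)\in B_r(0)$ for some $u\in L^2(\mathbb R^+;L^2(\Omega))$ with $\|u\|_{L^2(\mathbb R^+;L^2(\Omega))}\le M$. An optimal control is a $u\in L^2(\mathbb R^+;L^2(\Omega))$ with $\|u\|_{L^2(\mathbb R^+;L^2(\Omega))}\le M$ and $y(T(M,y_0);y_0,u)\in B_r(0)$. Two optimal controls are regarded as the same if they agree a.e. on $(0,T(M,y_0))$. \textbf{Problem} $(TP)^{M,y_0}_\delta$. Let $T_\delta(M,y_0)$ be the infimum of all $k\delta$, with $k\ge1$ an integer, such that $y(k\delta;y_0,u)\in B_r(0)$ for some $u\in L^2_\delta(\mathbb R^+;L^2(\Omega))$ with $\|u\|_{L^2(\mathbb R^+;L^2(\Omega))}\le M$. An optimal control is a $u\in L^2_\delta(\mathbb R^+;L^2(\Omega))$ with $\|u\|_{L^2(\mathbb R^+;L^2(\Omega))}\le M$ and $y(T_\delta(M,y_0);y_0,u)\in B_r(0)$. It is an optimal control with the minimal norm if its norm in $L^2(0,T_\delta(M,y_0);L^2(\Omega))$ is at most that of every optimal control. Two optimal controls are regarded as the same if they agree a.e.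 on $(0,T_\delta(M,y_0))$. \textbf{Problem} $(NP)^{k\delta,y_0}_\delta$. For $v\in L^2_\delta(0,k\delta;L^2(\Omega))$ let $y(\cdot;y_0,v)$ be the solution above with $u$ the extension of $v$ by zero to $\mathbb R^+$. Let $$N_\delta(k\delta,y_0)=\inf\{\|v\|_{L^2(0,k\delta;L^2(\Omega))}:\ v\in L^2_\delta(0,k\delta;L^2(\Omega)),\ y(k\delta;y_0,v)\in B_r(0)\}.$$ An optimal control is a $v\in L^2_\delta(0,k\delta;L^2(\Omega))$ with $y(k\delta;y_0,v)\in B_r(0)$ and $\|v\|_{L^2(0,k\delta;L^2(\Omega))}=N_\delta(k\delta,y_0)$. \textbf{Theorem.} Let $y_0\in L^2(\Omega)\setminus B_r(0)$ and $M\ge0$. (i) The problem $(TP)^{M,y_0}$ has a unique optimal control. (ii) For each $\delta>0$, the problem $(TP)^{M,y_0}_\delta$ has a unique optimal control with the minimal norm. (iii) For each $\delta>0$, $T_\delta(M,y_0)=k\delta$ for some integer $k\ge1$. Let $u^*_\delta$ be the optimal control with the minimal norm to $(TP)^{M,y_0}_\delta$. Then the restriction of $u^*_\delta$ to $(0,T_\delta(M,y_0))$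 is an optimal control to $(NP)^{T_\delta(M,y_0),y_0}_\delta$, and $\|u^*_\delta\|_{L^2(0,T_\delta(M,y_0);L^2(\Omega))}=N_\delta(T_\delta(M,y_0),y_0)$. -/

import Mathlib

open MeasureTheory Set Filter Topology
open scoped ENNReal

noncomputable section

namespace HeatControl

/-- The Euclidean space `ℝ^d`. -/
abbrev Space (d : ℕ) : Type := EuclideanSpace ℝ (Fin d)

/-- The boundary of `Ω` is of class `C²`: near each boundary point, `Ω` is the set where a `C²`
function with nonvanishing differential is negative. -/
def HasC2Boundary {d : ℕ} (Ω : Set (Space d)) : Prop :=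
  ∀ x₀ ∈ frontier Ω, ∃ (U : Set (Space d)) (ρ : Space d → ℝ),
    IsOpen U ∧ x₀ ∈ U ∧ ContDiffOn ℝ 2 ρ U ∧ (∀ x ∈ U, fderiv ℝ ρ x ≠ 0) ∧
      Ω ∩ U = {x ∈ U | ρ x < 0}

/-- `L²(Ω)`. -/
abbrev L2 {d : ℕ} (Ω : Set (Space d)) : Type :=
  Lp ℝ 2 (volume.restrict Ω)

/-- `L²(Ω; ℝ^d)`, the space of square integrable vector fields. -/
abbrev L2Field {d : ℕ} (Ω : Set (Space d)) : Type :=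
  Lp (Space d) 2 (volume.restrict Ω)

/-- The functions of class `C_c^∞(Ω)`. -/
structure IsTestFunction {d : ℕ} (Ω : Set (Space d)) (φ : Space d → ℝ) : Prop where
  smooth : ContDiff ℝ ((⊤ : ℕ∞) : WithTop ℕ∞) φ
  compactSupport : HasCompactSupport φ
  support_subset : tsupport φ ⊆ Ω

/-- The set of pairs `(v, ∇v)` with `v ∈ H¹₀(Ω)`, that is, the closure in
`L²(Ω) × L²(Ω; ℝ^d)` of the pairs `(φ, ∇φ)` with `φ ∈ C_c^∞(Ω)`. -/
def H10Graph {d : ℕ} (Ω : Set (Space d)) : Set (L2 Ω × L2Field Ω) :=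
  closure {p | ∃ φ : Space d → ℝ, IsTestFunction Ω φ ∧
    (p.1 : Space d → ℝ) =ᵐ[volume.restrict Ω] φ ∧
    (p.2 : Space d → Space d) =ᵐ[volume.restrict Ω] gradient φ}

/-- `L²(ℝ⁺; L²(Ω))`, the space of distributed controls. -/
abbrev Control {d : ℕ} (Ω : Set (Space d)) : Type :=
  Lp (L2 Ω) 2 (volume.restrict (Ioi (0 : ℝ)))

/-- `L²(0, T; L²(Ω))`. -/
abbrev ControlOn {d : ℕ} (Ω : Set (Space d)) (T : ℝ) : Type :=
  Lp (L2 Ω) 2 (volume.restrict (Ioo (0 : ℝ) T))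

/-- The restriction of a control to `(0, T)`. -/
def restrictControl {d : ℕ} {Ω : Set (Space d)} (T : ℝ) (u : Control Ω) : ControlOn Ω T :=
  MemLp.toLp (fun t => u t)
    ((Lp.memLp u).mono_measure (Measure.restrict_mono Ioo_subset_Ioi_self le_rfl))

theorem memLp_zeroExtension {d : ℕ} {Ω : Set (Space d)} {T : ℝ} (v : ControlOn Ω T) :
    MemLp ((Ioo (0 : ℝ) T).indicator fun t => v t) 2 (volume.restrict (Ioi (0 : ℝ))) := by
  rw [memLp_indicator_iff_restrict measurableSet_Ioo,
    Measure.restrict_restrict measurableSet_Ioo,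
    inter_eq_left.mpr (Ioo_subset_Ioi_self : Ioo (0 : ℝ) T ⊆ Ioi 0)]
  exact Lp.memLp v

/-- The extension by zero to `ℝ⁺` of a control on `(0, T)`. -/
def zeroExtension {d : ℕ} {Ω : Set (Space d)} {T : ℝ} (v : ControlOn Ω T) : Control Ω :=
  MemLp.toLp _ (memLp_zeroExtension v)

/-- `y` is the (weak) solution on `[0, ∞)` of `∂ₜ y - Δ y = χ_ω u` in `Ω × ℝ⁺`, `y = 0` on
`∂Ω × ℝ⁺`, `y(0) = y₀`: it belongs to `C([0, ∞); L²(Ω))` and to `L²(0, T; H¹₀(Ω))` for each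
`T > 0`, and it satisfies the equation, tested with each `φ ∈ C_c^∞(Ω)`, integrated in time. -/
structure IsHeatSolution {d : ℕ} {Ω : Set (Space d)} (ω : Set (Space d)) (y₀ : L2 Ω)
    (u : Control Ω) (y : ℝ → L2 Ω) : Prop where
  continuousOn : ContinuousOn y (Ici 0)
  initial : y 0 = y₀
  weak : ∃ g : ℝ → L2Field Ω,
    (∀ T : ℝ, 0 < T → MemLp g 2 (volume.restrict (Ioo 0 T))) ∧
    (∀ᵐ t ∂(volume.restrict (Ioi (0 : ℝ))), (y t, g t) ∈ H10Graph Ω) ∧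
    ∀ φ : Space d → ℝ, IsTestFunction Ω φ → ∀ t : ℝ, 0 ≤ t →
      (∫ x in Ω, y t x * φ x) - ∫ x in Ω, y₀ x * φ x =
        -(∫ s in (0 : ℝ)..t, ∫ x in Ω, inner ℝ (g s x) (gradient φ x))
          + ∫ s in (0 : ℝ)..t, ∫ x in ω, u s x * φ x

/-- `y(t; y₀, u) ∈ B_r(0)`. -/
def Reaches {d : ℕ} {Ω : Set (Space d)} (ω : Set (Space d)) (r : ℝ) (y₀ : L2 Ω)
    (u : Control Ω) (t : ℝ) : Prop :=
  ∃ y : ℝ → L2 Ω, IsHeatSolution ω y₀ u y ∧ y t ∈ Metric.closedBall (0 : L2 Ω) r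

/-! ### The time optimal distributed control problem -/

/-- The optimal time `T(M, y₀)`. -/
def optTime {d : ℕ} {Ω : Set (Space d)} (ω : Set (Space d)) (r M : ℝ) (y₀ : L2 Ω) : ℝ :=
  sInf {t : ℝ | 0 < t ∧ ∃ u : Control Ω, ‖u‖ ≤ M ∧ Reaches ω r y₀ u t}

/-- `u` is an optimal control to the time optimal distributed control problem. -/
def IsTimeOptimal {d : ℕ} {Ω : Set (Space d)} (ω : Set (Space d)) (r M : ℝ) (y₀ : L2 Ω)
    (u : Control Ω) : Prop :=
  ‖u‖ ≤ M ∧ Reaches ω r y₀ u (optTime ω r M y₀)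

/-! ### The time optimal sampled-data control problem -/

/-- `u ∈ L²_δ(ℝ⁺; L²(Ω))`: there are `c 0, c 1, …` in `L²(Ω)` such that `u = c i` on
`(iδ, (i+1)δ]` for each `i`. -/
def IsSampled {d : ℕ} {Ω : Set (Space d)} (δ : ℝ) (u : Control Ω) : Prop :=
  ∃ c : ℕ → L2 Ω, ∀ i : ℕ,
    ∀ᵐ t ∂(volume.restrict (Ioc ((i : ℝ) * δ) (((i : ℝ) + 1) * δ))), u t = c i

/-- The optimal time `T_δ(M, y₀)`. -/
def optTimeSampled {d : ℕ} {Ω : Set (Space d)} (ω : Set (Space d)) (r M δ : ℝ)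
    (y₀ : L2 Ω) : ℝ :=
  sInf {t : ℝ | ∃ k : ℕ, 1 ≤ k ∧ t = k * δ ∧
    ∃ u : Control Ω, IsSampled δ u ∧ ‖u‖ ≤ M ∧ Reaches ω r y₀ u (k * δ)}

/-- `u` is an optimal control to the time optimal sampled-data control problem. -/
def IsTimeOptimalSampled {d : ℕ} {Ω : Set (Space d)} (ω : Set (Space d)) (r M δ : ℝ)
    (y₀ : L2 Ω) (u : Control Ω) : Prop :=
  IsSampled δ u ∧ ‖u‖ ≤ M ∧ Reaches ω r y₀ u (optTimeSampled ω r M δ y₀)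

/-- `u` is an optimal control with the minimal norm (the norm being that of
`L²(0, T_δ(M, y₀); L²(Ω))`) to the time optimal sampled-data control problem. -/
def IsMinNormTimeOptimalSampled {d : ℕ} {Ω : Set (Space d)} (ω : Set (Space d)) (r M δ : ℝ)
    (y₀ : L2 Ω) (u : Control Ω) : Prop :=
  IsTimeOptimalSampled ω r M δ y₀ u ∧
    ∀ v : Control Ω, IsTimeOptimalSampled ω r M δ y₀ v →
      ‖restrictControl (optTimeSampled ω r M δ y₀) u‖ ≤
        ‖restrictControl (optTimeSampled ω r M δ y₀) v‖

/-! ### The norm optimal sampled-data control problem -/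

/-- `v ∈ L²_δ(0, T; L²(Ω))`: `v` is the restriction to `(0, T)` of an element of
`L²_δ(ℝ⁺; L²(Ω))`. It is used with `T` a multiple of `δ`. -/
def IsSampledOn {d : ℕ} {Ω : Set (Space d)} (δ : ℝ) {T : ℝ} (v : ControlOn Ω T) : Prop :=
  ∃ f : Control Ω, IsSampled δ f ∧ restrictControl T f = v

/-- `v` is an admissible control to the norm optimal sampled-data control problem. -/
def IsNormAdmissibleSampled {d : ℕ} {Ω : Set (Space d)} (ω : Set (Space d)) (r δ T : ℝ)
    (y₀ : L2 Ω) (v : ControlOn Ω T) : Prop :=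
  IsSampledOn δ v ∧ Reaches ω r y₀ (zeroExtension v) T

/-- The optimal norm `N_δ(T, y₀)`. -/
def optNormSampled {d : ℕ} {Ω : Set (Space d)} (ω : Set (Space d)) (r δ T : ℝ)
    (y₀ : L2 Ω) : ℝ :=
  sInf {a : ℝ | ∃ v : ControlOn Ω T, IsNormAdmissibleSampled ω r δ T y₀ v ∧ a = ‖v‖}

/-- `v` is an optimal control to the norm optimal sampled-data control problem. -/
def IsNormOptimalSampled {d : ℕ} {Ω : Set (Space d)} (ω : Set (Space d)) (r δ T : ℝ)
    (y₀ : L2 Ω) (v : ControlOn Ω T) : Prop :=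
  IsNormAdmissibleSampled ω r δ T y₀ v ∧ ‖v‖ = optNormSampled ω r δ T y₀

end HeatControl

end

open HeatControl

/-! Write `G = (-Δ)⁻¹` and `S t = exp (tΔ)`. The whole equation is encoded in `G`, a bounded,
symmetric, nonnegative and injective operator on `L²(Ω)`. It factors as `G = P P*`, where `P`
recovers a function of `H¹₀(Ω)` from its gradient; Poincaré's inequality makes `P` bounded. The
semigroup is the strong limit of `exp (-t (G + ε)⁻¹)`, and its generator enters only through `∫₀ᵗ S
s x ds = G x - G (S t x)`. An energy argument for this integrated equation identifies weak solutions
with mild ones, so that reaching the ball at time `t` means `‖S t y₀ + Λ t u‖ ≤ r`, with `Λ t u` the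
Duhamel integral of `χ_ω u`.

Three properties of the semigroup carry the control theory. The smoothing estimate `t ‖S t z‖ ≤ ‖G
z‖` makes the free solution decay, so the zero control is admissible for a late enough time and all
infima are over nonempty sets. The identity `⟪S t z, z⟫ = ‖S (t/2) z‖²` makes `S t` injective.
Unique continuation (`eq_zero_of_vanishes`) says that `S t x = 0` on `ω` with `t > 0` forces `x =
0`. It rests on quantitative analyticity: smoothing bounds `(-Δ)ⁱ S t x` by `(n/t)ⁱ ‖x‖` for `i ≤
n`, iterated Caccioppoli inequalities convert these bounds into interior `L²` bounds of order `(q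
n)ⁿ` on the `n`-th directional derivatives, and Taylor's formula propagates zeros over balls of
definite radius; connectedness of `Ω` does the rest.

For (i), an optimal control is a weak limit of controls whose times tend to the infimum `T`. For
uniqueness, no control of norm at most `M` can bring the state strictly inside the ball at time `T`,
since by continuity it would be inside a little earlier. The midpoint of two distinct optimal
controls has norm strictly below `M`, so it may be moved slightly against the adjoint of its final
state `e`. That adjoint, `χ_ω S (T - s) e`, is nonzero by unique continuation, and the move
decreases the norm of the final state: a contradiction.

For (ii) and (iii), the sampled optimal time is a minimum by the well-ordering of the integers. The
sampled controls steering `y₀` to the ball at time `kδ` form a nonempty closed convex set, which has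
a unique element of minimal norm. Truncation at `kδ` preserves sampling and the final state and does
not increase the norm, so this element vanishes after `kδ`. The bound `M` plays no part in this
minimisation, and the minimiser satisfies it automatically, which is why the time optimal and norm
optimal problems share their solution. -/

namespace HeatControl

open scoped RealInnerProductSpace

/-! ### The contraction semigroup of a Green operator -/

section Semigroup

variable {H : Type*} [NormedAddCommGroup H] [InnerProductSpace ℝ H]

/-- A bounded, symmetric, positive and injective operator. The operator `(-Δ)⁻¹` is of this kind. -/
structure IsGreenOperator (G : H →L[ℝ] H) : Prop where
  symm : ∀ x y, ⟪G x, y⟫ = ⟪x, G y⟫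
  nonneg : ∀ x, 0 ≤ ⟪G x, x⟫
  inj : ∀ x, G x = 0 → x = 0

variable {G : H →L[ℝ] H}

/-- By symmetry, the orthogonal complement of the range is the kernel, which is trivial. -/
theorem IsGreenOperator.denseRange [CompleteSpace H] (hG : IsGreenOperator G) :
    DenseRange G := by
  have h : (G.range : Submodule ℝ H)ᗮ = ⊥ := by
    rw [Submodule.eq_bot_iff]
    intro x hx
    apply hG.inj
    rw [← inner_self_eq_zero (𝕜 := ℝ), hG.symm, real_inner_comm]
    exact hx _ ⟨_, rfl⟩
  have := (Submodule.topologicalClosure_eq_top_iff).2 h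
  intro x
  have hx : x ∈ (G.range : Submodule ℝ H).topologicalClosure := by rw [this]; trivial
  have h2 : x ∈ closure ((G.range : Submodule ℝ H) : Set H) := hx
  exact h2

/-- Cauchy–Schwarz for the form `⟪G x, y⟫`, with `y = G x`. -/
theorem IsGreenOperator.norm_sq_le (hG : IsGreenOperator G) (x : H) :
    ‖G x‖ ^ 2 ≤ ‖G‖ * ⟪G x, x⟫ := by
  -- Nonnegativity of the form at `x - s • G x`. The choice `s = ‖G‖⁻¹` below makes the quadratic
  -- term at most half the linear one.
  have key : ∀ s : ℝ, 0 ≤ ⟪G x, x⟫ - 2 * s * ‖G x‖ ^ 2 + s ^ 2 * ⟪G (G x), G x⟫ := by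
    intro s
    have := hG.nonneg (x - s • G x)
    simp only [map_sub, map_smul, inner_sub_left, inner_sub_right, inner_smul_left,
      inner_smul_right, hG.symm (G x) x, real_inner_self_eq_norm_sq] at this
    simp only [conj_trivial] at this
    nlinarith [this, hG.symm (G x) (G x)]
  have hb : ⟪G (G x), G x⟫ ≤ ‖G‖ * ‖G x‖ ^ 2 := by
    calc ⟪G (G x), G x⟫ ≤ ‖G (G x)‖ * ‖G x‖ := real_inner_le_norm _ _
      _ ≤ (‖G‖ * ‖G x‖) * ‖G x‖ := by gcongr; exact G.le_opNorm _
      _ = _ := by ring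
  by_cases h0 : ‖G‖ = 0
  · have : G = 0 := norm_eq_zero.1 h0
    simp [this]
  have hpos : 0 < ‖G‖ := lt_of_le_of_ne (norm_nonneg _) (Ne.symm h0)
  have := key (‖G‖⁻¹)
  have h2 : ‖G‖⁻¹ ^ 2 * ⟪G (G x), G x⟫ ≤ ‖G‖⁻¹ * ‖G x‖ ^ 2 := by
    calc _ ≤ ‖G‖⁻¹ ^ 2 * (‖G‖ * ‖G x‖ ^ 2) := by gcongr
      _ = _ := by field_simp
  have h3 : ‖G‖⁻¹ * ‖G x‖ ^ 2 ≤ ⟪G x, x⟫ := by linarith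
  rwa [inv_mul_le_iff₀ hpos] at h3

variable [CompleteSpace H]

/-- Lax–Milgram: the form of `G + ε` is coercive with constant `ε`. -/
theorem IsGreenOperator.exists_resolvent (hG : IsGreenOperator G) {ε : ℝ} (hε : 0 < ε) :
    ∃ A : H →L[ℝ] H, (∀ x, G (A x) + ε • A x = x) ∧ ∀ x, A (G x) + ε • A x = x := by
  let T : H →L[ℝ] H := G + ε • ContinuousLinearMap.id ℝ H
  let b : H →L[ℝ] H →L[ℝ] ℝ := (innerSL ℝ).comp T
  have hb : IsCoercive b := by
    refine ⟨ε, hε, fun u => ?_⟩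
    have : b u u = ⟪G u, u⟫ + ε * (‖u‖ * ‖u‖) := by
      change ⟪G u + ε • u, u⟫ = _
      rw [inner_add_left, inner_smul_left, real_inner_self_eq_norm_mul_norm, conj_trivial]
    rw [this]
    nlinarith [hG.nonneg u]
  have he : ∀ v, hb.continuousLinearEquivOfBilin v = T v := fun v =>
    (hb.unique_continuousLinearEquivOfBilin (fun w => by simp [b])).symm
  refine ⟨(hb.continuousLinearEquivOfBilin.symm : H →L[ℝ] H), fun x => ?_, fun x => ?_⟩
  · have := he (hb.continuousLinearEquivOfBilin.symm x)
    rw [ContinuousLinearEquiv.apply_symm_apply] at this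
    simpa [T] using this.symm
  · have := he x
    have h2 := congrArg hb.continuousLinearEquivOfBilin.symm this
    rw [ContinuousLinearEquiv.symm_apply_apply] at h2
    simpa [T] using h2.symm

/-- The operator `(G + ε)⁻¹`, for `0 < ε`. -/
noncomputable def IsGreenOperator.yosida (hG : IsGreenOperator G) (ε : ℝ) : H →L[ℝ] H := by
  classical
  exact if h : 0 < ε then (hG.exists_resolvent h).choose else 0

/-! ### Resolvent bounds -/

section Yosida

variable (hG : IsGreenOperator G) {ε : ℝ} (hε : 0 < ε)
include hε

theorem IsGreenOperator.apply_yosida (x : H) :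
    G (hG.yosida ε x) + ε • hG.yosida ε x = x := by
  rw [IsGreenOperator.yosida, dif_pos hε]
  exact (hG.exists_resolvent hε).choose_spec.1 x

theorem IsGreenOperator.yosida_apply (x : H) :
    hG.yosida ε (G x) + ε • hG.yosida ε x = x := by
  rw [IsGreenOperator.yosida, dif_pos hε]
  exact (hG.exists_resolvent hε).choose_spec.2 x

theorem IsGreenOperator.yosida_comm (D : H →L[ℝ] H) (hD : ∀ x, D (G x) = G (D x)) (x : H) :
    D (hG.yosida ε x) = hG.yosida ε (D x) := by
  have h := hG.apply_yosida hε x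
  have h2 := congrArg (fun z => hG.yosida ε (D z)) h
  simp only [map_add, map_smul, hD] at h2
  rw [hG.yosida_apply hε] at h2
  exact h2

theorem IsGreenOperator.yosida_G (x : H) : G (hG.yosida ε x) = hG.yosida ε (G x) :=
  hG.yosida_comm hε G (fun _ => rfl) x

theorem IsGreenOperator.yosida_symm (x y : H) :
    ⟪hG.yosida ε x, y⟫ = ⟪x, hG.yosida ε y⟫ := by
  conv_lhs => rw [← hG.apply_yosida hε y]
  conv_rhs => rw [← hG.apply_yosida hε x]
  simp only [inner_add_left, inner_add_right, inner_smul_left, inner_smul_right, hG.symm,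
    conj_trivial]

theorem IsGreenOperator.yosida_nonneg (x : H) : 0 ≤ ⟪hG.yosida ε x, x⟫ := by
  have h : ⟪hG.yosida ε x, x⟫ = ⟪hG.yosida ε x, G (hG.yosida ε x) + ε • hG.yosida ε x⟫ := by
    rw [hG.apply_yosida hε]
  rw [h, inner_add_right, inner_smul_right, ← hG.symm]
  have := hG.nonneg (hG.yosida ε x)
  exact add_nonneg this (mul_nonneg hε.le real_inner_self_nonneg)

/-- Expand the square of `x = G A x + ε A x`, where `A = (G + ε)⁻¹`: the cross term `2ε ⟪G A x, A
x⟫` is nonnegative. In consequence both `G A` and `ε A` are contractions, uniformly in `ε`. -/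
theorem IsGreenOperator.norm_sq_yosida (x : H) :
    ‖G (hG.yosida ε x)‖ ^ 2 + (ε * ‖hG.yosida ε x‖) ^ 2 ≤ ‖x‖ ^ 2 := by
  have h := hG.apply_yosida hε x
  conv_rhs => rw [← h]
  rw [norm_add_sq_real, norm_smul, inner_smul_right, Real.norm_of_nonneg hε.le]
  nlinarith [hG.nonneg (hG.yosida ε x), mul_nonneg hε.le (hG.nonneg (hG.yosida ε x))]

theorem IsGreenOperator.norm_G_yosida_le (x : H) : ‖G (hG.yosida ε x)‖ ≤ ‖x‖ := by
  have := hG.norm_sq_yosida hε x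
  exact abs_le_of_sq_le_sq' (by nlinarith [sq_nonneg (ε * ‖hG.yosida ε x‖)]) (norm_nonneg _) |>.2

theorem IsGreenOperator.norm_yosida_le (x : H) : ε * ‖hG.yosida ε x‖ ≤ ‖x‖ := by
  have := hG.norm_sq_yosida hε x
  exact abs_le_of_sq_le_sq' (by nlinarith [sq_nonneg (‖G (hG.yosida ε x)‖)]) (norm_nonneg _) |>.2

theorem IsGreenOperator.norm_yosida_G_le (x : H) : ‖hG.yosida ε (G x)‖ ≤ ‖x‖ := by
  rw [← hG.yosida_G hε]; exact hG.norm_G_yosida_le hε x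

/-- The resolvent identity. On the range of `G ∘ G` the two resolvents on the right are absorbed by
the two factors `G`, so the approximate generators converge there as `ε → 0`. -/
theorem IsGreenOperator.yosida_sub_yosida {ε' : ℝ} (hε' : 0 < ε') (x : H) :
    hG.yosida ε x - hG.yosida ε' x = (ε' - ε) • hG.yosida ε (hG.yosida ε' x) := by
  have h1 := hG.apply_yosida hε' x
  have h2 := congrArg (hG.yosida ε) h1
  have h3 := hG.yosida_apply hε (hG.yosida ε' x)
  rw [map_add, map_smul] at h2
  rw [← h2, sub_smul, eq_sub_of_add_eq h3]
  abel

end Yosida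

/-- The semigroup generated by `-(G + ε)⁻¹`. -/
noncomputable def IsGreenOperator.approx (hG : IsGreenOperator G) (ε t : ℝ) : H →L[ℝ] H :=
  NormedSpace.exp (t • (-hG.yosida ε))

/-! ### The approximating semigroups -/

section Approx

variable (hG : IsGreenOperator G) {ε : ℝ}

theorem IsGreenOperator.approx_zero : hG.approx ε 0 = 1 := by
  simp [IsGreenOperator.approx]

theorem IsGreenOperator.approx_add (s t : ℝ) :
    hG.approx ε (s + t) = hG.approx ε s * hG.approx ε t := by
  let _ : NormedAlgebra ℚ (H →L[ℝ] H) := NormedAlgebra.restrictScalars ℚ ℝ _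
  rw [IsGreenOperator.approx, add_smul, NormedSpace.exp_add_of_commute]; rfl
  exact ((Commute.refl _).smul_left _).smul_right _

theorem IsGreenOperator.hasDerivAt_approx (t : ℝ) :
    HasDerivAt (hG.approx ε) (-(hG.yosida ε * hG.approx ε t)) t := by
  exact (hasDerivAt_exp_smul_const' (𝕂 := ℝ) (-hG.yosida ε) t).congr_deriv (neg_mul _ _)

theorem IsGreenOperator.hasDerivAt_approx_apply (x : H) (t : ℝ) :
    HasDerivAt (fun s => hG.approx ε s x) (-hG.yosida ε (hG.approx ε t x)) t :=
  ((hG.hasDerivAt_approx t).clm_apply (hasDerivAt_const t x)).congr_deriv (by simp)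

theorem IsGreenOperator.approx_comm (hε : 0 < ε) (D : H →L[ℝ] H) (hD : ∀ x, D (G x) = G (D x))
    (t : ℝ) (x : H) : D (hG.approx ε t x) = hG.approx ε t (D x) := by
  have h1 : Commute D (hG.yosida ε) := by
    ext x; exact hG.yosida_comm hε D hD x
  have : Commute D (hG.approx ε t) := (h1.neg_right.smul_right t).exp_right
  exact congrArg (fun T : H →L[ℝ] H => T x) this.eq

theorem IsGreenOperator.approx_symm (hε : 0 < ε) (t : ℝ) (x y : H) :
    ⟪hG.approx ε t x, y⟫ = ⟪x, hG.approx ε t y⟫ := by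
  have h1 : star (hG.yosida ε) = hG.yosida ε := by
    rw [ContinuousLinearMap.star_eq_adjoint]
    symm
    rw [ContinuousLinearMap.eq_adjoint_iff]
    exact hG.yosida_symm hε
  have h2 : star (hG.approx ε t) = hG.approx ε t := by
    rw [IsGreenOperator.approx, NormedSpace.star_exp, star_smul, star_neg, h1]
    simp
  rw [ContinuousLinearMap.star_eq_adjoint] at h2
  conv_lhs => rw [← h2]
  rw [ContinuousLinearMap.adjoint_inner_left]

theorem IsGreenOperator.norm_approx_le (hε : 0 < ε) {t : ℝ} (ht : 0 ≤ t) (x : H) :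
    ‖hG.approx ε t x‖ ≤ ‖x‖ := by
  have h : Antitone fun s => ‖hG.approx ε s x‖ ^ 2 := by
    apply antitone_of_hasDerivAt_nonpos
      (f' := fun s => 2 * ⟪hG.approx ε s x, -hG.yosida ε (hG.approx ε s x)⟫)
    · intro s
      exact (hG.hasDerivAt_approx_apply x s).norm_sq
    · intro s
      have := hG.yosida_nonneg hε (hG.approx ε s x)
      rw [real_inner_comm] at this
      simp only [inner_neg_right, Pi.zero_apply]
      linarith
  have := h ht
  simp only [hG.approx_zero, one_apply_eq_self] at this
  exact abs_le_of_sq_le_sq' this (norm_nonneg _) |>.2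

/-- Interpolate between the two semigroups by `s ↦ exp (-(t - s) A) exp (-s A') x`. As everything
commutes, the derivative in `s` is a product of contractions applied to `A x - A' x`. -/
theorem IsGreenOperator.norm_approx_sub_le (hε : 0 < ε) {ε' : ℝ} (hε' : 0 < ε') {t : ℝ}
    (ht : 0 ≤ t) (x : H) :
    ‖hG.approx ε' t x - hG.approx ε t x‖ ≤ ‖hG.yosida ε x - hG.yosida ε' x‖ * t := by
  have hd : ∀ s ∈ Icc 0 t, HasDerivWithinAt (fun s => hG.approx ε (t - s) (hG.approx ε' s x))
      (hG.approx ε (t - s) (hG.approx ε' s (hG.yosida ε x - hG.yosida ε' x))) (Icc 0 t) s := by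
    intro s _
    have h1 : HasDerivAt (fun s => hG.approx ε (t - s))
        (hG.yosida ε * hG.approx ε (t - s)) s := by
      have := (hG.hasDerivAt_approx (ε := ε) (t - s)).scomp s ((hasDerivAt_id s).const_sub t)
      exact this.congr_deriv (by simp)
    have h2 := (h1.clm_apply (hG.hasDerivAt_approx_apply (ε := ε') x s))
    refine (h2.congr_deriv ?_).hasDerivWithinAt
    have c1 := hG.approx_comm hε (hG.yosida ε) (fun y => (hG.yosida_G hε y).symm) (t - s)
      (hG.approx ε' s x)
    have c2 := hG.approx_comm hε' (hG.yosida ε) (fun y => (hG.yosida_G hε y).symm) s x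
    have c3 := hG.approx_comm hε' (hG.yosida ε') (fun y => (hG.yosida_G hε' y).symm) s x
    simp only [mul_apply_eq_comp, map_sub, map_neg]
    rw [c1, c2, c3]
    abel
  have := norm_image_sub_le_of_norm_deriv_le_segment' hd
    (C := ‖hG.yosida ε x - hG.yosida ε' x‖) (fun s hs => (hG.norm_approx_le hε
      (sub_nonneg.2 hs.2.le) _).trans (hG.norm_approx_le hε' hs.1 _)) t ⟨ht, le_rfl⟩
  simpa [hG.approx_zero] using this

theorem IsGreenOperator.continuous_approx_apply (x : H) :
    Continuous fun s => hG.approx ε s x :=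
  continuous_iff_continuousAt.2 fun t => (hG.hasDerivAt_approx_apply x t).continuousAt

/-- Because `(G + ε) A = 1`, applying `-(G + ε)` to the orbit gives an antiderivative of it. The
limit `ε → 0` is the property `integral` of the heat semigroup. -/
theorem IsGreenOperator.integral_approx (hε : 0 < ε) (x : H) (t : ℝ) :
    ∫ s in (0 : ℝ)..t, hG.approx ε s x =
      G x - G (hG.approx ε t x) + ε • (x - hG.approx ε t x) := by
  have hd : ∀ s ∈ uIcc 0 t, HasDerivAt
      (fun s => -(G (hG.approx ε s x) + ε • hG.approx ε s x)) (hG.approx ε s x) s := by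
    intro s _
    have h := hG.hasDerivAt_approx_apply (ε := ε) x s
    have h1 := (G.hasFDerivAt.comp_hasDerivAt s h).add (h.const_smul ε) |>.neg
    refine h1.congr_deriv ?_
    have := hG.apply_yosida hε (hG.approx ε s x)
    conv_rhs => rw [← this]
    simp only [map_neg, smul_neg]
    abel
  rw [intervalIntegral.integral_eq_sub_of_hasDerivAt hd
    ((hG.continuous_approx_apply x).intervalIntegrable _ _), hG.approx_zero]
  simp only [one_apply_eq_self, smul_sub]
  abel

end Approx

/-- The strongly continuous contraction semigroup `exp (-t G⁻¹)`, extended by the identity to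
negative times. -/
structure IsHeatSemigroup (G : H →L[ℝ] H) (S : ℝ → H →L[ℝ] H) : Prop where
  zero : ∀ x, S 0 x = x
  continuous : ∀ x, Continuous fun t => S t x
  norm_le : ∀ t x, ‖S t x‖ ≤ ‖x‖
  add : ∀ s t, 0 ≤ s → 0 ≤ t → ∀ x, S (s + t) x = S s (S t x)
  symm : ∀ t x y, ⟪S t x, y⟫ = ⟪x, S t y⟫
  comm : ∀ t x, G (S t x) = S t (G x)
  integral : ∀ t, 0 ≤ t → ∀ x, ∫ s in (0 : ℝ)..t, S s x = G x - G (S t x)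

omit [CompleteSpace H] in
theorem cauchySeq_of_dense {T : ℕ → H →L[ℝ] H} (hT : ∀ n x, ‖T n x‖ ≤ ‖x‖) {D : Set H}
    (hD : Dense D) (h : ∀ x ∈ D, CauchySeq fun n => T n x) (x : H) :
    CauchySeq fun n => T n x := by
  rw [Metric.cauchySeq_iff']
  intro e he
  obtain ⟨z, hz, hzD⟩ := Metric.mem_closure_iff.1 (hD x) (e / 4) (by linarith)
  obtain ⟨N, hN⟩ := Metric.cauchySeq_iff'.1 (h z hz) (e / 4) (by linarith)
  refine ⟨N, fun n hn => ?_⟩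
  have h1 : ∀ n, dist (T n x) (T n z) < e / 4 := fun n => by
    rw [dist_eq_norm, ← map_sub]
    exact (hT n _).trans_lt (by rwa [← dist_eq_norm])
  calc dist (T n x) (T N x)
      ≤ dist (T n x) (T n z) + dist (T n z) (T N z) + dist (T N z) (T N x) :=
        dist_triangle4 _ _ _ _
    _ < e / 4 + e / 4 + e / 4 := by
        gcongr
        · exact h1 n
        · exact hN n hn
        · rw [dist_comm]; exact h1 N
    _ < e := by linarith

/-- The approximating semigroups are Cauchy on the dense range of `G ∘ G`, by the resolvent
identity, and contractivity extends the convergence to every vector. All the algebraic properties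
pass to the pointwise limit; only strong continuity needs a uniform estimate. -/
theorem IsGreenOperator.exists_semigroup (hG : IsGreenOperator G) :
    ∃ S : ℝ → H →L[ℝ] H, IsHeatSemigroup G S := by
  set e : ℕ → ℝ := fun n => 1 / ((n : ℝ) + 1) with he_def
  have he : ∀ n, 0 < e n := fun n => by positivity
  have he0 : Tendsto e atTop (𝓝 0) := tendsto_one_div_add_atTop_nhds_zero_nat
  have hdense : Dense (range fun x => G (G x)) :=
    hG.denseRange.comp hG.denseRange G.continuous
  have hc : ∀ t, 0 ≤ t → ∀ x, CauchySeq fun n => hG.approx (e n) t x := by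
    intro t ht
    apply cauchySeq_of_dense (fun n x => hG.norm_approx_le (he n) ht x) hdense
    rintro _ ⟨z, rfl⟩
    have hb : ∀ n m, dist (hG.approx (e n) t (G (G z))) (hG.approx (e m) t (G (G z))) ≤
        dist (e n) (e m) * (‖z‖ * t) := by
      intro n m
      rw [dist_eq_norm]
      refine (hG.norm_approx_sub_le (he m) (he n) ht _).trans ?_
      rw [hG.yosida_sub_yosida (he m) (he n), norm_smul, Real.dist_eq, Real.norm_eq_abs,
        mul_assoc]
      gcongr
      calc _ = ‖hG.yosida (e m) (G (hG.yosida (e n) (G z)))‖ := by rw [hG.yosida_G (he n)]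
        _ ≤ _ := (hG.norm_yosida_G_le (he m) _).trans (hG.norm_yosida_G_le (he n) _)
    rw [Metric.cauchySeq_iff]
    intro d hd
    obtain ⟨N, hN⟩ := Metric.cauchySeq_iff.1 he0.cauchySeq (d / (‖z‖ * t + 1)) (by positivity)
    refine ⟨N, fun n hn m hm => (hb n m).trans_lt ?_⟩
    have h1 := hN n hn m hm
    rw [lt_div_iff₀ (by positivity)] at h1
    nlinarith [dist_nonneg (x := e n) (y := e m)]
  have hlim : ∀ t x, ∃ y, Tendsto (fun n => hG.approx (e n) (max t 0) x) atTop (𝓝 y) :=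
    fun t x => cauchySeq_tendsto_of_complete (hc _ (le_max_right _ _) x)
  choose S0 hS0 using hlim
  let S : ℝ → H →L[ℝ] H := fun t => continuousLinearMapOfTendsto
    (fun n => hG.approx (e n) (max t 0)) (tendsto_pi_nhds.2 (hS0 t))
  have hS : ∀ t x, Tendsto (fun n => hG.approx (e n) (max t 0) x) atTop (𝓝 (S t x)) := hS0
  have hS' : ∀ t, 0 ≤ t → ∀ x, Tendsto (fun n => hG.approx (e n) t x) atTop (𝓝 (S t x)) := by
    intro t ht x
    have := hS t x
    rwa [max_eq_left ht] at this
  have hnorm : ∀ t x, ‖S t x‖ ≤ ‖x‖ := fun t x =>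
    le_of_tendsto (hS t x).norm (Eventually.of_forall fun n =>
      hG.norm_approx_le (he n) (le_max_right _ _) x)
  have hcomm : ∀ t x, G (S t x) = S t (G x) := fun t x => by
    refine tendsto_nhds_unique ((G.continuous.tendsto _).comp (hS t x)) ?_
    refine (hS t (G x)).congr fun n => ?_
    exact (hG.approx_comm (he n) G (fun _ => rfl) _ x).symm
  refine ⟨S, ?_, ?_, hnorm, ?_, ?_, hcomm, ?_⟩
  · intro x
    refine tendsto_nhds_unique (hS' 0 le_rfl x) ?_
    simp [hG.approx_zero]
  -- Orbits starting in the range of `G` are Lipschitz with a constant independent of `n`, since `A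
  -- G` is a contraction; strong continuity follows by density.
  · have hLip : ∀ z s t, ‖S s (G z) - S t (G z)‖ ≤ ‖z‖ * |s - t| := by
      intro z s t
      refine le_of_tendsto ((hS s _).sub (hS t _)).norm (Eventually.of_forall fun n => ?_)
      have := (convex_Ici (0 : ℝ)).norm_image_sub_le_of_norm_hasDerivWithin_le
        (f := fun s => hG.approx (e n) s (G z)) (C := ‖z‖)
        (fun r _ => (hG.hasDerivAt_approx_apply (G z) r).hasDerivWithinAt)
        (fun r hr => by
          rw [norm_neg, hG.approx_comm (he n) (hG.yosida (e n))
            (fun y => (hG.yosida_G (he n) y).symm)]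
          exact (hG.norm_approx_le (he n) hr _).trans (hG.norm_yosida_G_le (he n) z))
        (le_max_right t 0) (le_max_right s 0)
      refine this.trans ?_
      gcongr
      exact abs_max_sub_max_le_abs s t 0
    intro x
    rw [Metric.continuous_iff]
    intro t d hd
    obtain ⟨_, ⟨z, rfl⟩, hz⟩ := Metric.mem_closure_iff.1 (hG.denseRange x) (d / 4) (by linarith)
    refine ⟨d / (4 * (‖z‖ + 1)), by positivity, fun s hs => ?_⟩
    have h1 : ∀ t, dist (S t x) (S t (G z)) < d / 4 := fun t => by
      rw [dist_eq_norm, ← map_sub]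
      exact (hnorm t _).trans_lt (by rwa [← dist_eq_norm])
    have h2 : dist (S s (G z)) (S t (G z)) ≤ d / 4 := by
      rw [dist_eq_norm]
      refine (hLip z s t).trans ?_
      rw [Real.dist_eq] at hs
      calc ‖z‖ * |s - t| ≤ (‖z‖ + 1) * (d / (4 * (‖z‖ + 1))) := by gcongr; linarith
        _ = d / 4 := by field_simp
    calc dist (S s x) (S t x)
        ≤ dist (S s x) (S s (G z)) + dist (S s (G z)) (S t (G z)) + dist (S t (G z)) (S t x) :=
          dist_triangle4 _ _ _ _
      _ < d / 4 + d / 4 + d / 4 := by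
          refine add_lt_add (add_lt_add_of_lt_of_le (h1 s) h2) ?_
          rw [dist_comm]; exact h1 t
      _ < d := by linarith
  · intro s t hs ht x
    refine tendsto_nhds_unique (hS' _ (add_nonneg hs ht) x) ?_
    have h1 : Tendsto (fun n => hG.approx (e n) s (hG.approx (e n) t x - S t x)) atTop (𝓝 0) := by
      apply squeeze_zero_norm (a := fun n => ‖hG.approx (e n) t x - S t x‖)
      · intro n; exact hG.norm_approx_le (he n) hs _
      · exact tendsto_iff_norm_sub_tendsto_zero.1 (hS' t ht x)
    have := h1.add (hS' s hs (S t x))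
    rw [zero_add] at this
    refine this.congr fun n => ?_
    rw [hG.approx_add, map_sub]
    simp
  · intro t x y
    refine tendsto_nhds_unique ((hS t x).inner tendsto_const_nhds) ?_
    refine (tendsto_const_nhds.inner (hS t y)).congr fun n => ?_
    exact (hG.approx_symm (he n) _ x y).symm
  · intro t ht x
    have h1 : Tendsto (fun n => ∫ s in (0 : ℝ)..t, hG.approx (e n) s x) atTop
        (𝓝 (∫ s in (0 : ℝ)..t, S s x)) := by
      apply intervalIntegral.tendsto_integral_filter_of_dominated_convergence (fun _ => ‖x‖)
      · exact Eventually.of_forall fun n =>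
          (hG.continuous_approx_apply x).aestronglyMeasurable
      · refine Eventually.of_forall fun n => Eventually.of_forall fun s hs => ?_
        rw [uIoc_of_le ht] at hs
        exact hG.norm_approx_le (he n) hs.1.le x
      · exact intervalIntegrable_const
      · refine Eventually.of_forall fun s hs => ?_
        rw [uIoc_of_le ht] at hs
        exact hS' s hs.1.le x
    refine tendsto_nhds_unique h1 ?_
    have h2 : Tendsto (fun n => G x - G (hG.approx (e n) t x) + e n • (x - hG.approx (e n) t x))
        atTop (𝓝 (G x - G (S t x) + (0 : ℝ) • (x - S t x))) :=
      (tendsto_const_nhds.sub ((G.continuous.tendsto _).comp (hS' t ht x))).add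
        (he0.smul (tendsto_const_nhds.sub (hS' t ht x)))
    rw [zero_smul, add_zero] at h2
    exact h2.congr fun n => (hG.integral_approx (he n) x t).symm

end Semigroup
-- Smoothing, backward uniqueness and the integrated equation
section Duhamel

variable {H : Type*} [NormedAddCommGroup H] [InnerProductSpace ℝ H]
  {G : H →L[ℝ] H} {S : ℝ → H →L[ℝ] H}

theorem IsHeatSemigroup.inner_self_half (hS : IsHeatSemigroup G S) {t : ℝ} (ht : 0 ≤ t) (z : H) :
    ⟪S t z, z⟫ = ‖S (t / 2) z‖ ^ 2 := by
  have : S t z = S (t / 2) (S (t / 2) z) := by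
    rw [← hS.add _ _ (by linarith) (by linarith), add_halves]
  rw [this, hS.symm, real_inner_self_eq_norm_sq]

theorem IsHeatSemigroup.G_inner_self_half (hS : IsHeatSemigroup G S) {t : ℝ} (ht : 0 ≤ t) (z : H) :
    ⟪G (S t z), z⟫ = ⟪G (S (t / 2) z), S (t / 2) z⟫ := by
  have : S t z = S (t / 2) (S (t / 2) z) := by
    rw [← hS.add _ _ (by linarith) (by linarith), add_halves]
  rw [this, hS.comm, hS.symm]

theorem IsHeatSemigroup.norm_antitone (hS : IsHeatSemigroup G S) {s t : ℝ} (hs : 0 ≤ s)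
    (hst : s ≤ t) (z : H) : ‖S t z‖ ≤ ‖S s z‖ := by
  have : S t z = S (t - s) (S s z) := by
    rw [← hS.add _ _ (by linarith) hs, sub_add_cancel]
  rw [this]
  exact hS.norm_le _ _

theorem IsHeatSemigroup.inner_antitone (hS : IsHeatSemigroup G S) {s t : ℝ} (hs : 0 ≤ s)
    (hst : s ≤ t) (z : H) : ⟪S t z, z⟫ ≤ ⟪S s z, z⟫ := by
  rw [hS.inner_self_half hs, hS.inner_self_half (hs.trans hst)]
  gcongr
  exact hS.norm_antitone (by linarith) (by linarith) z

theorem IsHeatSemigroup.intervalIntegral_inner [CompleteSpace H] (hS : IsHeatSemigroup G S)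
    {t : ℝ} (ht : 0 ≤ t) (z w : H) :
    ∫ s in (0 : ℝ)..t, ⟪S s z, w⟫ = ⟪G z, w⟫ - ⟪G (S t z), w⟫ := by
  rw [← inner_sub_left, ← hS.integral t ht, real_inner_comm]
  have := ((innerSL ℝ w).intervalIntegral_comp_comm
    ((hS.continuous z).intervalIntegrable (μ := volume) 0 t))
  simp only [innerSL_apply_apply] at this
  rw [← this]
  simp only [real_inner_comm]

variable [CompleteSpace H]

/-- The function `s ↦ ⟪S s z, z⟫` is nonincreasing, equals `‖S a z‖²` at `s = 2a`, and has integral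
at most `⟪G z, z⟫` over `[0, 2a]`. -/
theorem IsHeatSemigroup.two_mul_norm_sq_le (hG : IsGreenOperator G) (hS : IsHeatSemigroup G S)
    {a : ℝ} (ha : 0 ≤ a) (z : H) : (2 * a) * ‖S a z‖ ^ 2 ≤ ⟪G z, z⟫ := by
  have h1 := hS.intervalIntegral_inner (t := 2 * a) (by linarith) z z
  have h2 : (2 * a) * ‖S a z‖ ^ 2 ≤ ∫ s in (0 : ℝ)..(2 * a), ⟪S s z, z⟫ := by
    have := intervalIntegral.integral_mono_on (a := 0) (b := 2 * a) (μ := volume)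
      (f := fun _ => ‖S a z‖ ^ 2) (g := fun s => ⟪S s z, z⟫) (by linarith)
      intervalIntegrable_const (((hS.continuous z).inner continuous_const).intervalIntegrable _ _)
      (fun s hs => by
        have h3 := hS.inner_antitone hs.1 hs.2 z
        rw [hS.inner_self_half (t := 2 * a) (by linarith)] at h3
        simpa using h3)
    simpa using this
  have h3 := hG.nonneg (S a z)
  rw [hS.G_inner_self_half (by linarith), show 2 * a / 2 = a by ring] at h1
  linarith

/-- The same argument as in `two_mul_norm_sq_le` with the form `⟪G ·, ·⟫` in place of the inner
product. -/
theorem IsHeatSemigroup.two_mul_inner_le (hG : IsGreenOperator G) (hS : IsHeatSemigroup G S)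
    {a : ℝ} (ha : 0 ≤ a) (z : H) : (2 * a) * ⟪G (S a z), S a z⟫ ≤ ‖G z‖ ^ 2 := by
  have h1 := hS.intervalIntegral_inner (t := 2 * a) (by linarith) z (G z)
  have e1 : ∀ s, ⟪S s z, G z⟫ = ⟪G (S s z), z⟫ := fun s => (hG.symm _ _).symm
  have h2 : (2 * a) * ⟪G (S a z), S a z⟫ ≤ ∫ s in (0 : ℝ)..(2 * a), ⟪S s z, G z⟫ := by
    have := intervalIntegral.integral_mono_on (a := 0) (b := 2 * a) (μ := volume)
      (f := fun _ => ⟪G (S a z), S a z⟫) (g := fun s => ⟪S s z, G z⟫) (by linarith)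
      intervalIntegrable_const (((hS.continuous z).inner continuous_const).intervalIntegrable _ _)
      (fun s hs => by
        have h4 : S a z = S (a - s / 2) (S (s / 2) z) := by
          rw [← hS.add _ _ (by linarith [hs.2]) (by linarith [hs.1]), sub_add_cancel]
        rw [e1, hS.G_inner_self_half hs.1]
        rw [h4, hS.comm, hS.symm]
        set v := S (s / 2) z
        set b := a - s / 2
        have hb : 0 ≤ b := by simp only [b]; linarith [hs.2]
        -- Monotonicity of the form along the semigroup: `⟪G v, v⟫ - ⟪G (S (2b) v), v⟫` is the
        -- integral of `⟪S s v, v⟫ = ‖S (s/2) v‖²`.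
        have h5 := hS.intervalIntegral_inner (t := 2 * b) (by linarith) v v
        have h6 : ⟪G v, S b (S b v)⟫ = ⟪G (S (2 * b) v), v⟫ := by
          rw [← hS.add _ _ hb hb, ← two_mul, ← hS.symm, ← hS.comm]
        have h7 : 0 ≤ ∫ s in (0 : ℝ)..(2 * b), ⟪S s v, v⟫ := by
          apply intervalIntegral.integral_nonneg (by linarith)
          intro u hu
          rw [hS.inner_self_half hu.1]
          positivity
        rw [h6]
        linarith)
    simpa using this
  have h3 : 0 ≤ ⟪G (S (2 * a) z), G z⟫ := by
    rw [hS.comm, hS.inner_self_half (by linarith)]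
    positivity
  rw [real_inner_self_eq_norm_sq] at h1
  linarith

/-- Parabolic smoothing, obtained by using each of the two preceding estimates on half of the time
interval. It yields both the decay as `t → ∞` and the factorisation of `S t` through `G`. -/
theorem IsHeatSemigroup.mul_norm_le (hG : IsGreenOperator G) (hS : IsHeatSemigroup G S)
    {t : ℝ} (ht : 0 ≤ t) (z : H) : t * ‖S t z‖ ≤ ‖G z‖ := by
  have h1 := hS.two_mul_norm_sq_le hG (a := t / 2) (by linarith) (S (t / 2) z)
  have h2 := hS.two_mul_inner_le hG (a := t / 2) (by linarith) z
  rw [← hS.add _ _ (by linarith) (by linarith), add_halves, mul_div_cancel₀ _ two_ne_zero] at h1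
  rw [mul_div_cancel₀ _ two_ne_zero] at h2
  have h3 : (t * ‖S t z‖) ^ 2 ≤ ‖G z‖ ^ 2 := by
    calc (t * ‖S t z‖) ^ 2 = t * (t * ‖S t z‖ ^ 2) := by ring
      _ ≤ t * ⟪G (S (t / 2) z), S (t / 2) z⟫ := by gcongr
      _ ≤ _ := h2
  exact abs_le_of_sq_le_sq' h3 (norm_nonneg _) |>.2

theorem IsHeatSemigroup.tendsto_zero (hG : IsGreenOperator G) (hS : IsHeatSemigroup G S) (z : H) :
    Tendsto (fun t => S t z) atTop (𝓝 0) := by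
  have h0 : Tendsto (fun t : ℝ => ‖G z‖ * t⁻¹) atTop (𝓝 0) := by
    simpa using tendsto_inv_atTop_zero.const_mul ‖G z‖
  refine squeeze_zero_norm' ?_ h0
  filter_upwards [eventually_gt_atTop 0] with t ht
  rw [← div_eq_mul_inv, le_div_iff₀ ht, mul_comm]
  exact hS.mul_norm_le hG ht.le z

-- If `S t z = 0`, then `‖S (t/2) z‖² = ⟪S t z, z⟫ = 0`. Halving repeatedly and letting the time
-- tend to zero gives `z = 0`.
omit [CompleteSpace H] in
theorem IsHeatSemigroup.injective (hS : IsHeatSemigroup G S) {t : ℝ} (ht : 0 ≤ t) {z : H}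
    (hz : S t z = 0) : z = 0 := by
  have h : ∀ n : ℕ, S (t * (1 / 2) ^ n) z = 0 := by
    intro n
    induction n with
    | zero => simpa using hz
    | succ n ih =>
      have := hS.inner_self_half (t := t * (1 / 2) ^ n) (by positivity) z
      rw [ih, inner_zero_left] at this
      rw [pow_succ, ← mul_assoc, mul_one_div]
      simpa using this.symm
  have h1 : Tendsto (fun n : ℕ => S (t * (1 / 2) ^ n) z) atTop (𝓝 (S 0 z)) := by
    apply ((hS.continuous z).tendsto 0).comp
    simpa using (tendsto_pow_atTop_nhds_zero_of_lt_one (r := (1 / 2 : ℝ)) (by norm_num)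
      (by norm_num)).const_mul t
  simp only [h, hS.zero] at h1
  exact tendsto_nhds_unique h1 tendsto_const_nhds

/-- The vector `z` stands for `G⁻¹ S t x`. If `G (w n) → x`, smoothing makes `S t (w n)` a Cauchy
sequence, and its limit has the right image under `G`. -/
theorem IsHeatSemigroup.exists_preimage (hG : IsGreenOperator G) (hS : IsHeatSemigroup G S)
    {t : ℝ} (ht : 0 < t) (x : H) : ∃ z, G z = S t x ∧ ‖z‖ ≤ t⁻¹ * ‖x‖ := by
  have hx : ∀ n : ℕ, ∃ w, dist x (G w) < 1 / ((n : ℝ) + 1) := fun n => by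
    obtain ⟨_, ⟨w, rfl⟩, hw⟩ := Metric.mem_closure_iff.1 (hG.denseRange x) (1 / ((n : ℝ) + 1))
      (by positivity)
    exact ⟨w, hw⟩
  choose w hw using hx
  have hlim : Tendsto (fun n => G (w n)) atTop (𝓝 x) := by
    rw [tendsto_iff_dist_tendsto_zero]
    refine squeeze_zero (fun _ => dist_nonneg) (fun n => ?_)
      tendsto_one_div_add_atTop_nhds_zero_nat
    rw [dist_comm]; exact (hw n).le
  have hle : ∀ z, ‖S t z‖ ≤ t⁻¹ * ‖G z‖ := fun z => by
    rw [inv_mul_eq_div, le_div_iff₀ ht, mul_comm]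
    exact hS.mul_norm_le hG ht.le z
  have hc : CauchySeq fun n => S t (w n) := by
    have := hlim.cauchySeq
    rw [Metric.cauchySeq_iff] at this ⊢
    intro e he
    obtain ⟨N, hN⟩ := this (t * e) (by positivity)
    refine ⟨N, fun m hm n hn => ?_⟩
    have h1 := hN m hm n hn
    rw [dist_eq_norm, ← map_sub] at h1 ⊢
    refine (hle _).trans_lt ?_
    rwa [inv_mul_lt_iff₀ ht]
  obtain ⟨z, hz⟩ := cauchySeq_tendsto_of_complete hc
  refine ⟨z, ?_, le_of_tendsto_of_tendsto' hz.norm (hlim.norm.const_mul _) fun n => hle _⟩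
  refine tendsto_nhds_unique ((G.continuous.tendsto _).comp hz) ?_
  refine (((S t).continuous.tendsto _).comp hlim).congr fun n => ?_
  exact (hS.comm _ _).symm

/-- Here `z i` plays the role of `(-Δ)ⁱ S t x`. Splitting `t` into `n` equal steps, each power of
the Laplacian consumes one step and costs a factor `n / t`; this growth is what gives spatial
analyticity. -/
theorem IsHeatSemigroup.exists_chain (hG : IsGreenOperator G) (hS : IsHeatSemigroup G S)
    {t : ℝ} (ht : 0 < t) (x : H) {n : ℕ} (hn : 0 < n) :
    ∃ z : ℕ → H, z 0 = S t x ∧ (∀ i < n, G (z (i + 1)) = z i) ∧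
      ∀ i, ‖z i‖ ≤ ((n : ℝ) / t) ^ i * ‖x‖ := by
  have hn' : (0 : ℝ) < n := by exact_mod_cast hn
  set τ : ℝ := t / n with hτ
  have hτ0 : 0 < τ := by positivity
  choose κ hκ1 hκ2 using hS.exists_preimage hG hτ0
  -- The iterate `κ^[i] x` has used `i` of the steps and `n - i` remain. For `i > n` the time is
  -- negative, which is harmless since the norm bound holds at all times.
  refine ⟨fun i => S (((n : ℝ) - i) * τ) (κ^[i] x), ?_, ?_, ?_⟩
  · simp only [Nat.cast_zero, sub_zero, Function.iterate_zero, id]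
    congr 2
    rw [hτ]; field_simp
  · intro i hi
    have hi' : (0 : ℝ) ≤ (n : ℝ) - (i + 1) := by
      have : ((i + 1 : ℕ) : ℝ) ≤ n := by exact_mod_cast hi
      push_cast at this; linarith
    simp only [Nat.cast_add, Nat.cast_one, Function.iterate_succ_apply']
    rw [hS.comm, hκ1, ← hS.add _ _ (by positivity) hτ0.le]
    congr 2
    ring
  · intro i
    refine (hS.norm_le _ _).trans ?_
    induction i with
    | zero => simp
    | succ i ih =>
      rw [Function.iterate_succ_apply']
      refine (hκ2 _).trans ?_
      rw [pow_succ, mul_right_comm, mul_comm]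
      have : τ⁻¹ = n / t := by rw [hτ, inv_div]
      rw [this]
      gcongr

omit [CompleteSpace H] in
theorem IsHeatSemigroup.continuous_uncurry (hS : IsHeatSemigroup G S) :
    Continuous fun p : ℝ × H => S p.1 p.2 := by
  rw [continuous_iff_continuousAt]
  rintro ⟨t, x⟩
  rw [ContinuousAt, tendsto_iff_norm_sub_tendsto_zero]
  have h1 : Tendsto (fun p : ℝ × H => ‖p.2 - x‖ + ‖S p.1 x - S t x‖) (𝓝 (t, x)) (𝓝 0) := by
    have : Continuous fun p : ℝ × H => ‖p.2 - x‖ + ‖S p.1 x - S t x‖ :=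
      (continuous_snd.sub continuous_const).norm.add
        ((((hS.continuous x).comp continuous_fst).sub continuous_const).norm)
    simpa using this.tendsto (t, x)
  refine squeeze_zero (fun _ => norm_nonneg _) (fun p => ?_) h1
  calc ‖S p.1 p.2 - S t x‖ = ‖S p.1 (p.2 - x) + (S p.1 x - S t x)‖ := by rw [map_sub]; abel_nf
    _ ≤ _ := (norm_add_le _ _).trans (by gcongr; exact hS.norm_le _ _)

/-- Fubini's theorem on a triangle. -/
theorem intervalIntegral_triangle_swap {E : Type*} [NormedAddCommGroup E] [NormedSpace ℝ E]
    {k : ℝ → ℝ → E} {t : ℝ} (ht : 0 ≤ t)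
    (hk : Integrable (Function.uncurry k)
      ((volume.restrict (Ioc 0 t)).prod (volume.restrict (Ioc 0 t)))) :
    ∫ σ in (0 : ℝ)..t, ∫ s in (0 : ℝ)..σ, k σ s = ∫ s in (0 : ℝ)..t, ∫ σ in s..t, k σ s := by
  have hm : MeasurableSet {p : ℝ × ℝ | p.2 < p.1} := measurableSet_lt measurable_snd measurable_fst
  have hi := hk.indicator hm
  have hsw := integral_integral_swap (f := fun σ s =>
    {p : ℝ × ℝ | p.2 < p.1}.indicator (Function.uncurry k) (σ, s)) hi
  rw [intervalIntegral.integral_of_le ht, intervalIntegral.integral_of_le ht]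
  convert hsw using 1
  · refine setIntegral_congr_fun measurableSet_Ioc fun σ hσ => ?_
    have : (fun s => {p : ℝ × ℝ | p.2 < p.1}.indicator (Function.uncurry k) (σ, s)) =
        (Iio σ).indicator (k σ) := by
      ext s; simp [indicator, Function.uncurry]
    rw [this, integral_indicator measurableSet_Iio, Measure.restrict_restrict measurableSet_Iio,
      intervalIntegral.integral_of_le hσ.1.le, integral_Ioc_eq_integral_Ioo]
    congr 2
    ext s; simp only [mem_inter_iff, mem_Iio, mem_Ioc, mem_Ioo]
    constructor
    · rintro ⟨h1, h2⟩; exact ⟨h2, h1, by linarith [hσ.2]⟩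
    · rintro ⟨h1, h2, h3⟩; exact ⟨h2, h1⟩
  · refine setIntegral_congr_fun measurableSet_Ioc fun s hs => ?_
    have : (fun σ => {p : ℝ × ℝ | p.2 < p.1}.indicator (Function.uncurry k) (σ, s)) =
        (Ioi s).indicator (fun σ => k σ s) := by
      ext σ; simp [indicator, Function.uncurry]
    rw [this, integral_indicator measurableSet_Ioi, Measure.restrict_restrict measurableSet_Ioi,
      intervalIntegral.integral_of_le hs.2]
    congr 2
    ext σ; simp only [mem_inter_iff, mem_Ioi, mem_Ioc]
    constructor
    · rintro ⟨h1, h2⟩; exact ⟨h1, by linarith [hs.1], h2⟩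
    · rintro ⟨h1, h2, h3⟩; exact ⟨h1, h3⟩

/-- The Duhamel integral. -/
noncomputable def duhamel (S : ℝ → H →L[ℝ] H) (f : ℝ → H) (t : ℝ) : H :=
  ∫ s in (0 : ℝ)..t, S (t - s) (f s)

section

variable (hS : IsHeatSemigroup G S) {f : ℝ → H} (hf : ∀ t, IntegrableOn f (Ioc 0 t))
include hS hf

omit [CompleteSpace H] in
theorem IsHeatSemigroup.integrableOn_duhamel (t T : ℝ) :
    IntegrableOn (fun s => S (t - s) (f s)) (Ioc 0 T) := by
  refine Integrable.mono (hf T) ?_ (Eventually.of_forall fun s => hS.norm_le _ _)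
  exact hS.continuous_uncurry.comp_aestronglyMeasurable
    (f := fun s => (t - s, f s))
    ((continuous_const.sub continuous_id).aestronglyMeasurable.prodMk (hf T).1)

theorem IsHeatSemigroup.inner_duhamel {t : ℝ} (ht : 0 ≤ t) (η : H) :
    ⟪duhamel S f t, η⟫ = ∫ s in (0 : ℝ)..t, ⟪f s, S (t - s) η⟫ := by
  have := (innerSL ℝ η).intervalIntegral_comp_comm
    ((intervalIntegrable_iff_integrableOn_Ioc_of_le ht).2 (hS.integrableOn_duhamel hf t t))
  simp only [innerSL_apply_apply] at this
  rw [real_inner_comm, duhamel, ← this]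
  refine intervalIntegral.integral_congr fun s _ => ?_
  rw [real_inner_comm, hS.symm]

omit [CompleteSpace H] in
theorem IsHeatSemigroup.continuousOn_duhamel : ContinuousOn (duhamel S f) (Ici 0) := by
  intro t ht
  -- Integrating an indicator over the fixed interval `(0, t + 1]` permits dominated convergence;
  -- the integrand is continuous in `t'` at `t` for every `s ≠ t`.
  have h1 : ContinuousWithinAt (fun t' => ∫ s in Ioc 0 (t + 1),
      (Iio t').indicator (fun s => S (t' - s) (f s)) s) (Iio (t + 1) ∩ Ici 0) t := by
    apply continuousWithinAt_of_dominated (bound := fun s => ‖f s‖)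
    · refine Eventually.of_forall fun t' => ?_
      exact (hS.integrableOn_duhamel hf t' (t + 1)).1.indicator measurableSet_Iio
    · refine Eventually.of_forall fun t' => Eventually.of_forall fun s => ?_
      exact (norm_indicator_le_norm_self _ _).trans (hS.norm_le _ _)
    · exact (hf (t + 1)).norm
    · have h0 : ∀ᵐ s ∂(volume.restrict (Ioc 0 (t + 1))), s ≠ t :=
        ae_restrict_of_ae (Measure.ae_ne volume t)
      filter_upwards [h0] with s hs
      apply ContinuousAt.continuousWithinAt
      rcases lt_or_gt_of_ne hs with h | h
      · have : (fun t' => S (t' - s) (f s)) =ᶠ[𝓝 t]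
            fun t' => (Iio t').indicator (fun s => S (t' - s) (f s)) s := by
          filter_upwards [Ioi_mem_nhds h] with t' ht'
          rw [indicator_of_mem]; exact ht'
        exact (((hS.continuous (f s)).comp (continuous_id.sub continuous_const)).continuousAt).congr
          this
      · have : (fun t' => (0 : H)) =ᶠ[𝓝 t]
            fun t' => (Iio t').indicator (fun s => S (t' - s) (f s)) s := by
          filter_upwards [Iio_mem_nhds h] with t' ht'
          rw [indicator_of_notMem]; exact not_lt.2 (le_of_lt (mem_Iio.1 ht'))
        exact continuousAt_const.congr this
  have h2 : ∀ t' ∈ Iio (t + 1) ∩ Ici 0, duhamel S f t' = ∫ s in Ioc 0 (t + 1),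
      (Iio t').indicator (fun s => S (t' - s) (f s)) s := by
    rintro t' ⟨h1, h2⟩
    rw [integral_indicator measurableSet_Iio, Measure.restrict_restrict measurableSet_Iio,
      duhamel, intervalIntegral.integral_of_le h2, integral_Ioc_eq_integral_Ioo]
    congr 2
    ext s; simp only [mem_inter_iff, mem_Iio, mem_Ioc, mem_Ioo] at h1 ⊢
    constructor
    · rintro ⟨h3, h4⟩; exact ⟨h4, h3, by linarith⟩
    · rintro ⟨h3, h4, h5⟩; exact ⟨h4, h3⟩
  have h3 : ContinuousWithinAt (duhamel S f) (Iio (t + 1) ∩ Ici 0) t :=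
    h1.congr h2 (h2 t ⟨by simp, ht⟩)
  exact (continuousWithinAt_inter' (mem_nhdsWithin_of_mem_nhds
    (Iio_mem_nhds (lt_add_one t)))).1 (by rwa [inter_comm] at h3)

/-- After Fubini on the triangle, the inner integral of `S (σ - s) (f s)` over `σ ∈ [s, t]` is `G (f
s) - G (S (t - s) (f s))`. -/
theorem IsHeatSemigroup.duhamel_equation {t : ℝ} (ht : 0 ≤ t) :
    G (duhamel S f t) + ∫ σ in (0 : ℝ)..t, duhamel S f σ = ∫ s in (0 : ℝ)..t, G (f s) := by
  have hII : ∀ g : ℝ → H, IntegrableOn g (Ioc 0 t) → IntervalIntegrable g volume 0 t := fun g hg =>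
    (intervalIntegrable_iff_integrableOn_Ioc_of_le ht).2 hg
  have hsw : ∫ σ in (0 : ℝ)..t, duhamel S f σ =
      ∫ s in (0 : ℝ)..t, ∫ σ in s..t, S (σ - s) (f s) := by
    apply intervalIntegral_triangle_swap ht
    have hb : Integrable (fun p : ℝ × ℝ => f p.2)
        ((volume.restrict (Ioc 0 t)).prod (volume.restrict (Ioc 0 t))) := (hf t).comp_snd _
    refine hb.mono ?_ (Eventually.of_forall fun p => hS.norm_le _ _)
    exact hS.continuous_uncurry.comp_aestronglyMeasurable
      (f := fun p : ℝ × ℝ => (p.1 - p.2, f p.2))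
      ((continuous_fst.sub continuous_snd).aestronglyMeasurable.prodMk hb.1)
  have h1 : ∫ s in (0 : ℝ)..t, ∫ σ in s..t, S (σ - s) (f s) =
      ∫ s in (0 : ℝ)..t, (G (f s) - G (S (t - s) (f s))) := by
    refine intervalIntegral.integral_congr fun s hs => ?_
    rw [uIcc_of_le ht] at hs
    rw [intervalIntegral.integral_comp_sub_right (fun σ => S σ (f s)) s, sub_self,
      hS.integral _ (by linarith [hs.2])]
  have hGf : IntervalIntegrable (fun s => G (f s)) volume 0 t := hII _ (G.integrable_comp (hf t))
  have hGS : IntervalIntegrable (fun s => G (S (t - s) (f s))) volume 0 t :=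
    hII _ (G.integrable_comp (hS.integrableOn_duhamel hf t t))
  rw [hsw, h1, intervalIntegral.integral_sub hGf hGS, duhamel,
    G.intervalIntegral_comp_comm (hII _ (hS.integrableOn_duhamel hf t t))]
  abel

/-- The mild solution satisfies the integrated heat equation. -/
theorem IsHeatSemigroup.mild_equation (y₀ : H) {t : ℝ} (ht : 0 ≤ t) :
    G (S t y₀ + duhamel S f t) - G y₀ + ∫ σ in (0 : ℝ)..t, (S σ y₀ + duhamel S f σ) =
      ∫ s in (0 : ℝ)..t, G (f s) := by
  have hc : IntervalIntegrable (duhamel S f) volume 0 t :=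
    ((hS.continuousOn_duhamel hf).mono
      (by rw [uIcc_of_le ht]; exact Icc_subset_Ici_self)).intervalIntegrable
  rw [intervalIntegral.integral_add ((hS.continuous y₀).intervalIntegrable _ _) hc,
    hS.integral t ht, ← hS.duhamel_equation hf ht, map_add]
  abel

end

/-- Uniqueness for the integrated heat equation. -/
theorem IsGreenOperator.eq_zero_of_equation (hG : IsGreenOperator G) {w : ℝ → H}
    (hw : ContinuousOn w (Ici 0)) (h : ∀ t, 0 ≤ t → G (w t) + ∫ s in (0 : ℝ)..t, w s = 0) :
    ∀ t, 0 ≤ t → w t = 0 := by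
  set v : ℝ → H := fun t => w (max t 0) with hv
  have hvc : Continuous v :=
    hw.comp_continuous (continuous_id.max continuous_const) fun t => mem_Ici.2 (le_max_right _ _)
  set V : ℝ → H := fun t => ∫ s in (0 : ℝ)..t, v s with hV
  have hVd : ∀ t, HasDerivAt V (v t) t := fun t => hvc.integral_hasStrictDerivAt 0 t |>.hasDerivAt
  have heq : ∀ t, 0 ≤ t → G (v t) + V t = 0 := by
    intro t ht
    have : V t = ∫ s in (0 : ℝ)..t, w s := by
      refine intervalIntegral.integral_congr fun s hs => ?_
      rw [uIcc_of_le ht] at hs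
      simp [hv, max_eq_left hs.1]
    rw [this]
    simpa [hv, max_eq_left ht] using h t ht
  -- The primitive `V` satisfies `G V' = -V`. Hence `⟪G V, V⟫` is nonnegative, vanishes at time zero
  -- and has derivative `-2 ‖V‖²`, so it is identically zero.
  have hd : ∀ t, 0 ≤ t → HasDerivAt (fun t => ⟪G (V t), V t⟫) (-2 * ‖V t‖ ^ 2) t := by
    intro t ht
    have h1 := (G.hasFDerivAt.comp_hasDerivAt t (hVd t)).inner ℝ (hVd t)
    refine h1.congr_deriv ?_
    have h2 : G (v t) = -V t := eq_neg_of_add_eq_zero_left (heq t ht)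
    rw [Function.comp_apply, hG.symm (V t), h2, inner_neg_left, inner_neg_right,
      real_inner_self_eq_norm_sq]
    ring
  have hanti : AntitoneOn (fun t => ⟪G (V t), V t⟫) (Ici 0) := by
    apply antitoneOn_of_deriv_nonpos (convex_Ici 0)
    · exact fun t ht => (hd t ht).continuousAt.continuousWithinAt
    · intro t ht
      rw [interior_Ici] at ht
      exact (hd t (le_of_lt ht)).differentiableAt.differentiableWithinAt
    · intro t ht
      rw [interior_Ici] at ht
      rw [(hd t (le_of_lt ht)).deriv]
      nlinarith [sq_nonneg ‖V t‖]
  have hV0 : V 0 = 0 := by simp [hV]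
  have hz : ∀ t, 0 ≤ t → ⟪G (V t), V t⟫ = 0 := fun t ht => by
    refine le_antisymm ?_ (hG.nonneg _)
    have := hanti (mem_Ici.2 le_rfl) (mem_Ici.2 ht) ht
    simpa [hV0] using this
  have hVz : ∀ t, 0 ≤ t → V t = 0 := fun t ht => by
    apply hG.inj
    have := hG.norm_sq_le (V t)
    rw [hz t ht, mul_zero] at this
    simpa using le_antisymm this (sq_nonneg _)
  intro t ht
  have := heq t ht
  rw [hVz t ht, add_zero] at this
  have := hG.inj _ this
  simpa [hv, max_eq_left ht] using this

/-- The energy identity for an absolutely continuous curve. -/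
theorem norm_sq_of_integral {p q : ℝ → H} {p₀ : H} {T : ℝ} (hT : 0 ≤ T)
    (hq : IntegrableOn q (Ioc 0 T))
    (hp : ∀ t ∈ Icc 0 T, p t = p₀ + ∫ s in (0 : ℝ)..t, q s) :
    ‖p T‖ ^ 2 = ‖p₀‖ ^ 2 + 2 * ∫ t in (0 : ℝ)..T, ⟪q t, p t⟫ := by
  have hqi : IntervalIntegrable q volume 0 T :=
    (intervalIntegrable_iff_integrableOn_Ioc_of_le hT).2 hq
  have hsub : ∀ a b, a ∈ Icc 0 T → b ∈ Icc 0 T → IntervalIntegrable q volume a b :=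
    fun a b ha hb => hqi.mono_set (by
      rw [uIcc_of_le hT]
      exact uIcc_subset_Icc ha hb)
  have hin : ∀ a b c, a ∈ Icc 0 T → b ∈ Icc 0 T →
      ∫ s in a..b, ⟪c, q s⟫ = ⟪c, ∫ s in a..b, q s⟫ := fun a b c ha hb => by
    have := (innerSL ℝ c).intervalIntegral_comp_comm (hsub a b ha hb)
    simpa only [innerSL_apply_apply] using this
  have h0 : (0 : ℝ) ∈ Icc 0 T := ⟨le_rfl, hT⟩
  have hTT : T ∈ Icc 0 T := ⟨hT, le_rfl⟩
  have hk : Integrable (Function.uncurry fun σ s => ⟪q σ, q s⟫)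
      ((volume.restrict (Ioc 0 T)).prod (volume.restrict (Ioc 0 T))) := by
    refine (hq.norm.mul_prod hq.norm).mono ?_ (Eventually.of_forall fun p => ?_)
    · exact ((hq.comp_fst _).1).inner ((hq.comp_snd _).1)
    · simpa [Function.uncurry] using norm_inner_le_norm (𝕜 := ℝ) (q p.1) (q p.2)
  -- Since `q` is merely integrable, Fubini on the triangle replaces the chain rule: it gives `2 ∫
  -- ⟪q t, ∫₀ᵗ q⟫ = ‖∫ q‖²`.
  have hsw := intervalIntegral_triangle_swap hT hk
  set Q : H := ∫ s in (0 : ℝ)..T, q s with hQ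
  have hI1 : IntervalIntegrable (fun t => ⟪q t, ∫ s in (0 : ℝ)..t, q s⟫) volume 0 T := by
    have hc : ContinuousOn (fun t => ∫ s in (0 : ℝ)..t, q s) (uIcc 0 T) :=
      intervalIntegral.continuousOn_primitive_interval
        (by rw [uIcc_of_le hT]; exact (integrableOn_Icc_iff_integrableOn_Ioc (by simp)).2 hq)
    rw [uIcc_of_le hT] at hc
    obtain ⟨C, hC⟩ := isCompact_Icc.exists_bound_of_continuousOn hc
    rw [intervalIntegrable_iff_integrableOn_Ioc_of_le hT]
    refine (hq.norm.mul_const C).mono' (hq.1.inner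
      ((hc.mono Ioc_subset_Icc_self).aestronglyMeasurable measurableSet_Ioc)) ?_
    filter_upwards [ae_restrict_mem measurableSet_Ioc] with t ht
    refine (norm_inner_le_norm _ _).trans ?_
    gcongr
    exact hC t (Ioc_subset_Icc_self ht)
  have e1 : ∫ σ in (0 : ℝ)..T, ∫ s in (0 : ℝ)..σ, ⟪q σ, q s⟫ =
      ∫ t in (0 : ℝ)..T, ⟪q t, ∫ s in (0 : ℝ)..t, q s⟫ := by
    refine intervalIntegral.integral_congr fun σ hσ => ?_
    rw [uIcc_of_le hT] at hσ
    exact hin _ _ _ h0 hσ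
  have hqc : ∀ c, IntervalIntegrable (fun t => ⟪q t, c⟫) volume 0 T := fun c => by
    have := (innerSL ℝ c).integrable_comp hq
    rw [intervalIntegrable_iff_integrableOn_Ioc_of_le hT]
    refine this.congr (Eventually.of_forall fun t => ?_)
    simp [real_inner_comm]
  have e2 : ∫ s in (0 : ℝ)..T, ∫ σ in s..T, ⟪q σ, q s⟫ =
      ∫ t in (0 : ℝ)..T, (⟪q t, Q⟫ - ⟪q t, ∫ s in (0 : ℝ)..t, q s⟫) := by
    refine intervalIntegral.integral_congr fun s hs => ?_
    rw [uIcc_of_le hT] at hs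
    rw [← inner_sub_right, hQ, intervalIntegral.integral_interval_sub_left (hsub _ _ h0 hTT)
      (hsub _ _ h0 hs), ← hin _ _ _ hs hTT]
    simp only [real_inner_comm]
  have e3 : ∀ c, ∫ t in (0 : ℝ)..T, ⟪q t, c⟫ = ⟪c, Q⟫ := fun c => by
    rw [hQ, ← hin _ _ _ h0 hTT]
    simp only [real_inner_comm]
  rw [e1, e2, intervalIntegral.integral_sub (hqc Q) hI1, e3, real_inner_self_eq_norm_sq] at hsw
  have e4 : ∫ t in (0 : ℝ)..T, ⟪q t, p t⟫ =
      ⟪p₀, Q⟫ + ∫ t in (0 : ℝ)..T, ⟪q t, ∫ s in (0 : ℝ)..t, q s⟫ := by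
    rw [← e3, ← intervalIntegral.integral_add (hqc _) hI1]
    refine intervalIntegral.integral_congr fun t ht => ?_
    rw [uIcc_of_le hT] at ht
    rw [hp t ht, inner_add_right]
  rw [e4, hp T hTT, norm_add_sq_real]
  linarith

end Duhamel
-- Norms and convergence in `L²`
section L2Basics

variable {α E : Type*} [MeasurableSpace α] {μ : Measure α} [NormedAddCommGroup E]

theorem integral_norm_sq_Lp [InnerProductSpace ℝ E] (f : Lp E 2 μ) :
    ∫ a, ‖f a‖ ^ 2 ∂μ = ‖f‖ ^ 2 := by
  rw [← real_inner_self_eq_norm_sq, L2.inner_def]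
  simp only [real_inner_self_eq_norm_sq]

theorem norm_sq_toLp [InnerProductSpace ℝ E] {f : α → E} (hf : MemLp f 2 μ) :
    ‖hf.toLp f‖ ^ 2 = ∫ a, ‖f a‖ ^ 2 ∂μ := by
  rw [← integral_norm_sq_Lp]
  exact integral_congr_ae (hf.coeFn_toLp.mono fun a ha => by simp only [ha])

theorem tendsto_toLp_of_dominated [InnerProductSpace ℝ E] {f : ℕ → α → E} {g : α → E}
    (hf : ∀ n, MemLp (f n) 2 μ) (hg : MemLp g 2 μ) {b : α → ℝ} (hb : MemLp b 2 μ)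
    (hfb : ∀ n, ∀ᵐ a ∂μ, ‖f n a - g a‖ ≤ b a)
    (h : ∀ᵐ a ∂μ, Tendsto (fun n => f n a) atTop (𝓝 (g a))) :
    Tendsto (fun n => (hf n).toLp (f n)) atTop (𝓝 (hg.toLp g)) := by
  rw [tendsto_iff_norm_sub_tendsto_zero]
  have h1 : Tendsto (fun n => ∫ a, ‖f n a - g a‖ ^ 2 ∂μ) atTop (𝓝 (∫ _, (0 : ℝ) ∂μ)) := by
    apply tendsto_integral_of_dominated_convergence (fun a => b a ^ 2)
    · exact fun n => (((hf n).sub hg).norm.integrable_sq).1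
    · exact hb.integrable_sq
    · intro n
      filter_upwards [hfb n] with a ha
      rw [Real.norm_of_nonneg (by positivity)]
      gcongr
    · filter_upwards [h] with a ha
      have := (tendsto_iff_norm_sub_tendsto_zero.1 ha).pow 2
      simpa using this
  have h2 : ∀ n, ‖(hf n).toLp (f n) - hg.toLp g‖ = √(∫ a, ‖f n a - g a‖ ^ 2 ∂μ) := fun n => by
    rw [← MemLp.toLp_sub, ← Real.sqrt_sq (norm_nonneg _), norm_sq_toLp]
    rfl
  simp only [h2]
  have := (Real.continuous_sqrt.tendsto _).comp h1
  rw [integral_zero, Real.sqrt_zero] at this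
  exact this

end L2Basics

/-! ### Energy estimates; weak solutions are mild solutions -/

section Energy

variable {H : Type*} [NormedAddCommGroup H] [InnerProductSpace ℝ H] [CompleteSpace H]
  {G : H →L[ℝ] H} {S : ℝ → H →L[ℝ] H}

-- Young's inequality with weight `‖G‖`, together with `‖G d‖² ≤ ‖G‖ ⟪G d, d⟫`. It lets the
-- dissipation absorb the forcing term in the energy estimate.
omit [CompleteSpace H] in
theorem IsGreenOperator.two_mul_inner_le (hG : IsGreenOperator G) (a d : H) :
    2 * ⟪a, G d⟫ ≤ ‖G‖ * ‖a‖ ^ 2 + ⟪G d, d⟫ := by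
  have h1 := hG.norm_sq_le d
  rcases eq_or_lt_of_le (norm_nonneg G) with h | h
  · have h0 : G = 0 := norm_eq_zero.1 h.symm
    simp [h0]
  · have h2 : ⟪a, G d⟫ ≤ ‖a‖ * ‖G d‖ := real_inner_le_norm _ _
    have h3 : 0 ≤ (‖G‖ * ‖a‖ - ‖G d‖) ^ 2 := sq_nonneg _
    have h4 : ‖G‖ * (2 * (‖a‖ * ‖G d‖)) ≤ ‖G‖ * (‖G‖ * ‖a‖ ^ 2 + ⟪G d, d⟫) := by nlinarith
    exact (mul_le_mul_of_nonneg_left h2 two_pos.le).trans (le_of_mul_le_mul_left h4 h)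

/-- The error is `ε (G + ε)⁻¹ x`: a contraction applied to `x`, and of size `ε ‖z‖` when `x = G z`.
Density of the range concludes. -/
theorem IsGreenOperator.tendsto_yosida (hG : IsGreenOperator G) (x : H) :
    Tendsto (fun n : ℕ => G (hG.yosida (1 / ((n : ℝ) + 1)) x)) atTop (𝓝 x) := by
  have he : ∀ n : ℕ, 0 < 1 / ((n : ℝ) + 1) := fun n => by positivity
  rw [Metric.tendsto_atTop]
  intro d hd
  obtain ⟨_, ⟨z, rfl⟩, hz⟩ := Metric.mem_closure_iff.1 (hG.denseRange x) (d / 2) (by linarith)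
  have h0 : Tendsto (fun n : ℕ => 1 / ((n : ℝ) + 1) * ‖z‖) atTop (𝓝 0) := by
    simpa using (tendsto_one_div_add_atTop_nhds_zero_nat (𝕜 := ℝ)).mul_const ‖z‖
  obtain ⟨N, hN⟩ := (h0.eventually (gt_mem_nhds (show 0 < d / 2 by linarith))).exists_forall_of_atTop
  refine ⟨N, fun n hn => ?_⟩
  set e := 1 / ((n : ℝ) + 1)
  have key : ∀ y, G (hG.yosida e y) - y = -(e • hG.yosida e y) := fun y => by
    nth_rw 2 [← hG.apply_yosida (he n) y]
    abel
  rw [dist_eq_norm, key, norm_neg]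
  have : e • hG.yosida e x = e • hG.yosida e (x - G z) + e • hG.yosida e (G z) := by
    rw [← smul_add, ← map_add, sub_add_cancel]
  rw [this]
  calc _ ≤ ‖e • hG.yosida e (x - G z)‖ + ‖e • hG.yosida e (G z)‖ := norm_add_le _ _
    _ ≤ ‖x - G z‖ + e * ‖z‖ := by
        rw [norm_smul, norm_smul, Real.norm_of_nonneg (he n).le]
        gcongr
        · exact hG.norm_yosida_le (he n) _
        · exact hG.norm_yosida_G_le (he n) _
    _ < d / 2 + d / 2 := add_lt_add (by rwa [← dist_eq_norm]) (hN n hn)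
    _ = d := add_halves d

/-- The mild solution of `y' + G⁻¹ y = f`, `y 0 = y₀`. -/
noncomputable def mild (S : ℝ → H →L[ℝ] H) (y₀ : H) (f : ℝ → H) (t : ℝ) : H :=
  S t y₀ + duhamel S f t

theorem MemLp.integrableOn_Ioc {E : Type*} [NormedAddCommGroup E] {f : ℝ → E}
    (hf : MemLp f 2 (volume.restrict (Ioi (0 : ℝ)))) (t : ℝ) : IntegrableOn f (Ioc 0 t) :=
  (hf.mono_measure (Measure.restrict_mono Ioc_subset_Ioi_self le_rfl)).integrable (by norm_num)

variable (hG : IsGreenOperator G) (hS : IsHeatSemigroup G S) {f : ℝ → H}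
  (hf : MemLp f 2 (volume.restrict (Ioi (0 : ℝ)))) (y₀ : H)

include hS hf

omit [CompleteSpace H] in
theorem IsHeatSemigroup.continuousOn_mild : ContinuousOn (mild S y₀ f) (Ici 0) :=
  (hS.continuous y₀).continuousOn.add (hS.continuousOn_duhamel (MemLp.integrableOn_Ioc hf))

/-- The curve `G D y` is absolutely continuous even when `y` is not, so the energy identity applies
to it. The operator `D` will be a Yosida operator, or a difference of two, as a bounded substitute
for `G⁻¹`. -/
theorem IsHeatSemigroup.mild_comm {D : H →L[ℝ] H} (hD : ∀ x, D (G x) = G (D x))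
    {t : ℝ} (ht : 0 ≤ t) :
    G (D (mild S y₀ f t)) = G (D y₀) + ∫ s in (0 : ℝ)..t, (G (D (f s)) - D (mild S y₀ f s)) := by
  have h := congrArg D (hS.mild_equation (MemLp.integrableOn_Ioc hf) y₀ ht)
  have hi1 : IntervalIntegrable (mild S y₀ f) volume 0 t :=
    ((hS.continuousOn_mild hf y₀).mono
      (by rw [uIcc_of_le ht]; exact Icc_subset_Ici_self)).intervalIntegrable
  have hi2 : IntervalIntegrable (fun s => G (f s)) volume 0 t :=
    (intervalIntegrable_iff_integrableOn_Ioc_of_le ht).2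
      (G.integrable_comp (MemLp.integrableOn_Ioc hf t))
  change D (G (mild S y₀ f t) - G y₀ + ∫ s in (0 : ℝ)..t, mild S y₀ f s) = _ at h
  rw [map_add, map_sub, hD, hD, ← D.intervalIntegral_comp_comm hi1,
    ← D.intervalIntegral_comp_comm hi2] at h
  simp only [hD] at h
  rw [intervalIntegral.integral_sub, ← h]
  · abel
  · exact (intervalIntegrable_iff_integrableOn_Ioc_of_le ht).2
      (G.integrable_comp (D.integrable_comp (MemLp.integrableOn_Ioc hf t)))
  · exact (intervalIntegrable_iff_integrableOn_Ioc_of_le ht).2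
      (D.integrable_comp ((intervalIntegrable_iff_integrableOn_Ioc_of_le ht).1 hi1))

-- Energy identity for `G D y`, whose derivative is `G D f - D y`: the pairing of `-D y` with `G D
-- y` is the dissipation, and half of the doubled dissipation absorbs the forcing.
include hG in
theorem IsHeatSemigroup.energy_le {D : H →L[ℝ] H} (hD : ∀ x, D (G x) = G (D x))
    {T : ℝ} (hT : 0 ≤ T) :
    ∫ t in (0 : ℝ)..T, ⟪G (D (mild S y₀ f t)), D (mild S y₀ f t)⟫ ≤
      ‖G (D y₀)‖ ^ 2 + ‖G‖ * ∫ t in (0 : ℝ)..T, ‖G (D (f t))‖ ^ 2 := by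
  set y := mild S y₀ f with hy
  have hyc := hS.continuousOn_mild hf y₀
  have hyc' : ContinuousOn y (Icc 0 T) := hyc.mono Icc_subset_Ici_self
  have hDy : ContinuousOn (fun t => D (y t)) (Icc 0 T) := D.continuous.comp_continuousOn hyc'
  have hGDy : ContinuousOn (fun t => G (D (y t))) (Icc 0 T) := G.continuous.comp_continuousOn hDy
  have hII : ∀ {E : Type _} [NormedAddCommGroup E] {g : ℝ → E}, IntegrableOn g (Ioc 0 T) →
      IntervalIntegrable g volume 0 T := fun hg =>
    (intervalIntegrable_iff_integrableOn_Ioc_of_le hT).2 hg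
  have hGDf : MemLp (fun t => G (D (f t))) 2 (volume.restrict (Ioi (0 : ℝ))) :=
    (G.comp D).comp_memLp' hf
  have hq : IntegrableOn (fun s => G (D (f s)) - D (y s)) (Ioc 0 T) :=
    (MemLp.integrableOn_Ioc hGDf T).sub
      ((hDy.integrableOn_Icc).mono_set Ioc_subset_Icc_self)
  have hE := norm_sq_of_integral hT hq (p := fun t => G (D (y t))) (p₀ := G (D y₀))
    (fun t ht => hS.mild_comm hf y₀ hD ht.1)
  have hi1 : IntervalIntegrable (fun t => ⟪G (D (y t)), D (y t)⟫) volume 0 T := by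
    apply ContinuousOn.intervalIntegrable
    rw [uIcc_of_le hT]
    exact hGDy.inner hDy
  have hi2 : IntervalIntegrable (fun t => ‖G (D (f t))‖ ^ 2) volume 0 T :=
    hII ((hGDf.norm.integrable_sq).mono_measure (Measure.restrict_mono Ioc_subset_Ioi_self le_rfl))
  have hi3 : IntervalIntegrable (fun t => ⟪G (D (f t)) - D (y t), G (D (y t))⟫) volume 0 T := by
    obtain ⟨C, hC⟩ := isCompact_Icc.exists_bound_of_continuousOn hGDy
    apply hII
    refine (hq.norm.mul_const C).mono' (hq.1.inner
      ((hGDy.mono Ioc_subset_Icc_self).aestronglyMeasurable measurableSet_Ioc)) ?_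
    filter_upwards [ae_restrict_mem measurableSet_Ioc] with t ht
    refine (norm_inner_le_norm _ _).trans ?_
    gcongr
    exact hC t (Ioc_subset_Icc_self ht)
  have hmono : 2 * ∫ t in (0 : ℝ)..T, ⟪G (D (f t)) - D (y t), G (D (y t))⟫ ≤
      ∫ t in (0 : ℝ)..T, (‖G‖ * ‖G (D (f t))‖ ^ 2 - ⟪G (D (y t)), D (y t)⟫) := by
    rw [← intervalIntegral.integral_const_mul]
    refine intervalIntegral.integral_mono_on hT (hi3.const_mul 2) ((hi2.const_mul _).sub hi1) ?_
    intro t _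
    have := hG.two_mul_inner_le (G (D (f t))) (D (y t))
    rw [inner_sub_left, real_inner_comm (G (D (y t))) (D (y t))]
    linarith
  rw [intervalIntegral.integral_sub (hi2.const_mul _) hi1,
    intervalIntegral.integral_const_mul] at hmono
  have := sq_nonneg ‖G (D (y T))‖
  linarith

variable {W : Type*} [NormedAddCommGroup W] [InnerProductSpace ℝ W] [CompleteSpace W]
  {P : W →L[ℝ] H} (hPG : ∀ x, G x = P (ContinuousLinearMap.adjoint P x))

-- As `⟪G x, x⟫ = ‖P* x‖²`, the energy estimate bounds `P* D y` in `L²` uniformly in the time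
-- horizon. For `D` close to `G⁻¹`, the field `P* D y` approximates the gradient of `y`.
include hG hPG in
theorem IsHeatSemigroup.memLp_adjoint {D : H →L[ℝ] H} (hD : ∀ x, D (G x) = G (D x)) :
    MemLp (fun t => ContinuousLinearMap.adjoint P (D (mild S y₀ f t))) 2
      (volume.restrict (Ioi (0 : ℝ))) ∧
    ∫ t in Ioi (0 : ℝ), ‖ContinuousLinearMap.adjoint P (D (mild S y₀ f t))‖ ^ 2 ≤
      ‖G (D y₀)‖ ^ 2 + ‖G‖ * ∫ t in Ioi (0 : ℝ), ‖G (D (f t))‖ ^ 2 := by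
  set y := mild S y₀ f with hy
  have hyc := hS.continuousOn_mild hf y₀
  have hP : ∀ x, ‖ContinuousLinearMap.adjoint P x‖ ^ 2 = ⟪G x, x⟫ := fun x => by
    rw [hPG, ← real_inner_self_eq_norm_sq, ContinuousLinearMap.adjoint_inner_right]
  have hc : ContinuousOn (fun t => ContinuousLinearMap.adjoint P (D (y t))) (Ici 0) :=
    (ContinuousLinearMap.adjoint P).continuous.comp_continuousOn (D.continuous.comp_continuousOn hyc)
  have hm : AEStronglyMeasurable (fun t => ContinuousLinearMap.adjoint P (D (y t)))
      (volume.restrict (Ioi (0 : ℝ))) :=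
    (hc.mono Ioi_subset_Ici_self).aestronglyMeasurable measurableSet_Ioi
  have hGDf : MemLp (fun t => G (D (f t))) 2 (volume.restrict (Ioi (0 : ℝ))) :=
    (G.comp D).comp_memLp' hf
  set C := ‖G (D y₀)‖ ^ 2 + ‖G‖ * ∫ t in Ioi (0 : ℝ), ‖G (D (f t))‖ ^ 2 with hC
  have hb : ∀ T : ℝ, 0 ≤ T →
      ∫ t in (0 : ℝ)..T, ‖ContinuousLinearMap.adjoint P (D (y t))‖ ^ 2 ≤ C := by
    intro T hT
    simp only [hP]
    refine (hS.energy_le hG hf y₀ hD hT).trans ?_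
    rw [hC, intervalIntegral.integral_of_le hT]
    gcongr
    · exact Eventually.of_forall fun t => by positivity
    · exact hGDf.norm.integrable_sq
    · exact Ioc_subset_Ioi_self
  have hint : IntegrableOn (fun t => ‖ContinuousLinearMap.adjoint P (D (y t))‖ ^ 2)
      (Ioi (0 : ℝ)) := by
    apply integrableOn_Ioi_of_intervalIntegral_norm_bounded (l := atTop) C 0 (b := fun T => T)
    · intro T
      exact (((hc.norm.pow 2).mono Icc_subset_Ici_self).integrableOn_Icc).mono_set
        Ioc_subset_Icc_self
    · exact tendsto_id
    · filter_upwards [eventually_ge_atTop 0] with T hT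
      simpa using hb T hT
  refine ⟨(memLp_two_iff_integrable_sq_norm hm).2 hint, ?_⟩
  refine le_of_tendsto (intervalIntegral_tendsto_integral_Ioi 0 hint tendsto_id) ?_
  filter_upwards [eventually_ge_atTop 0] with T hT
  exact hb T hT

include hG hPG in
/-- The mild solution is a weak solution. -/
theorem IsHeatSemigroup.exists_weak : ∃ γ : Lp W 2 (volume.restrict (Ioi (0 : ℝ))),
    (∀ᵐ t ∂(volume.restrict (Ioi (0 : ℝ))), P (γ t) = mild S y₀ f t) ∧
    ∀ t, 0 ≤ t → ∀ w : W, ⟪mild S y₀ f t, P w⟫ - ⟪y₀, P w⟫ =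
      -(∫ s in (0 : ℝ)..t, ⟪γ s, w⟫) + ∫ s in (0 : ℝ)..t, ⟪f s, P w⟫ := by
  set y := mild S y₀ f with hy
  have hyc := hS.continuousOn_mild hf y₀
  set e : ℕ → ℝ := fun n => 1 / ((n : ℝ) + 1) with he_def
  have he : ∀ n, 0 < e n := fun n => by positivity
  set A : ℕ → H →L[ℝ] H := fun n => hG.yosida (e n) with hA
  have hAc : ∀ n x, A n (G x) = G (A n x) := fun n x => (hG.yosida_G (he n) x).symm
  have hlim : ∀ x, Tendsto (fun n => G (A n x)) atTop (𝓝 x) := hG.tendsto_yosida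
  have hγ := fun n => (hS.memLp_adjoint hG hf y₀ hPG (hAc n)).1
  set γ : ℕ → Lp W 2 (volume.restrict (Ioi (0 : ℝ))) := fun n => (hγ n).toLp _ with hγdef
  have hF : ∀ n, MemLp (fun t => G (A n (f t))) 2 (volume.restrict (Ioi (0 : ℝ))) := fun n =>
    (G.comp (A n)).comp_memLp' hf
  have hFlim : Tendsto (fun n => (hF n).toLp _) atTop (𝓝 (hf.toLp f)) := by
    apply tendsto_toLp_of_dominated hF hf (hf.norm.const_mul 2)
    · refine fun n => Eventually.of_forall fun t => ?_
      have h1 := hG.norm_G_yosida_le (he n) (f t)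
      have h2 := norm_sub_le (G (A n (f t))) (f t)
      linarith
    · exact Eventually.of_forall fun t => hlim (f t)
  -- The estimate for `D = A n - A m` turns convergence of the regularised data into the Cauchy
  -- property of the approximate gradients.
  have hdiff : ∀ n m, ‖γ n - γ m‖ ≤ ‖G (A n y₀) - G (A m y₀)‖ +
      √‖G‖ * ‖(hF n).toLp _ - (hF m).toLp _‖ := by
    intro n m
    have h1 := (hS.memLp_adjoint hG hf y₀ hPG (D := A n - A m) (fun x => by simp [hAc])).2
    have h2 : ‖γ n - γ m‖ ^ 2 ≤ ‖G (A n y₀) - G (A m y₀)‖ ^ 2 +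
        ‖G‖ * ‖(hF n).toLp _ - (hF m).toLp _‖ ^ 2 := by
      rw [hγdef, ← MemLp.toLp_sub, ← MemLp.toLp_sub, norm_sq_toLp, norm_sq_toLp]
      simpa using h1
    refine abs_le_of_sq_le_sq' (h2.trans ?_) (by positivity) |>.2
    nlinarith [Real.sq_sqrt (norm_nonneg G), mul_nonneg (norm_nonneg (G (A n y₀) - G (A m y₀)))
      (mul_nonneg (Real.sqrt_nonneg ‖G‖) (norm_nonneg ((hF n).toLp _ - (hF m).toLp _)))]
  have hcau : CauchySeq γ := by
    have c1 := Metric.cauchySeq_iff.1 (hlim y₀).cauchySeq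
    have c2 := Metric.cauchySeq_iff.1 hFlim.cauchySeq
    rw [Metric.cauchySeq_iff]
    intro d hd
    obtain ⟨N1, h1⟩ := c1 (d / 2) (by linarith)
    obtain ⟨N2, h2⟩ := c2 (d / (2 * (√‖G‖ + 1))) (by positivity)
    refine ⟨max N1 N2, fun n hn m hm => ?_⟩
    have a1 := h1 n (le_of_max_le_left hn) m (le_of_max_le_left hm)
    have a2 := h2 n (le_of_max_le_right hn) m (le_of_max_le_right hm)
    rw [dist_eq_norm] at a1 a2 ⊢
    refine (hdiff n m).trans_lt ?_
    have a3 : √‖G‖ * ‖(hF n).toLp _ - (hF m).toLp _‖ ≤ d / 2 := by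
      calc _ ≤ (√‖G‖ + 1) * (d / (2 * (√‖G‖ + 1))) := by gcongr; linarith
        _ = d / 2 := by field_simp
    linarith
  obtain ⟨g, hg⟩ := cauchySeq_tendsto_of_complete hcau
  refine ⟨g, ?_, ?_⟩
  · obtain ⟨ns, hns, hns2⟩ := (tendstoInMeasure_of_tendsto_Lp hg).exists_seq_tendsto_ae
    have hcoe : ∀ᵐ t ∂(volume.restrict (Ioi (0 : ℝ))), ∀ n, γ n t =
        ContinuousLinearMap.adjoint P (A n (y t)) := ae_all_iff.2 fun n => (hγ n).coeFn_toLp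
    filter_upwards [hns2, hcoe] with t h1 h2
    have h3 := (P.continuous.tendsto _).comp h1
    refine tendsto_nhds_unique h3 ?_
    refine ((hlim (y t)).comp hns.tendsto_atTop).congr fun i => ?_
    simp only [Function.comp_apply, h2, hPG]
  · intro t ht w
    have hμ : (volume.restrict (Ioi (0 : ℝ))) (Ioc 0 t) ≠ ∞ := by
      rw [Measure.restrict_apply measurableSet_Ioc]
      exact ((measure_mono inter_subset_left).trans_lt measure_Ioc_lt_top).ne
    have hinner : ∀ u : Lp W 2 (volume.restrict (Ioi (0 : ℝ))),
        ⟪indicatorConstLp 2 measurableSet_Ioc hμ w, u⟫ = ∫ s in (0 : ℝ)..t, ⟪u s, w⟫ := by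
      intro u
      rw [L2.inner_indicatorConstLp_eq_setIntegral_inner, Measure.restrict_restrict
        measurableSet_Ioc, inter_eq_left.2 Ioc_subset_Ioi_self, intervalIntegral.integral_of_le ht]
      simp only [real_inner_comm]
    have hfi : IntervalIntegrable f volume 0 t :=
      (intervalIntegrable_iff_integrableOn_Ioc_of_le ht).2 (MemLp.integrableOn_Ioc hf t)
    have hpair : ∫ s in (0 : ℝ)..t, ⟪f s, P w⟫ = ⟪∫ s in (0 : ℝ)..t, f s, P w⟫ := by
      have := (innerSL ℝ (P w)).intervalIntegral_comp_comm hfi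
      simp only [innerSL_apply_apply] at this
      rw [real_inner_comm, ← this]
      simp only [real_inner_comm]
    have hn : ∀ n, ⟪G (A n (y t)), P w⟫ - ⟪G (A n y₀), P w⟫ =
        -⟪indicatorConstLp 2 measurableSet_Ioc hμ w, γ n⟫ +
          ⟪G (A n (∫ s in (0 : ℝ)..t, f s)), P w⟫ := by
      intro n
      have h1 := hS.mild_comm hf y₀ (hAc n) ht
      have hAy : IntervalIntegrable (fun s => A n (y s)) volume 0 t :=
        (((A n).continuous.comp_continuousOn hyc).mono
          (by rw [uIcc_of_le ht]; exact Icc_subset_Ici_self)).intervalIntegrable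
      have hGf : IntervalIntegrable (fun s => G (A n (f s))) volume 0 t :=
        (intervalIntegrable_iff_integrableOn_Ioc_of_le ht).2 (MemLp.integrableOn_Ioc (hF n) t)
      rw [intervalIntegral.integral_sub hGf hAy] at h1
      have h2 : ⟪∫ s in (0 : ℝ)..t, A n (y s), P w⟫ =
          ⟪indicatorConstLp 2 measurableSet_Ioc hμ w, γ n⟫ := by
        have := (innerSL ℝ (P w)).intervalIntegral_comp_comm hAy
        simp only [innerSL_apply_apply] at this
        rw [real_inner_comm, ← this, hinner]
        rw [intervalIntegral.integral_of_le ht, intervalIntegral.integral_of_le ht]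
        apply integral_congr_ae
        have := ae_restrict_of_ae_restrict_of_subset (s := Ioc 0 t) (t := Ioi 0) Ioc_subset_Ioi_self
          (hγ n).coeFn_toLp
        filter_upwards [this] with s hs
        rw [hγdef]
        simp only
        rw [hs, ContinuousLinearMap.adjoint_inner_left, real_inner_comm]
      have h3 : ∫ s in (0 : ℝ)..t, G (A n (f s)) = G (A n (∫ s in (0 : ℝ)..t, f s)) :=
        (G.comp (A n)).intervalIntegral_comp_comm hfi
      rw [h1, inner_add_left, inner_sub_left, h2, h3]
      ring
    have hl : ∀ x, Tendsto (fun n => ⟪G (A n x), P w⟫) atTop (𝓝 ⟪x, P w⟫) := fun x =>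
      (hlim x).inner tendsto_const_nhds
    have hl2 : Tendsto (fun n => ⟪indicatorConstLp 2 measurableSet_Ioc hμ w, γ n⟫) atTop
        (𝓝 ⟪indicatorConstLp 2 measurableSet_Ioc hμ w, g⟫) := tendsto_const_nhds.inner hg
    have l1 := (hl (y t)).sub (hl y₀)
    have l2 := hl2.neg.add (hl (∫ s in (0 : ℝ)..t, f s))
    have := tendsto_nhds_unique l1 (l2.congr fun n => (hn n).symm)
    rw [this, hinner, hpair]

include hG hPG in
/-- A weak solution is the mild solution. -/
theorem IsHeatSemigroup.eq_mild {y : ℝ → H} (hy : ContinuousOn y (Ici 0)) {γ : ℝ → W}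
    (hγ : ∀ᵐ t ∂(volume.restrict (Ioi (0 : ℝ))), P (γ t) = y t)
    (h : ∀ t, 0 ≤ t → ∀ w : W, ⟪y t, P w⟫ - ⟪y₀, P w⟫ =
      -(∫ s in (0 : ℝ)..t, ⟪γ s, w⟫) + ∫ s in (0 : ℝ)..t, ⟪f s, P w⟫) :
    ∀ t, 0 ≤ t → y t = mild S y₀ f t := by
  have hmc := hS.continuousOn_mild hf y₀
  suffices ∀ t, 0 ≤ t → y t - mild S y₀ f t = 0 from fun t ht => sub_eq_zero.1 (this t ht)
  apply hG.eq_zero_of_equation (hy.sub hmc)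
  intro t ht
  have hyi : IntervalIntegrable y volume 0 t :=
    (hy.mono (by rw [uIcc_of_le ht]; exact Icc_subset_Ici_self)).intervalIntegrable
  have hmi : IntervalIntegrable (mild S y₀ f) volume 0 t :=
    (hmc.mono (by rw [uIcc_of_le ht]; exact Icc_subset_Ici_self)).intervalIntegrable
  have hfi : IntervalIntegrable f volume 0 t :=
    (intervalIntegrable_iff_integrableOn_Ioc_of_le ht).2 (MemLp.integrableOn_Ioc hf t)
  -- Testing with `w = P* x` and using `P P* = G` converts the weak formulation into the integrated
  -- equation, for which uniqueness is known.
  have key : G (y t) - G y₀ = -(∫ s in (0 : ℝ)..t, y s) + ∫ s in (0 : ℝ)..t, G (f s) := by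
    refine ext_inner_right ℝ fun x => ?_
    have h1 := h t ht (ContinuousLinearMap.adjoint P x)
    rw [← hPG, ← hG.symm, ← hG.symm] at h1
    have h2 : ∫ s in (0 : ℝ)..t, ⟪γ s, ContinuousLinearMap.adjoint P x⟫ =
        ⟪∫ s in (0 : ℝ)..t, y s, x⟫ := by
      have := (innerSL ℝ x).intervalIntegral_comp_comm hyi
      simp only [innerSL_apply_apply] at this
      rw [real_inner_comm, ← this]
      rw [intervalIntegral.integral_of_le ht, intervalIntegral.integral_of_le ht]
      apply integral_congr_ae
      filter_upwards [ae_restrict_of_ae_restrict_of_subset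
        (s := Ioc 0 t) (t := Ioi 0) Ioc_subset_Ioi_self hγ] with s hs
      rw [ContinuousLinearMap.adjoint_inner_right, hs, real_inner_comm]
    have h3 : ∫ s in (0 : ℝ)..t, ⟪f s, G x⟫ = ⟪∫ s in (0 : ℝ)..t, G (f s), x⟫ := by
      have := ((innerSL ℝ x).comp G).intervalIntegral_comp_comm hfi
      simp only [ContinuousLinearMap.comp_apply, innerSL_apply_apply] at this
      rw [real_inner_comm, G.intervalIntegral_comp_comm hfi, ← this]
      refine intervalIntegral.integral_congr fun s _ => ?_
      rw [← hG.symm, real_inner_comm]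
    rw [inner_sub_left, inner_add_left, inner_neg_left, h1, h2, h3]
  have h2 := hS.mild_equation (MemLp.integrableOn_Ioc hf) y₀ ht
  change G (mild S y₀ f t) - G y₀ + ∫ s in (0 : ℝ)..t, mild S y₀ f s = _ at h2
  simp only [Pi.sub_apply]
  rw [map_sub, intervalIntegral.integral_sub hyi hmi]
  rw [← h2] at key
  have : G (y t) = -(∫ s in (0 : ℝ)..t, y s) + (G (mild S y₀ f t) - G y₀ +
    ∫ s in (0 : ℝ)..t, mild S y₀ f s) + G y₀ := by rw [← key]; abel
  rw [this]
  abel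

end Energy
-- Calculus of smooth functions and Poincaré's inequality
section Calculus

variable {d : ℕ}

/-- The functions of class `C^∞`. -/
abbrev IsSmooth (f : Space d → ℝ) : Prop := ContDiff ℝ ((⊤ : ℕ∞) : WithTop ℕ∞) f

/-- The derivative of `f` in the direction `v`. -/
noncomputable def pd (v : Space d) (f : Space d → ℝ) : Space d → ℝ := fun x => fderiv ℝ f x v

/-- The `i`-th vector of the canonical basis. -/
noncomputable abbrev stdVec (i : Fin d) : Space d := EuclideanSpace.single i 1

/-- The Laplacian of `f`. -/
noncomputable def lap (f : Space d → ℝ) : Space d → ℝ :=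
  fun x => ∑ i, pd (stdVec i) (pd (stdVec i) f) x

theorem IsSmooth.pd {f : Space d → ℝ} (hf : IsSmooth f) (v : Space d) : IsSmooth (pd v f) :=
  (hf.fderiv_right (m := ((⊤ : ℕ∞) : WithTop ℕ∞)) (by simp)).clm_apply contDiff_const

theorem IsSmooth.differentiable {f : Space d → ℝ} (hf : IsSmooth f) : Differentiable ℝ f :=
  ContDiff.differentiable hf (by simp)

theorem IsSmooth.lap {f : Space d → ℝ} (hf : IsSmooth f) : IsSmooth (lap f) :=
  ContDiff.sum fun i _ => (hf.pd (stdVec i)).pd (stdVec i)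

theorem tsupport_pd_subset (v : Space d) (f : Space d → ℝ) : tsupport (pd v f) ⊆ tsupport f :=
  tsupport_fderiv_apply_subset ℝ v

theorem hasCompactSupport_pd {f : Space d → ℝ} (hf : HasCompactSupport f) (v : Space d) :
    HasCompactSupport (pd v f) :=
  HasCompactSupport.fderiv_apply (𝕜 := ℝ) hf v

theorem IsTestFunction.pd {Ω : Set (Space d)} {f : Space d → ℝ} (hf : IsTestFunction Ω f)
    (v : Space d) : IsTestFunction Ω (pd v f) :=
  ⟨IsSmooth.pd hf.smooth v, hasCompactSupport_pd hf.compactSupport v,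
    (tsupport_pd_subset v f).trans hf.support_subset⟩

theorem IsTestFunction.add {Ω : Set (Space d)} {f g : Space d → ℝ} (hf : IsTestFunction Ω f)
    (hg : IsTestFunction Ω g) : IsTestFunction Ω (f + g) :=
  ⟨hf.smooth.add hg.smooth, hf.compactSupport.add hg.compactSupport,
    (tsupport_add f g).trans (union_subset hf.support_subset hg.support_subset)⟩

theorem IsTestFunction.zero {Ω : Set (Space d)} : IsTestFunction Ω (0 : Space d → ℝ) :=
  ⟨contDiff_const, HasCompactSupport.zero, by simp [tsupport]⟩

theorem IsTestFunction.smul {Ω : Set (Space d)} {f : Space d → ℝ} (c : ℝ)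
    (hf : IsTestFunction Ω f) : IsTestFunction Ω (c • f) :=
  ⟨hf.smooth.const_smul c, hf.compactSupport.smul_left (f := fun _ => c),
    (tsupport_smul_subset_right (fun _ => c) f).trans hf.support_subset⟩

theorem IsTestFunction.lap {Ω : Set (Space d)} {f : Space d → ℝ} (hf : IsTestFunction Ω f) :
    IsTestFunction Ω (lap f) := by
  have : HeatControl.lap f = ∑ i, HeatControl.pd (stdVec i) (HeatControl.pd (stdVec i) f) := by
    ext x; simp [HeatControl.lap]
  rw [this]
  exact Finset.sum_induction _ (IsTestFunction Ω) (fun _ _ h1 h2 => h1.add h2) IsTestFunction.zero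
    fun i _ => (hf.pd _).pd _

theorem pd_mul {f g : Space d → ℝ} (hf : IsSmooth f) (hg : IsSmooth g) (v x : Space d) :
    pd v (fun y => f y * g y) x = f x * pd v g x + pd v f x * g x := by
  unfold pd
  rw [fderiv_fun_mul (hf.differentiable x) (hg.differentiable x)]
  simp [mul_comm]

theorem integral_mul_pd {f g : Space d → ℝ} (hf : IsSmooth f) (hg : IsSmooth g)
    (hgc : HasCompactSupport g) (v : Space d) :
    ∫ x, f x * pd v g x = -∫ x, pd v f x * g x := by
  apply integral_mul_fderiv_eq_neg_fderiv_mul_of_integrable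
  · exact ((hf.pd v).continuous.mul hg.continuous).integrable_of_hasCompactSupport
      (hgc.mul_left (f := pd v f))
  · exact (hf.continuous.mul (hg.pd v).continuous).integrable_of_hasCompactSupport
      ((hasCompactSupport_pd hgc v).mul_left (f := f))
  · exact (hf.continuous.mul hg.continuous).integrable_of_hasCompactSupport
      (hgc.mul_left (f := f))
  · exact fun x _ => hf.differentiable x
  · exact fun x _ => hg.differentiable x

theorem integral_pd_mul {f g : Space d → ℝ} (hf : IsSmooth f) (hg : IsSmooth g)
    (hfc : HasCompactSupport f) (v : Space d) :
    ∫ x, pd v f x * g x = -∫ x, f x * pd v g x := by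
  have := integral_mul_pd hg hf hfc v
  simp only [mul_comm (g _), mul_comm (pd v g _)] at this
  exact this

theorem gradient_apply (f : Space d → ℝ) (x : Space d) (i : Fin d) :
    gradient f x i = pd (stdVec i) f x := by
  have : ⟪gradient f x, stdVec i⟫ = pd (stdVec i) f x := by
    rw [pd, ← InnerProductSpace.toDual_apply_apply (𝕜 := ℝ), gradient,
      (InnerProductSpace.toDual ℝ (Space d)).apply_symm_apply]
  rw [← this, EuclideanSpace.inner_single_right]
  simp

theorem inner_gradient (f g : Space d → ℝ) (x : Space d) :
    ⟪gradient f x, gradient g x⟫ = ∑ i, pd (stdVec i) f x * pd (stdVec i) g x := by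
  rw [PiLp.inner_apply]
  simp only [gradient_apply]
  refine Finset.sum_congr rfl fun i _ => ?_
  simp [mul_comm]

theorem abs_pd_le (v : Space d) (f : Space d → ℝ) (x : Space d) :
    |pd v f x| ≤ ‖gradient f x‖ * ‖v‖ := by
  have : pd v f x = ⟪gradient f x, v⟫ := by
    rw [pd, ← InnerProductSpace.toDual_apply_apply (𝕜 := ℝ), gradient,
      (InnerProductSpace.toDual ℝ (Space d)).apply_symm_apply]
  rw [this]
  exact abs_real_inner_le_norm _ _

theorem IsSmooth.continuous_gradient {f : Space d → ℝ} (hf : IsSmooth f) :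
    Continuous (gradient f) :=
  (InnerProductSpace.toDual ℝ (Space d)).symm.continuous.comp
    (hf.continuous_fderiv (by simp))

theorem hasCompactSupport_gradient {f : Space d → ℝ} (hf : HasCompactSupport f) :
    HasCompactSupport (gradient f) :=
  (hf.fderiv (𝕜 := ℝ)).comp_left (g := (InnerProductSpace.toDual ℝ (Space d)).symm) (map_zero _)

theorem gradient_add_smooth {f g : Space d → ℝ} (hf : IsSmooth f) (hg : IsSmooth g) :
    gradient (f + g) = gradient f + gradient g := by
  ext x : 1
  simp only [gradient, Pi.add_apply]
  rw [fderiv_add (hf.differentiable x) (hg.differentiable x), map_add]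

theorem gradient_const_smul_smooth {f : Space d → ℝ} (hf : IsSmooth f) (c : ℝ) :
    gradient (c • f) = c • gradient f := by
  ext x : 1
  simp only [gradient, Pi.smul_apply]
  rw [fderiv_const_smul (hf.differentiable x)]
  simp

/-- Green's identity. -/
theorem integral_inner_gradient {f g : Space d → ℝ} (hf : IsSmooth f) (hg : IsSmooth g)
    (hgc : HasCompactSupport g) :
    ∫ x, ⟪gradient f x, gradient g x⟫ = -∫ x, f x * lap g x := by
  simp only [inner_gradient, lap, Finset.mul_sum]
  rw [integral_finsetSum, integral_finsetSum, ← Finset.sum_neg_distrib]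
  · refine Finset.sum_congr rfl fun i _ => ?_
    rw [integral_mul_pd hf (hg.pd _) (hasCompactSupport_pd hgc _), neg_neg]
  · intro i _
    exact (hf.continuous.mul ((hg.pd _).pd _).continuous).integrable_of_hasCompactSupport
      ((hasCompactSupport_pd (hasCompactSupport_pd hgc _) _).mul_left (f := f))
  · intro i _
    exact ((hf.pd _).continuous.mul (hg.pd _).continuous).integrable_of_hasCompactSupport
      ((hasCompactSupport_pd hgc _).mul_left (f := pd (stdVec i) f))

theorem isSmooth_coord (i : Fin d) : IsSmooth fun x : Space d => x i :=
  (EuclideanSpace.proj i : Space d →L[ℝ] ℝ).contDiff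

theorem pd_coord (i : Fin d) (x : Space d) : pd (stdVec i) (fun x : Space d => x i) x = 1 := by
  have : HasFDerivAt (fun x : Space d => x i)
      (EuclideanSpace.proj i : Space d →L[ℝ] ℝ) x :=
    (EuclideanSpace.proj i : Space d →L[ℝ] ℝ).hasFDerivAt
  rw [pd, this.fderiv]
  simp

theorem IsTestFunction.mul_left {Ω : Set (Space d)} {f g : Space d → ℝ} (hf : IsSmooth f)
    (hg : IsTestFunction Ω g) : IsTestFunction Ω fun x => f x * g x :=
  ⟨hf.mul hg.smooth, hg.compactSupport.mul_left (f := f),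
    (tsupport_mul_subset_right (f := f)).trans hg.support_subset⟩

theorem IsTestFunction.integrable {Ω : Set (Space d)} {f : Space d → ℝ}
    (hf : IsTestFunction Ω f) : Integrable f :=
  hf.smooth.continuous.integrable_of_hasCompactSupport hf.compactSupport

theorem integrable_gradient_sq {f : Space d → ℝ} (hf : IsSmooth f) (hc : HasCompactSupport f) :
    Integrable fun x => ‖gradient f x‖ ^ 2 := by
  have h := (hasCompactSupport_gradient hc).norm
  simp only [pow_two]
  exact (hf.continuous_gradient.norm.mul
    hf.continuous_gradient.norm).integrable_of_hasCompactSupport (h.mul_left)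

/-- Poincaré's inequality for test functions. -/
theorem poincare_test (hd : 1 ≤ d) {Ω : Set (Space d)} {R : ℝ} (hR : ∀ x ∈ Ω, ‖x‖ ≤ R)
    {f : Space d → ℝ} (hf : IsTestFunction Ω f) :
    ∫ x, f x ^ 2 ≤ (2 * R) ^ 2 * ∫ x, ‖gradient f x‖ ^ 2 := by
  obtain ⟨i⟩ : Nonempty (Fin d) := ⟨⟨0, hd⟩⟩
  have hs : IsSmooth f := hf.smooth
  have hff : IsTestFunction Ω fun x => f x * f x := hf.mul_left hs
  -- Integrating by parts against the coordinate `x i`, whose own derivative is one, expresses `∫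
  -- f²` as `-∫ x i ∂ᵢ(f²)`; on the bounded set `Ω` the factor `x i` is at most `R`.
  have h1 := integral_mul_pd (isSmooth_coord i) hff.smooth hff.compactSupport (stdVec i)
  simp only [pd_coord, one_mul] at h1
  have hiA : Integrable fun x => f x ^ 2 := by simpa only [pow_two] using hff.integrable
  have hiB : Integrable fun x => ‖gradient f x‖ ^ 2 := integrable_gradient_sq hs hf.compactSupport
  have hiC : Integrable fun x : Space d => x i * pd (stdVec i) (fun x => f x * f x) x :=
    ((hff.pd (stdVec i)).mul_left (isSmooth_coord i)).integrable
  have h2 : ∀ x : Space d, -(x i * pd (stdVec i) (fun x => f x * f x) x) ≤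
      (1 / 2) * f x ^ 2 + (1 / 2) * ((2 * R) ^ 2 * ‖gradient f x‖ ^ 2) := by
    intro x
    rw [pd_mul hs hs]
    by_cases hx : x ∈ Ω
    · have a1 : |x i| ≤ R := (PiLp.norm_apply_le x i).trans (hR x hx)
      have a2 : |pd (stdVec i) f x| ≤ ‖gradient f x‖ := by
        simpa using abs_pd_le (stdVec i) f x
      have a3 : (x i * pd (stdVec i) f x) ^ 2 ≤ R ^ 2 * ‖gradient f x‖ ^ 2 := by
        rw [mul_pow, ← sq_abs (x i), ← sq_abs (pd _ f x)]
        gcongr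
      generalize pd (stdVec i) f x = p at *
      generalize ‖gradient f x‖ = q at *
      generalize x i = c at *
      nlinarith [sq_nonneg (f x + 2 * (c * p))]
    · have : f x = 0 := image_eq_zero_of_notMem_tsupport fun h => hx (hf.support_subset h)
      rw [this]
      simp only [mul_zero, zero_mul, add_zero]
      rw [neg_zero]
      positivity
  have h3 : ∫ x, f x ^ 2 = ∫ x : Space d, -(x i * pd (stdVec i) (fun x => f x * f x) x) := by
    rw [integral_neg, h1, neg_neg]
    simp only [pow_two]
  have h4 := integral_mono hiC.neg ((hiA.const_mul (1 / 2)).add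
    ((hiB.const_mul ((2 * R) ^ 2)).const_mul (1 / 2))) h2
  simp only [Pi.neg_apply, Pi.add_apply] at h4
  rw [integral_add (hiA.const_mul _) ((hiB.const_mul _).const_mul _), integral_const_mul,
    integral_const_mul, integral_const_mul, ← h3] at h4
  linarith

end Calculus
-- The space `H¹₀(Ω)` and multiplication by `χ_ω`
section Dirichlet

variable {d : ℕ} {Ω : Set (Space d)}

theorem IsTestFunction.memLp {φ : Space d → ℝ} (hφ : IsTestFunction Ω φ) (s : Set (Space d)) :
    MemLp φ 2 (volume.restrict s) :=
  hφ.smooth.continuous.memLp_of_hasCompactSupport hφ.compactSupport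

theorem IsTestFunction.memLp_gradient {φ : Space d → ℝ} (hφ : IsTestFunction Ω φ)
    (s : Set (Space d)) : MemLp (gradient φ) 2 (volume.restrict s) :=
  (IsSmooth.continuous_gradient hφ.smooth).memLp_of_hasCompactSupport
    (hasCompactSupport_gradient hφ.compactSupport)

/-- The class of a test function in `L²(Ω)`. -/
noncomputable def IsTestFunction.toL2 {φ : Space d → ℝ} (hφ : IsTestFunction Ω φ) : L2 Ω :=
  (hφ.memLp Ω).toLp φ

/-- The class of the gradient of a test function in `L²(Ω; ℝ^d)`. -/
noncomputable def IsTestFunction.gradL2 {φ : Space d → ℝ} (hφ : IsTestFunction Ω φ) :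
    L2Field Ω :=
  (hφ.memLp_gradient Ω).toLp (gradient φ)

theorem IsTestFunction.setIntegral_eq {φ g : Space d → ℝ} (hφ : IsTestFunction Ω φ)
    (hg : ∀ x, φ x = 0 → g x = 0) : ∫ x in Ω, g x = ∫ x, g x :=
  setIntegral_eq_integral_of_forall_compl_eq_zero fun x hx =>
    hg x (image_eq_zero_of_notMem_tsupport fun h => hx (hφ.support_subset h))

theorem IsTestFunction.gradient_eq_zero {φ : Space d → ℝ} (hφ : IsTestFunction Ω φ) {x : Space d}
    (hx : x ∉ Ω) : gradient φ x = 0 := by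
  ext i
  rw [gradient_apply]
  exact image_eq_zero_of_notMem_tsupport fun h =>
    hx (hφ.support_subset (tsupport_pd_subset _ _ h))

theorem IsTestFunction.inner_toL2 {φ : Space d → ℝ} (hφ : IsTestFunction Ω φ) (u : L2 Ω) :
    ⟪u, hφ.toL2⟫ = ∫ x in Ω, u x * φ x := by
  rw [L2.inner_def]
  refine integral_congr_ae ?_
  filter_upwards [(hφ.memLp Ω).coeFn_toLp] with x hx
  rw [IsTestFunction.toL2, hx]
  simp [mul_comm]

theorem IsTestFunction.inner_gradL2 {φ : Space d → ℝ} (hφ : IsTestFunction Ω φ) (g : L2Field Ω) :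
    ⟪g, hφ.gradL2⟫ = ∫ x in Ω, inner ℝ (g x) (gradient φ x) := by
  rw [L2.inner_def]
  refine integral_congr_ae ?_
  filter_upwards [(hφ.memLp_gradient Ω).coeFn_toLp] with x hx
  rw [IsTestFunction.gradL2, hx]

/-- The pairs `(φ, ∇φ)`, with `φ` a test function. -/
def testPairs (Ω : Set (Space d)) : Submodule ℝ (L2 Ω × L2Field Ω) where
  carrier := {p | ∃ φ : Space d → ℝ, IsTestFunction Ω φ ∧
    (p.1 : Space d → ℝ) =ᵐ[volume.restrict Ω] φ ∧
    (p.2 : Space d → Space d) =ᵐ[volume.restrict Ω] gradient φ}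
  add_mem' := by
    rintro p q ⟨φ, hφ, h1, h2⟩ ⟨ψ, hψ, h3, h4⟩
    refine ⟨φ + ψ, hφ.add hψ, ?_, ?_⟩
    · exact (Lp.coeFn_add _ _).trans (h1.add h3)
    · rw [gradient_add_smooth hφ.smooth hψ.smooth]
      exact (Lp.coeFn_add _ _).trans (h2.add h4)
  zero_mem' := by
    refine ⟨0, IsTestFunction.zero, Lp.coeFn_zero _ _ _, (Lp.coeFn_zero _ _ _).trans ?_⟩
    have : gradient (0 : Space d → ℝ) = 0 := by
      ext x : 1
      simp [gradient]
    rw [this]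
  smul_mem' := by
    rintro c p ⟨φ, hφ, h1, h2⟩
    refine ⟨c • φ, hφ.smul c, ?_, ?_⟩
    · exact (Lp.coeFn_smul _ _).trans (h1.const_smul c)
    · rw [gradient_const_smul_smooth hφ.smooth]
      exact (Lp.coeFn_smul _ _).trans (h2.const_smul c)

theorem mem_testPairs {p : L2 Ω × L2Field Ω} :
    p ∈ testPairs Ω ↔ ∃ φ, ∃ hφ : IsTestFunction Ω φ, p = (hφ.toL2, hφ.gradL2) := by
  constructor
  · rintro ⟨φ, hφ, h1, h2⟩
    refine ⟨φ, hφ, Prod.ext ?_ ?_⟩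
    · exact Lp.ext (h1.trans (hφ.memLp Ω).coeFn_toLp.symm)
    · exact Lp.ext (h2.trans (hφ.memLp_gradient Ω).coeFn_toLp.symm)
  · rintro ⟨φ, hφ, rfl⟩
    exact ⟨φ, hφ, (hφ.memLp Ω).coeFn_toLp, (hφ.memLp_gradient Ω).coeFn_toLp⟩

theorem IsTestFunction.mem_H10Graph {φ : Space d → ℝ} (hφ : IsTestFunction Ω φ) :
    (hφ.toL2, hφ.gradL2) ∈ H10Graph Ω :=
  subset_closure (mem_testPairs.2 ⟨φ, hφ, rfl⟩)

theorem H10Graph_induction {p : L2 Ω × L2Field Ω → Prop} (hp : IsClosed {v | p v})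
    (h : ∀ φ, ∀ hφ : IsTestFunction Ω φ, p (hφ.toL2, hφ.gradL2)) {v : L2 Ω × L2Field Ω}
    (hv : v ∈ H10Graph Ω) : p v := by
  have : H10Graph Ω ⊆ {v | p v} := by
    apply closure_minimal _ hp
    intro v hv
    obtain ⟨φ, hφ, rfl⟩ := mem_testPairs.1 hv
    exact h φ hφ
  exact this hv

theorem poincare (hd : 1 ≤ d) (hΩ : Bornology.IsBounded Ω) :
    ∃ C : ℝ, 0 ≤ C ∧ ∀ v ∈ H10Graph Ω, ‖v.1‖ ≤ C * ‖v.2‖ := by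
  obtain ⟨R, hR0, hR⟩ := hΩ.exists_pos_norm_le
  refine ⟨2 * R, by positivity, fun v hv => ?_⟩
  refine H10Graph_induction (p := fun v => ‖v.1‖ ≤ 2 * R * ‖v.2‖) ?_ ?_ hv
  · exact isClosed_le continuous_fst.norm (continuous_const.mul continuous_snd.norm)
  · intro φ hφ
    have h := poincare_test hd hR hφ
    have h1 : ‖hφ.toL2‖ ^ 2 = ∫ x, φ x ^ 2 := by
      rw [IsTestFunction.toL2, norm_sq_toLp, hφ.setIntegral_eq (fun x hx => by simp [hx])]
      simp
    have h2 : ‖hφ.gradL2‖ ^ 2 = ∫ x, ‖gradient φ x‖ ^ 2 := by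
      rw [IsTestFunction.gradL2, norm_sq_toLp]
      refine setIntegral_eq_integral_of_forall_compl_eq_zero fun x hx => ?_
      rw [hφ.gradient_eq_zero hx]
      simp
    rw [← h1, ← h2, ← mul_pow] at h
    exact abs_le_of_sq_le_sq' h (by positivity) |>.2

/-- The gradients of the functions of `H¹₀(Ω)` form a Hilbert space on which the function depends
continuously on its gradient. -/
theorem exists_potential (hd : 1 ≤ d) (hΩ : Bornology.IsBounded Ω) :
    ∃ (W : Submodule ℝ (L2Field Ω)) (P : W →L[ℝ] L2 Ω), IsClosed (W : Set (L2Field Ω)) ∧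
      ∀ v g, (v, g) ∈ H10Graph Ω ↔ ∃ γ : W, (γ : L2Field Ω) = g ∧ P γ = v := by
  obtain ⟨C, hC, hCv⟩ := poincare hd hΩ
  set V : Submodule ℝ (L2 Ω × L2Field Ω) := (testPairs Ω).topologicalClosure with hV
  have hVc : IsClosed (V : Set (L2 Ω × L2Field Ω)) := (testPairs Ω).isClosed_topologicalClosure
  have : CompleteSpace V := hVc.completeSpace_coe
  let T : V →L[ℝ] L2Field Ω := (ContinuousLinearMap.snd ℝ (L2 Ω) (L2Field Ω)).comp V.subtypeL
  -- Poincaré's inequality bounds the graph norm by the gradient, so projecting onto the gradient is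
  -- an isomorphism onto a closed subspace; `P` is its inverse followed by the first projection.
  have hT : AntilipschitzWith (max C 1).toNNReal T := by
    apply ContinuousLinearMap.antilipschitz_of_bound
    rintro ⟨v, hv⟩
    rw [Real.coe_toNNReal _ (by positivity)]
    have h1 := hCv v hv
    change ‖v‖ ≤ max C 1 * ‖v.2‖
    rw [Prod.norm_def]
    refine max_le (h1.trans ?_) ?_
    · gcongr; exact le_max_left _ _
    · exact le_mul_of_one_le_left (norm_nonneg _) (le_max_right _ _)
  have hcl : IsClosed (range T) := hT.isClosed_range T.uniformContinuous
  let e := T.equivRange hT.injective hcl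
  refine ⟨T.range, ((ContinuousLinearMap.fst ℝ (L2 Ω) (L2Field Ω)).comp V.subtypeL).comp
    (e.symm : T.range →L[ℝ] V), hcl, fun v g => ?_⟩
  constructor
  · intro hvg
    refine ⟨e ⟨(v, g), hvg⟩, rfl, ?_⟩
    simp
  · rintro ⟨γ, rfl, rfl⟩
    obtain ⟨p, rfl⟩ := e.surjective γ
    simp only [ContinuousLinearMap.comp_apply, ContinuousLinearEquiv.coe_coe,
      ContinuousLinearEquiv.symm_apply_apply]
    exact p.2

/-- Green's identity for functions of `H¹₀(Ω)`. -/
theorem inner_gradL2_of_mem {v : L2 Ω} {g : L2Field Ω} (h : (v, g) ∈ H10Graph Ω)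
    {φ : Space d → ℝ} (hφ : IsTestFunction Ω φ) :
    ⟪g, hφ.gradL2⟫ = -⟪v, hφ.lap.toL2⟫ := by
  refine H10Graph_induction (p := fun v => ⟪v.2, hφ.gradL2⟫ = -⟪v.1, hφ.lap.toL2⟫) ?_ ?_ h
  · exact isClosed_eq (continuous_snd.inner continuous_const)
      (continuous_fst.inner continuous_const).neg
  · intro ψ hψ
    simp only
    rw [hφ.inner_gradL2, hφ.lap.inner_toL2]
    have h1 : ∫ x in Ω, ⟪hψ.gradL2 x, gradient φ x⟫ = ∫ x, ⟪gradient ψ x, gradient φ x⟫ := by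
      rw [← setIntegral_eq_integral_of_forall_compl_eq_zero (s := Ω)
        (f := fun x => ⟪gradient ψ x, gradient φ x⟫)
        (fun x hx => by rw [hφ.gradient_eq_zero hx, inner_zero_right])]
      refine integral_congr_ae ?_
      filter_upwards [(hψ.memLp_gradient Ω).coeFn_toLp] with x hx
      rw [IsTestFunction.gradL2, hx]
    have h2 : ∫ x in Ω, hψ.toL2 x * lap φ x = ∫ x, ψ x * lap φ x := by
      rw [← hψ.setIntegral_eq (fun x hx => by rw [hx, zero_mul])]
      refine integral_congr_ae ?_
      filter_upwards [(hψ.memLp Ω).coeFn_toLp] with x hx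
      rw [IsTestFunction.toL2, hx]
    rw [h1, h2, integral_inner_gradient hψ.smooth hφ.smooth hφ.compactSupport]

theorem eq_zero_of_inner_test (hΩ : IsOpen Ω) {v : L2 Ω}
    (h : ∀ φ, ∀ hφ : IsTestFunction Ω φ, ⟪v, hφ.toL2⟫ = 0) : v = 0 := by
  have hv : LocallyIntegrableOn (v : Space d → ℝ) Ω volume := by
    apply locallyIntegrableOn_of_locallyIntegrable_restrict
    exact (Lp.memLp v).locallyIntegrable (by norm_num)
  have := hΩ.ae_eq_zero_of_integral_contDiff_smul_eq_zero hv (fun φ h1 h2 h3 => by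
    have hφ : IsTestFunction Ω φ := ⟨h1, h2, h3⟩
    have := h φ hφ
    rw [hφ.inner_toL2, hφ.setIntegral_eq (fun x hx => by rw [hx, mul_zero])] at this
    simpa [mul_comm] using this)
  apply Lp.ext
  have h2 := (ae_restrict_iff' hΩ.measurableSet).2 this
  filter_upwards [h2, Lp.coeFn_zero ℝ 2 (volume.restrict Ω)] with x hx h0
  rw [hx, h0]; rfl

/-- The multiplication by the characteristic function of `ω`. -/
noncomputable def chi (Ω : Set (Space d)) {ω : Set (Space d)} (hω : MeasurableSet ω) :
    L2 Ω →L[ℝ] L2 Ω :=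
  LinearMap.mkContinuous
    { toFun := fun u => ((Lp.memLp u).indicator hω).toLp (ω.indicator u)
      map_add' := fun u v => by
        apply Lp.ext
        filter_upwards [((Lp.memLp (u + v)).indicator hω).coeFn_toLp,
          ((Lp.memLp u).indicator hω).coeFn_toLp, ((Lp.memLp v).indicator hω).coeFn_toLp,
          Lp.coeFn_add u v, Lp.coeFn_add (((Lp.memLp u).indicator hω).toLp (ω.indicator u))
            (((Lp.memLp v).indicator hω).toLp (ω.indicator v))] with x h1 h2 h3 h4 h5
        rw [h1, h5, Pi.add_apply, h2, h3]
        by_cases hx : x ∈ ω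
        · simp only [indicator_of_mem hx, h4, Pi.add_apply]
        · simp [hx]
      map_smul' := fun c u => by
        apply Lp.ext
        filter_upwards [((Lp.memLp (c • u)).indicator hω).coeFn_toLp,
          ((Lp.memLp u).indicator hω).coeFn_toLp,
          Lp.coeFn_smul c u, Lp.coeFn_smul c (((Lp.memLp u).indicator hω).toLp (ω.indicator u))]
          with x h1 h2 h4 h5
        rw [RingHom.id_apply, h1, h5, Pi.smul_apply, h2]
        by_cases hx : x ∈ ω
        · simp only [indicator_of_mem hx, h4, Pi.smul_apply]
        · simp [hx] }
    1 (fun u => by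
      rw [one_mul]
      apply Lp.norm_le_norm_of_ae_le
      filter_upwards [((Lp.memLp u).indicator hω).coeFn_toLp] with x hx
      simp only [LinearMap.coe_mk, AddHom.coe_mk]
      rw [hx]
      exact norm_indicator_le_norm_self _ _)

theorem chi_coe {ω : Set (Space d)} (hω : MeasurableSet ω) (u : L2 Ω) :
    (chi Ω hω u : Space d → ℝ) =ᵐ[volume.restrict Ω] ω.indicator u :=
  ((Lp.memLp u).indicator hω).coeFn_toLp

theorem norm_chi_le {ω : Set (Space d)} (hω : MeasurableSet ω) (u : L2 Ω) :
    ‖chi Ω hω u‖ ≤ ‖u‖ := by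
  apply Lp.norm_le_norm_of_ae_le
  filter_upwards [chi_coe hω u] with x hx
  rw [hx]
  exact norm_indicator_le_norm_self _ _

theorem chi_symm {ω : Set (Space d)} (hω : MeasurableSet ω) (u v : L2 Ω) :
    ⟪chi Ω hω u, v⟫ = ⟪u, chi Ω hω v⟫ := by
  rw [L2.inner_def, L2.inner_def]
  refine integral_congr_ae ?_
  filter_upwards [chi_coe hω u, chi_coe hω v] with x h1 h2
  rw [h1, h2]
  by_cases hx : x ∈ ω <;> simp [hx]

theorem IsTestFunction.inner_chi {ω : Set (Space d)} (hω : MeasurableSet ω) (hωΩ : ω ⊆ Ω)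
    {φ : Space d → ℝ} (hφ : IsTestFunction Ω φ) (u : L2 Ω) :
    ⟪chi Ω hω u, hφ.toL2⟫ = ∫ x in ω, u x * φ x := by
  rw [hφ.inner_toL2]
  have : ∫ x in Ω, chi Ω hω u x * φ x = ∫ x in Ω, ω.indicator (fun x => u x * φ x) x := by
    refine integral_congr_ae ?_
    filter_upwards [chi_coe hω u] with x hx
    rw [hx]
    by_cases hx : x ∈ ω <;> simp [hx]
  rw [this, integral_indicator hω, Measure.restrict_restrict hω, inter_eq_left.2 hωΩ]

theorem ae_eq_zero_of_chi {ω : Set (Space d)} (hω : MeasurableSet ω) (hωΩ : ω ⊆ Ω) {u : L2 Ω}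
    (h : chi Ω hω u = 0) : ∀ᵐ x ∂(volume.restrict ω), u x = 0 := by
  have h1 : ∀ᵐ x ∂(volume.restrict Ω), ω.indicator (u : Space d → ℝ) x = 0 := by
    filter_upwards [chi_coe hω u, Lp.coeFn_zero ℝ 2 (volume.restrict Ω)] with x h1 h2
    rw [← h1, h, h2]; rfl
  filter_upwards [ae_restrict_of_ae_restrict_of_subset hωΩ h1, ae_restrict_mem hω] with x hx hxω
  rwa [indicator_of_mem hxω] at hx

end Dirichlet

/-! ### The heat semigroup and the weak formulation -/

section HeatEquation

variable {d : ℕ} {Ω : Set (Space d)}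

/-- The forcing term `χ_ω u`. -/
noncomputable def forcing {ω : Set (Space d)} (hω : MeasurableSet ω) (u : Control Ω) (t : ℝ) :
    L2 Ω :=
  chi Ω hω (u t)

theorem memLp_forcing {ω : Set (Space d)} (hω : MeasurableSet ω) (u : Control Ω) :
    MemLp (forcing hω u) 2 (volume.restrict (Ioi (0 : ℝ))) :=
  (chi Ω hω).comp_memLp' (Lp.memLp u)

/-- The solution operators of the heat equation with Dirichlet boundary conditions: the inverse
`G` of `-Δ` and the heat semigroup `S`. -/
theorem exists_heatSemigroup (hd : 1 ≤ d) (hΩ_open : IsOpen Ω) (hΩ : Bornology.IsBounded Ω) :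
    ∃ (G : L2 Ω →L[ℝ] L2 Ω) (S : ℝ → L2 Ω →L[ℝ] L2 Ω), IsGreenOperator G ∧ IsHeatSemigroup G S ∧
      (∀ v φ, ∀ hφ : IsTestFunction Ω φ, ⟪G v, hφ.lap.toL2⟫ = -⟪v, hφ.toL2⟫) ∧
      ∀ (ω : Set (Space d)) (hω : MeasurableSet ω), ω ⊆ Ω → ∀ (y₀ : L2 Ω) (u : Control Ω),
        (IsHeatSolution ω y₀ u (mild S y₀ (forcing hω u))) ∧
        ∀ y, IsHeatSolution ω y₀ u y → ∀ t, 0 ≤ t → y t = mild S y₀ (forcing hω u) t := by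
  obtain ⟨W, P, hWc, hWP⟩ := exists_potential hd hΩ
  have : CompleteSpace W := hWc.completeSpace_coe
  -- By `⟪P* v, γ⟫ = ⟪v, P γ⟫`, the field `P* v` is the gradient of the weak solution of the
  -- Dirichlet problem `-Δ z = v`, and `G v = P (P* v)` is that solution.
  set G : L2 Ω →L[ℝ] L2 Ω := P.comp (ContinuousLinearMap.adjoint P) with hG_def
  have hPG : ∀ x, G x = P (ContinuousLinearMap.adjoint P x) := fun x => rfl
  have htest : ∀ φ, ∀ hφ : IsTestFunction Ω φ,
      ∃ γ : W, (γ : L2Field Ω) = hφ.gradL2 ∧ P γ = hφ.toL2 := fun φ hφ =>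
    (hWP _ _).1 hφ.mem_H10Graph
  have hgraph : ∀ γ : W, (P γ, (γ : L2Field Ω)) ∈ H10Graph Ω := fun γ =>
    (hWP _ _).2 ⟨γ, rfl, rfl⟩
  have hG : IsGreenOperator G := by
    refine ⟨fun x y => ?_, fun x => ?_, fun x hx => ?_⟩
    · rw [hPG, hPG, ← ContinuousLinearMap.adjoint_inner_right,
        ContinuousLinearMap.adjoint_inner_left]
    · rw [hPG, ← ContinuousLinearMap.adjoint_inner_right]
      exact real_inner_self_nonneg
    · have h1 : ContinuousLinearMap.adjoint P x = 0 := by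
        rw [← inner_self_eq_zero (𝕜 := ℝ), ContinuousLinearMap.adjoint_inner_right, ← hPG, hx,
          inner_zero_left]
      apply eq_zero_of_inner_test hΩ_open
      intro φ hφ
      obtain ⟨γ, -, h2⟩ := htest φ hφ
      rw [← h2, ← ContinuousLinearMap.adjoint_inner_left, h1, inner_zero_left]
  obtain ⟨S, hS⟩ := hG.exists_semigroup
  refine ⟨G, S, hG, hS, ?_, ?_⟩
  · intro v φ hφ
    obtain ⟨γ, h1, h2⟩ := htest φ hφ
    have h3 := inner_gradL2_of_mem (hgraph (ContinuousLinearMap.adjoint P v)) hφ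
    rw [← h1, ← Submodule.coe_inner, ContinuousLinearMap.adjoint_inner_left, h2] at h3
    rw [hPG, h3, neg_neg]
  intro ω hω hωΩ y₀ u
  have hf := memLp_forcing hω u
  constructor
  · obtain ⟨γ, hγ1, hγ2⟩ := hS.exists_weak hG hf y₀ hPG
    refine ⟨hS.continuousOn_mild hf y₀, ?_, fun t => (γ t : L2Field Ω), ?_, ?_, ?_⟩
    · simp [mild, duhamel, hS.zero]
    · intro T _
      exact (W.subtypeL.comp_memLp' (Lp.memLp γ)).mono_measure
        (Measure.restrict_mono Ioo_subset_Ioi_self le_rfl)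
    · filter_upwards [hγ1] with t ht
      rw [← ht]
      exact hgraph _
    · intro φ hφ t ht
      obtain ⟨w, h1, h2⟩ := htest φ hφ
      have h3 := hγ2 t ht w
      rw [h2, hφ.inner_toL2, hφ.inner_toL2] at h3
      rw [h3]
      congr 1
      · congr 1
        refine intervalIntegral.integral_congr fun s _ => ?_
        rw [← hφ.inner_gradL2, ← h1, Submodule.coe_inner]
      · refine intervalIntegral.integral_congr fun s _ => ?_
        exact hφ.inner_chi hω hωΩ (u s)
  · rintro y ⟨hyc, -, g, hg1, hg2, hg3⟩
    have hgi : ∀ t, 0 ≤ t → IntervalIntegrable g volume 0 t := by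
      intro t ht
      rw [intervalIntegrable_iff_integrableOn_Ioo_of_le ht]
      rcases eq_or_lt_of_le ht with rfl | h
      · simp
      · exact (hg1 t h).integrable (by norm_num)
    have hfi : ∀ t, 0 ≤ t → IntervalIntegrable (forcing hω u) volume 0 t := fun t ht =>
      (intervalIntegrable_iff_integrableOn_Ioc_of_le ht).2 (MemLp.integrableOn_Ioc hf t)
    have hpair : ∀ {E : Type} [NormedAddCommGroup E] [InnerProductSpace ℝ E] [CompleteSpace E]
        {h : ℝ → E} {t : ℝ}, IntervalIntegrable h volume 0 t → ∀ w : E,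
        ∫ s in (0 : ℝ)..t, ⟪h s, w⟫ = ⟪∫ s in (0 : ℝ)..t, h s, w⟫ := fun hh w => by
      have := (innerSL ℝ w).intervalIntegral_comp_comm hh
      simp only [innerSL_apply_apply] at this
      rw [real_inner_comm, ← this]
      simp only [real_inner_comm]
    -- Both sides are continuous in the pair `v`, so the equation extends from test functions to
    -- `H¹₀(Ω)`.
    have key : ∀ t, 0 ≤ t → ∀ v ∈ H10Graph Ω, ⟪y t, v.1⟫ - ⟪y₀, v.1⟫ =
        -⟪∫ s in (0 : ℝ)..t, g s, v.2⟫ + ⟪∫ s in (0 : ℝ)..t, forcing hω u s, v.1⟫ := by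
      intro t ht v hv
      refine H10Graph_induction (p := fun v => ⟪y t, v.1⟫ - ⟪y₀, v.1⟫ =
        -⟪∫ s in (0 : ℝ)..t, g s, v.2⟫ + ⟪∫ s in (0 : ℝ)..t, forcing hω u s, v.1⟫) ?_ ?_ hv
      · apply isClosed_eq <;> fun_prop
      · intro φ hφ
        have h3 := hg3 φ hφ t ht
        rw [← hφ.inner_toL2, ← hφ.inner_toL2] at h3
        simp only
        rw [h3, ← hpair (hgi t ht), ← hpair (hfi t ht)]
        congr 1
        · congr 1
          refine intervalIntegral.integral_congr fun s _ => ?_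
          exact (hφ.inner_gradL2 _).symm
        · refine intervalIntegral.integral_congr fun s _ => ?_
          exact (hφ.inner_chi hω hωΩ (u s)).symm
    classical
    -- For almost every time `g t` is the gradient of `y t` and lies in `W`; the value `0` is used
    -- only on a null set.
    let γ : ℝ → W := fun t => if h : g t ∈ W then ⟨g t, h⟩ else 0
    have hγ : ∀ᵐ t ∂(volume.restrict (Ioi (0 : ℝ))), (γ t : L2Field Ω) = g t ∧ P (γ t) = y t := by
      filter_upwards [hg2] with t ht
      obtain ⟨w, h1, h2⟩ := (hWP _ _).1 ht
      have hm : g t ∈ W := by rw [← h1]; exact w.2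
      have : γ t = w := by
        simp only [γ, dif_pos hm]
        exact Subtype.ext h1.symm
      rw [this]
      exact ⟨h1, h2⟩
    refine hS.eq_mild hG hf y₀ hPG hyc (hγ.mono fun t ht => ht.2) ?_
    intro t ht w
    rw [key t ht _ (hgraph w), ← hpair (hgi t ht), ← hpair (hfi t ht)]
    congr 2
    rw [intervalIntegral.integral_of_le ht, intervalIntegral.integral_of_le ht]
    apply integral_congr_ae
    filter_upwards [ae_restrict_of_ae_restrict_of_subset (s := Ioc 0 t) (t := Ioi 0)
      Ioc_subset_Ioi_self hγ] with s hs
    rw [← hs.1, Submodule.coe_inner]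

end HeatEquation
-- Mollification of elements of `L²(Ω)`
section Mollification

variable {d : ℕ} {Ω : Set (Space d)}

/-- The extension by zero of an element of `L²(Ω)`. -/
noncomputable def zext (z : L2 Ω) : Space d → ℝ := Ω.indicator z

/-- The mollification of the extension by zero of `z`. -/
noncomputable def mol (z : L2 Ω) (ρ : Space d → ℝ) : Space d → ℝ :=
  convolution (zext z) ρ (ContinuousLinearMap.lsmul ℝ ℝ) volume

theorem integrable_zext (hΩo : IsOpen Ω) (hΩ : Bornology.IsBounded Ω) (z : L2 Ω) :
    Integrable (zext z) := by
  have : IsFiniteMeasure (volume.restrict Ω) :=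
    ⟨by rw [Measure.restrict_apply_univ]; exact hΩ.measure_lt_top⟩
  exact (integrable_indicator_iff hΩo.measurableSet).2 ((Lp.memLp z).integrable (by norm_num))

theorem mol_apply (hΩo : IsOpen Ω) (z : L2 Ω) (ρ : Space d → ℝ) (x : Space d) :
    mol z ρ x = ∫ y in Ω, z y * ρ (x - y) := by
  rw [mol, convolution_def, ← integral_indicator hΩo.measurableSet]
  congr 1
  ext y
  by_cases hy : y ∈ Ω <;> simp [zext, hy]

theorem isSmooth_mol (hΩo : IsOpen Ω) (hΩ : Bornology.IsBounded Ω) (z : L2 Ω) {ρ : Space d → ℝ}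
    (hρ : IsSmooth ρ) (hc : HasCompactSupport ρ) : IsSmooth (mol z ρ) :=
  hc.contDiff_convolution_right _ (integrable_zext hΩo hΩ z).locallyIntegrable hρ

theorem pd_mol (hΩo : IsOpen Ω) (hΩ : Bornology.IsBounded Ω) (z : L2 Ω) {ρ : Space d → ℝ}
    (hρ : IsSmooth ρ) (hc : HasCompactSupport ρ) (v : Space d) :
    pd v (mol z ρ) = mol z (pd v ρ) := by
  ext x
  have hz := (integrable_zext hΩo hΩ z).locallyIntegrable
  have h := hc.hasFDerivAt_convolution_right (ContinuousLinearMap.lsmul ℝ ℝ) hz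
    (ContDiff.of_le hρ (by simp)) x
  rw [pd, mol, h.fderiv, convolution_precompR_apply _ hz (hc.fderiv (𝕜 := ℝ))
    (hρ.continuous_fderiv (by simp))]
  rfl

theorem isSmooth_iterate_pd {f : Space d → ℝ} (hf : IsSmooth f) (v : Space d) (k : ℕ) :
    IsSmooth ((pd v)^[k] f) := by
  induction k with
  | zero => exact hf
  | succ k ih => rw [Function.iterate_succ_apply']; exact ih.pd v

theorem IsTestFunction.iterate_pd {f : Space d → ℝ} (hf : IsTestFunction Ω f) (v : Space d)
    (k : ℕ) : IsTestFunction Ω ((HeatControl.pd v)^[k] f) := by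
  induction k with
  | zero => exact hf
  | succ k ih => rw [Function.iterate_succ_apply']; exact ih.pd v

theorem iterate_pd_mol (hΩo : IsOpen Ω) (hΩ : Bornology.IsBounded Ω) (z : L2 Ω)
    {ρ : Space d → ℝ} {s : Set (Space d)} (hρ : IsTestFunction s ρ) (v : Space d) (k : ℕ) :
    (pd v)^[k] (mol z ρ) = mol z ((pd v)^[k] ρ) := by
  induction k with
  | zero => rfl
  | succ k ih =>
    rw [Function.iterate_succ_apply', ih, Function.iterate_succ_apply',
      pd_mol hΩo hΩ z (hρ.iterate_pd v k).smooth (hρ.iterate_pd v k).compactSupport]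

theorem lap_mol (hΩo : IsOpen Ω) (hΩ : Bornology.IsBounded Ω) (z : L2 Ω)
    {ρ : Space d → ℝ} {s : Set (Space d)} (hρ : IsTestFunction s ρ) :
    lap (mol z ρ) = mol z (lap ρ) := by
  ext x
  rw [mol_apply hΩo]
  have h1 : ∀ i, pd (stdVec i) (pd (stdVec i) (mol z ρ)) x =
      ∫ y in Ω, z y * pd (stdVec i) (pd (stdVec i) ρ) (x - y) := fun i => by
    rw [pd_mol hΩo hΩ z hρ.smooth hρ.compactSupport,
      pd_mol hΩo hΩ z (hρ.pd _).smooth (hρ.pd _).compactSupport, mol_apply hΩo]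
  simp only [lap, h1, Finset.mul_sum]
  rw [integral_finsetSum]
  intro i _
  have hm := ((hρ.pd (stdVec i)).pd (stdVec i))
  have h2 : MemLp (fun y => pd (stdVec i) (pd (stdVec i) ρ) (x - y)) 2 (volume.restrict Ω) :=
    (hm.smooth.continuous.comp (continuous_const.sub continuous_id)).memLp_of_hasCompactSupport
      (hm.compactSupport.comp_homeomorph (Homeomorph.subLeft x))
  exact (Lp.memLp z).integrable_mul h2

theorem pd_const_sub (v x : Space d) {ρ : Space d → ℝ} (hρ : Differentiable ℝ ρ) :
    pd v (fun y => ρ (x - y)) = fun y => -pd v ρ (x - y) := by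
  ext y
  have h := (hρ (x - y)).hasFDerivAt.comp y ((hasFDerivAt_id y).const_sub x)
  have h2 : HasFDerivAt (fun y => ρ (x - y)) _ y := h
  rw [pd, h2.fderiv]
  simp [pd]

theorem lap_const_sub (x : Space d) {ρ : Space d → ℝ} (hρ : IsSmooth ρ) :
    lap (fun y => ρ (x - y)) = fun y => lap ρ (x - y) := by
  ext y
  refine Finset.sum_congr rfl fun i _ => ?_
  rw [pd_const_sub _ _ hρ.differentiable,
    pd_const_sub (ρ := fun w => -pd (stdVec i) ρ w) _ _ ((ContDiff.neg (hρ.pd (stdVec i))).differentiable (by simp))]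
  simp only [pd, fderiv_fun_neg, neg_apply, neg_neg]
  rfl

theorem IsTestFunction.const_sub {ε : ℝ} {ρ : Space d → ℝ}
    (hρ : IsTestFunction (Metric.ball 0 ε) ρ) {x : Space d} (hx : Metric.ball x ε ⊆ Ω) :
    IsTestFunction Ω fun y => ρ (x - y) := by
  refine ⟨hρ.smooth.comp (contDiff_const.sub contDiff_id),
    hρ.compactSupport.comp_homeomorph (Homeomorph.subLeft x), ?_⟩
  refine (tsupport_comp_subset_preimage ρ (continuous_const.sub continuous_id)).trans ?_
  intro y hy
  apply hx
  have := hρ.support_subset hy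
  rw [mem_ball_zero_iff] at this
  rwa [Metric.mem_ball, dist_comm, dist_eq_norm]

/-- Far enough from the boundary, the reflected and translated mollifier is itself a test function.
Weak identities tested with it become pointwise identities for the mollification. -/
theorem mol_eq_inner (hΩo : IsOpen Ω) (z : L2 Ω) {ε : ℝ} {ρ : Space d → ℝ}
    (hρ : IsTestFunction (Metric.ball 0 ε) ρ) {x : Space d} (hx : Metric.ball x ε ⊆ Ω) :
    mol z ρ x = ⟪z, (hρ.const_sub hx).toL2⟫ := by
  rw [mol_apply hΩo, IsTestFunction.inner_toL2]

/-- If `Δ z = -z'` weakly in `Ω`, then `Δ (ρ * z) = -ρ * z'`, away from the boundary. -/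
theorem lap_mol_eq (hΩo : IsOpen Ω) (hΩ : Bornology.IsBounded Ω) {z z' : L2 Ω}
    (h : ∀ φ, ∀ hφ : IsTestFunction Ω φ, ⟪z, hφ.lap.toL2⟫ = -⟪z', hφ.toL2⟫)
    {ε : ℝ} {ρ : Space d → ℝ} (hρ : IsTestFunction (Metric.ball 0 ε) ρ) {x : Space d}
    (hx : Metric.ball x ε ⊆ Ω) : lap (mol z ρ) x = -mol z' ρ x := by
  rw [lap_mol hΩo hΩ z hρ, mol_eq_inner hΩo z hρ.lap hx, mol_eq_inner hΩo z' hρ hx,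
    ← h _ (hρ.const_sub hx)]
  congr 1
  apply Lp.ext
  refine (MemLp.coeFn_toLp _).trans (EventuallyEq.trans ?_ (MemLp.coeFn_toLp _).symm)
  rw [lap_const_sub x hρ.smooth]

/-- Cauchy–Schwarz. The dependence on `ρ` is a prefactor, so it does not affect the geometric rate
of the later derivative bounds. -/
theorem abs_mol_le (hΩo : IsOpen Ω) (z : L2 Ω) {s : Set (Space d)} {ρ : Space d → ℝ}
    (hρ : IsTestFunction s ρ) (x : Space d) :
    |mol z ρ x| ≤ ‖z‖ * √(∫ y, ρ y ^ 2) := by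
  have hm : MemLp (fun y => ρ (x - y)) 2 (volume.restrict Ω) :=
    (hρ.smooth.continuous.comp (continuous_const.sub continuous_id)).memLp_of_hasCompactSupport
      (hρ.compactSupport.comp_homeomorph (Homeomorph.subLeft x))
  have h1 : mol z ρ x = ⟪z, hm.toLp _⟫ := by
    rw [mol_apply hΩo, L2.inner_def]
    refine integral_congr_ae ?_
    filter_upwards [hm.coeFn_toLp] with y hy
    rw [hy]
    simp [mul_comm]
  have h2 : ‖hm.toLp _‖ ≤ √(∫ y, ρ y ^ 2) := by
    apply Real.le_sqrt_of_sq_le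
    rw [norm_sq_toLp, ← integral_sub_left_eq_self (fun y => ρ y ^ 2) volume x]
    simp only [Real.norm_eq_abs, sq_abs]
    apply setIntegral_le_integral
    · have := (hρ.mul_left hρ.smooth).integrable
      simp only [← pow_two] at this
      exact this.comp_sub_left x
    · exact Eventually.of_forall fun y => sq_nonneg _
  rw [h1]
  exact (abs_real_inner_le_norm _ _).trans (by gcongr)

end Mollification

/-! ### A weighted Caccioppoli inequality -/

section Caccioppoli

variable {d : ℕ}

/-- A weighted Caccioppoli inequality. -/
theorem caccioppoli {η w W : Space d → ℝ} (hη : IsSmooth η) (hw : IsSmooth w) (hW : Continuous W)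
    {K : Set (Space d)} (hK : IsCompact K) (hηK : tsupport η ⊆ K) (h0 : ∀ x, 0 ≤ η x)
    (h1 : ∀ x, η x ≤ 1) {L : ℝ} (hL : ∀ x, ‖gradient η x‖ ≤ L)
    (hlap : ∀ x ∈ K, lap w x = -W x) {k n : ℕ} (hkn : k + 1 ≤ n) {v : Space d} (hv : ‖v‖ ≤ 1) :
    ∫ x in K, (η x ^ (k + 1) * pd v w x) ^ 2 ≤
      (n : ℝ) ^ 2 * (1 + 4 * L ^ 2) * (∫ x in K, (η x ^ k * w x) ^ 2) +
        ((n : ℝ) ^ 2)⁻¹ * ∫ x in K, (η x ^ k * W x) ^ 2 := by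
  have hn : (0 : ℝ) < n := by exact_mod_cast (by omega : 0 < n)
  set ζ : Space d → ℝ := fun x => η x ^ (k + 1) with hζdef
  have hηc : HasCompactSupport η := hK.of_isClosed_subset (isClosed_tsupport η) hηK
  have hζ : IsSmooth ζ := ContDiff.pow hη (k + 1)
  -- The test function is `ζ² w` with `ζ = η ^ (k + 1)`. Differentiating the power leaves `η ^ k`,
  -- the weight of the previous step of the iteration.
  set f : Space d → ℝ := fun x => ζ x * (ζ x * w x) with hfdef
  have hζs : Function.support ζ ⊆ Function.support η := fun x hx h => hx (by
    simp only [hζdef]; rw [h]; simp)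
  have hf : IsTestFunction K f := by
    have hs : tsupport f ⊆ tsupport η :=
      closure_mono fun x hx => hζs fun h => hx (by simp only [hfdef]; rw [h, zero_mul])
    exact ⟨hζ.mul (hζ.mul hw), hηc.of_isClosed_subset (isClosed_tsupport _) hs, hs.trans hηK⟩
  have hgreen : ∫ x in K, ⟪gradient f x, gradient w x⟫ = -∫ x in K, f x * lap w x := by
    have e1 : ∫ x, ⟪gradient f x, gradient w x⟫ = -∫ x, f x * lap w x := by
      simp only [inner_gradient, lap, Finset.mul_sum]
      rw [integral_finsetSum, integral_finsetSum, ← Finset.sum_neg_distrib]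
      · refine Finset.sum_congr rfl fun i _ => ?_
        rw [integral_pd_mul hf.smooth (hw.pd _) hf.compactSupport]
      · intro i _
        have := (hf.mul_left ((hw.pd (stdVec i)).pd (stdVec i))).integrable
        simpa only [mul_comm] using this
      · intro i _
        have := ((hf.pd (stdVec i)).mul_left (hw.pd (stdVec i))).integrable
        simpa only [mul_comm] using this
    rw [setIntegral_eq_integral_of_forall_compl_eq_zero fun x hx => by
      rw [hf.gradient_eq_zero hx, inner_zero_left], e1,
      setIntegral_eq_integral_of_forall_compl_eq_zero fun x hx => by
        rw [image_eq_zero_of_notMem_tsupport fun h => hx (hf.support_subset h), zero_mul]]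
  have hpdζ : ∀ u x, pd u ζ x = (k + 1) * η x ^ k * pd u η x := fun u x => by
    have := ((hη.differentiable x).hasFDerivAt.pow (k + 1)).fderiv
    simp only [pd, hζdef]
    rw [this]
    simp [mul_assoc]
  have hgζ : ∀ x, gradient ζ x = ((k + 1) * η x ^ k) • gradient η x := fun x => by
    ext i
    rw [PiLp.smul_apply, gradient_apply, gradient_apply, hpdζ, smul_eq_mul]
  have hgf : ∀ x, gradient f x = (ζ x ^ 2) • gradient w x + (2 * (ζ x * w x)) • gradient ζ x := by
    intro x
    ext i
    rw [PiLp.add_apply, PiLp.smul_apply, PiLp.smul_apply, gradient_apply, gradient_apply,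
      gradient_apply, smul_eq_mul, smul_eq_mul, hfdef, pd_mul hζ (hζ.mul hw), pd_mul hζ hw]
    ring
  -- The first bracket integrates to zero by Green's identity. The terms with `∇ζ` and with `W` are
  -- split by Young's inequality: `n` bounds the exponent `k + 1`, and the weights `n²` and `n⁻²`
  -- balance `w` against `W`.
  have hpt : ∀ x ∈ K, (ζ x * pd v w x) ^ 2 ≤
      (2 * ⟪gradient f x, gradient w x⟫ + 2 * (f x * lap w x)) +
      ((n : ℝ) ^ 2 * (1 + 4 * L ^ 2) * (η x ^ k * w x) ^ 2 +
        ((n : ℝ) ^ 2)⁻¹ * (η x ^ k * W x) ^ 2) := by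
    intro x hx
    have hp : pd v w x ^ 2 ≤ ‖gradient w x‖ ^ 2 := by
      rw [← sq_abs]
      gcongr
      exact (abs_pd_le v w x).trans (mul_le_of_le_one_right (norm_nonneg _) hv)
    set a := ζ x with ha
    set b := η x ^ k with hb
    set p := ‖gradient w x‖ with hpdef
    have hab : a = b * η x := by rw [ha, hb]; simp only [hζdef, pow_succ]
    have hb0 : 0 ≤ b := pow_nonneg (h0 x) k
    have hab2 : a ^ 2 ≤ b ^ 2 := by
      have : a ≤ b := by rw [hab]; exact mul_le_of_le_one_right hb0 (h1 x)
      have ha0 : 0 ≤ a := by rw [hab]; exact mul_nonneg hb0 (h0 x)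
      gcongr
    have hkn' : ((k : ℝ) + 1) ≤ n := by exact_mod_cast hkn
    have hin : ⟪gradient f x, gradient w x⟫ =
        a ^ 2 * p ^ 2 + 2 * (a * w x) * ⟪gradient ζ x, gradient w x⟫ := by
      rw [hgf, inner_add_left, inner_smul_left, inner_smul_left, real_inner_self_eq_norm_sq]
      simp [ha, hpdef]
    have hc : |⟪gradient ζ x, gradient w x⟫| ≤ (n * b * L) * p := by
      refine (abs_real_inner_le_norm _ _).trans ?_
      rw [hgζ, norm_smul, Real.norm_of_nonneg (by positivity)]
      have hL' := hL x
      gcongr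
    have hL0 : 0 ≤ L := (norm_nonneg _).trans (hL x)
    have hq : ⟪gradient ζ x, gradient w x⟫ ^ 2 ≤ (n * b * L) ^ 2 * p ^ 2 := by
      rw [← sq_abs, ← mul_pow]
      gcongr
    rw [hin, hlap x hx]
    have hfx : f x = a ^ 2 * w x := by rw [hfdef]; simp only [ha]; ring
    rw [hfx]
    set q := ⟪gradient ζ x, gradient w x⟫
    have t1 : -(4 * (a * w x) * q) ≤ a ^ 2 * p ^ 2 + 4 * (n * b * L) ^ 2 * w x ^ 2 := by
      by_cases hp0 : p = 0
      · have : q = 0 := by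
          have : q ^ 2 ≤ 0 := by rw [hp0] at hq; simpa using hq
          exact pow_eq_zero_iff two_ne_zero |>.1 (le_antisymm this (sq_nonneg _))
        rw [this, hp0]
        have : 0 ≤ 4 * (n * b * L) ^ 2 * w x ^ 2 := by positivity
        nlinarith
      · have hpp : 0 < p := lt_of_le_of_ne (norm_nonneg _) (Ne.symm hp0)
        have h4 : |a * w x * q| ≤ |a| * |w x| * ((n * b * L) * p) := by
          rw [abs_mul, abs_mul]
          gcongr
        have h5 := neg_abs_le (a * w x * q)
        nlinarith [sq_nonneg (|a| * p - 2 * (n * b * L) * |w x|), sq_abs a, sq_abs (w x)]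
    have t2 : 2 * (a ^ 2 * w x * W x) ≤
        (n : ℝ) ^ 2 * (b * w x) ^ 2 + ((n : ℝ) ^ 2)⁻¹ * (b * W x) ^ 2 := by
      have h6 : 0 ≤ (n * w x - (n : ℝ)⁻¹ * W x) ^ 2 := sq_nonneg _
      have h7 : (n * w x - (n : ℝ)⁻¹ * W x) ^ 2 =
          (n : ℝ) ^ 2 * w x ^ 2 + ((n : ℝ) ^ 2)⁻¹ * W x ^ 2 - 2 * (w x * W x) := by
        field_simp
        ring
      have h8 : 0 ≤ (n : ℝ) ^ 2 * w x ^ 2 + ((n : ℝ) ^ 2)⁻¹ * W x ^ 2 := by positivity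
      rw [h7] at h6
      calc 2 * (a ^ 2 * w x * W x) = a ^ 2 * (2 * (w x * W x)) := by ring
        _ ≤ a ^ 2 * ((n : ℝ) ^ 2 * w x ^ 2 + ((n : ℝ) ^ 2)⁻¹ * W x ^ 2) := by
            apply mul_le_mul_of_nonneg_left _ (sq_nonneg a); linarith
        _ ≤ b ^ 2 * ((n : ℝ) ^ 2 * w x ^ 2 + ((n : ℝ) ^ 2)⁻¹ * W x ^ 2) := by gcongr
        _ = _ := by ring
    have t3 : (a * pd v w x) ^ 2 ≤ a ^ 2 * p ^ 2 := by
      rw [mul_pow]; gcongr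
    have e5 : (n : ℝ) ^ 2 * (1 + 4 * L ^ 2) * (b * w x) ^ 2 =
        (n : ℝ) ^ 2 * (b * w x) ^ 2 + 4 * (n * b * L) ^ 2 * w x ^ 2 := by ring
    rw [e5]
    linarith
  have hcI : ∀ g : Space d → ℝ, Continuous g → IntegrableOn g K := fun g hg =>
    hg.continuousOn.integrableOn_compact hK
  have c1 : Continuous fun x => (ζ x * pd v w x) ^ 2 :=
    (hζ.continuous.mul (hw.pd v).continuous).pow 2
  have c2 : Continuous fun x => ⟪gradient f x, gradient w x⟫ :=
    (IsSmooth.continuous_gradient hf.smooth).inner (IsSmooth.continuous_gradient hw)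
  have c3 : Continuous fun x => f x * lap w x := hf.smooth.continuous.mul hw.lap.continuous
  have c4 : Continuous fun x => (η x ^ k * w x) ^ 2 :=
    ((hη.continuous.pow k).mul hw.continuous).pow 2
  have c5 : Continuous fun x => (η x ^ k * W x) ^ 2 := ((hη.continuous.pow k).mul hW).pow 2
  have i2 : IntegrableOn (fun x => 2 * ⟪gradient f x, gradient w x⟫) K := (hcI _ c2).const_mul 2
  have i3 : IntegrableOn (fun x => 2 * (f x * lap w x)) K := (hcI _ c3).const_mul 2
  have i4 : IntegrableOn (fun x => (n : ℝ) ^ 2 * (1 + 4 * L ^ 2) * (η x ^ k * w x) ^ 2) K :=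
    (hcI _ c4).const_mul _
  have i5 : IntegrableOn (fun x => ((n : ℝ) ^ 2)⁻¹ * (η x ^ k * W x) ^ 2) K :=
    (hcI _ c5).const_mul _
  have hmono := setIntegral_mono_on (hcI _ c1) ((i2.add i3).add (i4.add i5)) hK.measurableSet hpt
  have e1 := integral_add (i2.add i3) (i4.add i5)
  have e2 := integral_add i2 i3
  have e3 := integral_add i4 i5
  simp only [Pi.add_apply] at e1 e2 e3 hmono
  rw [e1, e2, e3, integral_const_mul, integral_const_mul,
    integral_const_mul, integral_const_mul, hgreen] at hmono
  refine hmono.trans (le_of_eq ?_)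
  ring

end Caccioppoli
-- Analytic bounds and propagation of zeros along segments
section UniqueContinuation

variable {d : ℕ} {Ω : Set (Space d)}

/-- The bound is stable under the recurrence: raising `i` contributes `B N`, which the weight `N⁻¹`
reduces to `B ≤ N B`, and `N P + N B` is the factor allowed for raising `k`. It is applied with `N =
n²`, where `k` counts derivatives and `i` powers of the Laplacian. -/
theorem le_of_two_index_recurrence {E : ℕ → ℕ → ℝ} {N P B A : ℝ} {n : ℕ} (hN : 1 ≤ N)
    (hP : 0 ≤ P) (hB : 0 ≤ B) (hA : 0 ≤ A) (h0 : ∀ i, E 0 i ≤ A * (B * N) ^ i)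
    (hE : ∀ k i, k + i + 1 ≤ n → E (k + 1) i ≤ N * P * E k i + N⁻¹ * E k (i + 1)) :
    ∀ k i, k + i ≤ n → E k i ≤ A * (N * (P + B)) ^ k * (B * N) ^ i := by
  have hN0 : 0 < N := by linarith
  intro k
  induction k with
  | zero => intro i _; simpa using h0 i
  | succ k ih =>
    intro i hi
    have e1 := ih i (by omega)
    have e2 := ih (i + 1) (by omega)
    have hBN : B ≤ N * B := le_mul_of_one_le_left hB hN
    calc E (k + 1) i ≤ N * P * E k i + N⁻¹ * E k (i + 1) := hE k i (by omega)
      _ ≤ N * P * (A * (N * (P + B)) ^ k * (B * N) ^ i) +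
          N⁻¹ * (A * (N * (P + B)) ^ k * (B * N) ^ (i + 1)) := by gcongr
      _ = A * (N * (P + B)) ^ k * (B * N) ^ i * (N * P + B) := by
          rw [pow_succ (B * N) i]; field_simp
      _ ≤ A * (N * (P + B)) ^ k * (B * N) ^ i * (N * P + N * B) := by gcongr
      _ = _ := by ring

/-- Interior estimates of analytic type for mollifications of `S t x`, uniform in the
mollifier. -/
theorem exists_analytic_bound (hΩo : IsOpen Ω) (hΩ : Bornology.IsBounded Ω)
    {G : L2 Ω →L[ℝ] L2 Ω} {S : ℝ → L2 Ω →L[ℝ] L2 Ω} (hG : IsGreenOperator G)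
    (hS : IsHeatSemigroup G S)
    (hlap : ∀ v φ, ∀ hφ : IsTestFunction Ω φ, ⟪G v, hφ.lap.toL2⟫ = -⟪v, hφ.toL2⟫)
    {t : ℝ} (ht : 0 < t) (x : L2 Ω) {c : Space d} {R : ℝ} (hR : 0 < R)
    (hc : Metric.ball c (3 * R) ⊆ Ω) :
    ∃ q : ℝ, 0 < q ∧ ∀ (ε : ℝ) (ρ : Space d → ℝ), ε ≤ R → IsTestFunction (Metric.ball 0 ε) ρ →
      ∃ A : ℝ, ∀ (n : ℕ) (v : Space d), 0 < n → ‖v‖ ≤ 1 →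
        ∫ y in Metric.closedBall c R, ((pd v)^[n] (mol (S t x) ρ) y) ^ 2 ≤ A * (n * q) ^ (2 * n) := by
  let β : ContDiffBump c := ⟨R, 2 * R, hR, by linarith⟩
  have hη : IsSmooth (β : Space d → ℝ) := β.contDiff
  obtain ⟨L, hL⟩ := (hη.continuous_gradient).bounded_above_of_compact_support
    (hasCompactSupport_gradient β.hasCompactSupport)
  set K : Set (Space d) := Metric.closedBall c (2 * R) with hKdef
  have hK : IsCompact K := isCompact_closedBall _ _
  have hηK : tsupport (β : Space d → ℝ) ⊆ K := by rw [β.tsupport_eq]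
  set P : ℝ := 1 + 4 * L ^ 2
  set B : ℝ := (1 / t) ^ 2
  have hPB : 0 < P + B := by positivity
  -- The rate `q` depends only on the time and the cutoff; all dependence on the mollifier goes into
  -- `A`, which in turn is independent of `n` and `v`.
  refine ⟨√(P + B), Real.sqrt_pos.2 hPB, fun ε ρ hε hρ => ?_⟩
  have hball : ∀ y ∈ K, Metric.ball y ε ⊆ Ω := fun y hy w hw => hc (by
    have h1 := Metric.mem_closedBall.1 hy
    have h2 := Metric.mem_ball.1 hw
    have h3 := dist_triangle w y c
    rw [Metric.mem_ball]; linarith)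
  set A : ℝ := volume.real K * (‖x‖ * √(∫ y, ρ y ^ 2)) ^ 2 with hA
  refine ⟨A, fun n v hn hv => ?_⟩
  have hn1 : (1 : ℝ) ≤ n := by exact_mod_cast hn
  -- The length of the chain is the order of differentiation, so a new chain is taken for each `n`.
  obtain ⟨z, hz0, hz1, hz2⟩ := hS.exists_chain hG ht x hn
  set w : ℕ → ℕ → Space d → ℝ := fun k i => (pd v)^[k] (mol (z i) ρ) with hw
  have hwm : ∀ k i, w k i = mol (z i) ((pd v)^[k] ρ) := fun k i =>
    iterate_pd_mol hΩo hΩ (z i) hρ v k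
  have hws : ∀ k i, IsSmooth (w k i) := fun k i =>
    isSmooth_iterate_pd (isSmooth_mol hΩo hΩ (z i) hρ.smooth hρ.compactSupport) v k
  have hlapw : ∀ k i, i < n → ∀ y ∈ K, lap (w k i) y = -w k (i + 1) y := by
    intro k i hi y hy
    rw [hwm, hwm]
    refine lap_mol_eq hΩo hΩ ?_ (hρ.iterate_pd v k) (hball y hy)
    intro φ hφ
    rw [← hz1 i hi]
    exact hlap _ _ _
  have key := le_of_two_index_recurrence (E := fun k i => ∫ y in K, (β y ^ k * w k i y) ^ 2)
    (N := (n : ℝ) ^ 2) (P := P) (B := B) (A := A) (n := n) (one_le_pow₀ hn1) (by positivity)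
    (by positivity) (by positivity) ?_ ?_
  · have h := key n 0 (by omega)
    have e1 : A * ((n : ℝ) ^ 2 * (P + B)) ^ n * (B * (n : ℝ) ^ 2) ^ 0 =
        A * (n * √(P + B)) ^ (2 * n) := by
      rw [pow_mul, mul_pow _ _ 2, Real.sq_sqrt hPB.le]; ring
    rw [e1] at h
    refine le_trans ?_ h
    have hint : IntegrableOn (fun y => (β y ^ n * w n 0 y) ^ 2) K :=
      (((hη.continuous.pow n).mul (hws n 0).continuous).pow 2).continuousOn.integrableOn_compact hK
    refine le_trans (le_of_eq ?_) (setIntegral_mono_set hint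
      (Eventually.of_forall fun y => sq_nonneg _)
      (Metric.closedBall_subset_closedBall (by linarith : R ≤ 2 * R)).eventuallyLE)
    refine setIntegral_congr_fun Metric.isClosed_closedBall.measurableSet fun y hy => ?_
    simp only [hw, hz0]
    rw [β.one_of_mem_closedBall hy, one_pow, one_mul]
  · intro i
    have hb : ∀ y, (w 0 i y) ^ 2 ≤ (‖x‖ * √(∫ y, ρ y ^ 2)) ^ 2 * (B * (n : ℝ) ^ 2) ^ i := by
      intro y
      have h1 : |w 0 i y| ≤ ((n : ℝ) / t) ^ i * ‖x‖ * √(∫ y, ρ y ^ 2) :=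
        (abs_mol_le hΩo (z i) hρ y).trans (by gcongr; exact hz2 i)
      have h2 : (B * (n : ℝ) ^ 2) ^ i = (((n : ℝ) / t) ^ i) ^ 2 := by
        rw [← pow_mul, mul_comm i 2, pow_mul]; congr 1; simp only [B]; field_simp
      rw [h2, ← sq_abs]
      calc |w 0 i y| ^ 2 ≤ (((n : ℝ) / t) ^ i * ‖x‖ * √(∫ y, ρ y ^ 2)) ^ 2 := by gcongr
        _ = _ := by ring
    have hfin : volume K ≠ ∞ := hK.measure_lt_top.ne
    have hint : IntegrableOn (fun y => (β y ^ 0 * w 0 i y) ^ 2) K :=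
      (((hη.continuous.pow 0).mul (hws 0 i).continuous).pow 2).continuousOn.integrableOn_compact hK
    calc ∫ y in K, (β y ^ 0 * w 0 i y) ^ 2
        ≤ ∫ y in K, (‖x‖ * √(∫ y, ρ y ^ 2)) ^ 2 * (B * (n : ℝ) ^ 2) ^ i := by
          refine setIntegral_mono hint (integrableOn_const hfin) fun y => ?_
          simpa using hb y
      _ = _ := by rw [setIntegral_const, smul_eq_mul, hA]; ring
  · intro k i hki
    have h := caccioppoli (k := k) (n := n) hη (hws k i) (hws k (i + 1)).continuous hK hηK
      (fun y => β.nonneg) (fun y => β.le_one) hL (hlapw k i (by omega)) (by omega) hv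
    refine le_trans (le_of_eq ?_) h
    simp only [hw, Function.iterate_succ_apply']

/-- Taylor's estimate for a function vanishing at the origin to order `n`. -/
theorem abs_le_of_taylor {n : ℕ} {M s : ℝ} : ∀ {g : ℕ → ℝ → ℝ},
    (∀ k < n, ∀ σ, HasDerivAt (g k) (g (k + 1) σ) σ) → (∀ k < n, g k 0 = 0) →
    (∀ σ ∈ Icc 0 s, |g n σ| ≤ M) → ∀ σ ∈ Icc 0 s, |g 0 σ| ≤ M * (σ ^ n / n.factorial) := by
  induction n with
  | zero => intro g _ _ hM σ hσ; simpa using hM σ hσ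
  | succ n ih =>
    intro g hd h0 hM σ hσ
    have h1 := ih (g := fun k => g (k + 1)) (fun k hk => hd (k + 1) (by omega))
      (fun k hk => h0 (k + 1) (by omega)) hM
    have hB : ∀ x, HasDerivAt (fun x : ℝ => M * (x ^ (n + 1) / (n + 1).factorial))
        (M * (x ^ n / n.factorial)) x := fun x => by
      have := ((hasDerivAt_pow (n + 1) x).div_const ((n + 1).factorial : ℝ)).const_mul M
      refine this.congr_deriv ?_
      rw [Nat.factorial_succ]
      push_cast
      have : (n.factorial : ℝ) ≠ 0 := by positivity
      field_simp
    have := image_norm_le_of_norm_deriv_right_le_deriv_boundary (f := g 0) (f' := g 1) (a := 0)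
      (b := s) (fun x _ => (hd 0 (by omega) x).continuousAt.continuousWithinAt)
      (fun x _ => (hd 0 (by omega) x).hasDerivWithinAt) (by simp [h0 0 (by omega)]) hB
      (fun x hx => h1 x ⟨hx.1, hx.2.le⟩) hσ
    simpa using this

theorem tsupport_iterate_pd_subset (v : Space d) (f : Space d → ℝ) (k : ℕ) :
    tsupport ((pd v)^[k] f) ⊆ tsupport f := by
  induction k with
  | zero => exact subset_rfl
  | succ k ih =>
    rw [Function.iterate_succ_apply']
    exact (tsupport_pd_subset _ _).trans ih

/-- Propagation of zeros along a segment under bounds of analytic type on the derivatives. -/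
theorem eq_zero_of_analytic_bound {F : Space d → ℝ} (hF : IsSmooth F) {v : Space d}
    (hbd : ∀ k, ∃ C, ∀ x, |(pd v)^[k] F x| ≤ C) (hv : ‖v‖ ≤ 1) {c x₀ : Space d} {R δ s q A : ℝ}
    (hδ : 0 < δ) (h0 : ∀ x ∈ Metric.ball x₀ δ, F x = 0) (hs : 0 ≤ s) (hx₀ : dist x₀ c + s < R)
    (hq : 0 < q) (hqs : 3 * (q * s) ≤ 1)
    (hA : ∀ n : ℕ, 0 < n →
      ∫ y in Metric.closedBall c R, ((pd v)^[n] F y) ^ 2 ≤ A * (n * q) ^ (2 * n)) :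
    F (x₀ + s • v) = 0 := by
  set ε : ℝ := min δ (R - dist x₀ c - s) with hε
  have hε0 : 0 < ε := lt_min hδ (by linarith)
  let β : ContDiffBump x₀ := ⟨ε / 2, ε, by linarith, by linarith⟩
  -- Derivatives are controlled only in `L²`, so `F` is averaged near `x₀` instead of evaluated. The
  -- weight is chosen so that the average at parameter `s` is the integral of `F (x + s • v) ^ 2 * β
  -- x`, whose vanishing gives `F (x₀ + s • v) = 0`.
  set ψ : Space d → ℝ := fun x => F (x + s • v) * β x with hψdef
  have hψc : Continuous ψ :=
    (hF.continuous.comp (continuous_add_const (s • v))).mul β.continuous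
  have hψs : HasCompactSupport ψ := β.hasCompactSupport.mul_left
  have hψ0 : ∀ x, x ∉ Metric.ball x₀ ε → ψ x = 0 := fun x hx => by
    have : x ∉ Function.support (β : Space d → ℝ) := by rw [β.support_eq]; exact hx
    rw [hψdef]; simp only
    rw [Function.notMem_support.1 this, mul_zero]
  have hsm : ∀ k, IsSmooth ((pd v)^[k] F) := isSmooth_iterate_pd hF v
  have hcont : ∀ (k : ℕ) (σ : ℝ), Continuous fun x => (pd v)^[k] F (x + σ • v) * ψ x := fun k σ =>
    ((hsm k).continuous.comp (continuous_add_const (σ • v))).mul hψc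
  have hint : ∀ (k : ℕ) (σ : ℝ), Integrable fun x => (pd v)^[k] F (x + σ • v) * ψ x := fun k σ =>
    (hcont k σ).integrable_of_hasCompactSupport hψs.mul_left
  set m : ℕ → ℝ → ℝ := fun k σ => ∫ x, (pd v)^[k] F (x + σ • v) * ψ x with hm
  have hder : ∀ k σ, HasDerivAt (m k) (m (k + 1) σ) σ := by
    intro k σ
    obtain ⟨C, hC⟩ := hbd (k + 1)
    refine (hasDerivAt_integral_of_dominated_loc_of_deriv_le (s := univ)
      (F := fun σ x => (pd v)^[k] F (x + σ • v) * ψ x)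
      (F' := fun σ x => (pd v)^[k + 1] F (x + σ • v) * ψ x)
      (bound := fun x => C * |ψ x|) univ_mem
      (Eventually.of_forall fun σ => (hcont k σ).aestronglyMeasurable) (hint k σ)
      (hcont (k + 1) σ).aestronglyMeasurable
      (Eventually.of_forall fun x σ _ => ?_) ?_ (Eventually.of_forall fun x σ _ => ?_)).2
    · rw [norm_mul, Real.norm_eq_abs, Real.norm_eq_abs]
      gcongr
      exact hC _
    · exact (hψc.integrable_of_hasCompactSupport hψs).abs.const_mul C
    · have h1 : HasDerivAt (fun σ : ℝ => x + σ • v) v σ := by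
        simpa using ((hasDerivAt_id σ).smul_const v).const_add x
      have h2 := ((hsm k).differentiable (x + σ • v)).hasFDerivAt.comp_hasDerivAt σ h1
      rw [Function.iterate_succ_apply']
      exact h2.mul_const (ψ x)
  have hzero : ∀ k, m k 0 = 0 := by
    intro k
    rw [hm]
    refine integral_eq_zero_of_ae (Eventually.of_forall fun x => ?_)
    by_cases hx : x ∈ Metric.ball x₀ ε
    · have hx' : x ∈ Metric.ball x₀ δ := Metric.ball_subset_ball (min_le_left _ _) hx
      have : x ∉ tsupport F := by
        rw [notMem_tsupport_iff_eventuallyEq]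
        filter_upwards [Metric.isOpen_ball.mem_nhds hx'] with y hy using h0 y hy
      have h2 := image_eq_zero_of_notMem_tsupport fun h =>
        this (tsupport_iterate_pd_subset v F k h)
      simp [h2]
    · simp [hψ0 x hx]
  set C : ℝ := ∫ x, ψ x ^ 2
  have hψ2 : Integrable fun x => ψ x ^ 2 :=
    (hψc.pow 2).integrable_of_hasCompactSupport (by
      simpa only [pow_two] using hψs.mul_left (f := ψ))
  have hbound : ∀ n : ℕ, 0 < n → ∀ σ ∈ Icc 0 s, |m n σ| ≤ (A + C) / 2 * (n * q) ^ n := by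
    intro n hn σ hσ
    have hn' : (0 : ℝ) < n := by exact_mod_cast hn
    set D : ℝ := (n * q) ^ n with hD
    have hD0 : 0 < D := by positivity
    set U : Set (Space d) := Metric.closedBall c R
    set f : Space d → ℝ := U.indicator fun y => ((pd v)^[n] F y) ^ 2 with hf
    have hfi : Integrable f :=
      (integrable_indicator_iff Metric.isClosed_closedBall.measurableSet).2
        (((hsm n).continuous.pow 2).continuousOn.integrableOn_compact (isCompact_closedBall _ _))
    have hfi' : Integrable fun x => f (x + σ • v) := hfi.comp_add_right _
    -- Young's inequality with weight `D`: since the squared derivative integrates to at most `A * D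
    -- ^ 2`, both terms are of size `D`.
    have hpt : ∀ x, ‖(pd v)^[n] F (x + σ • v) * ψ x‖ ≤
        (2 * D)⁻¹ * f (x + σ • v) + D / 2 * ψ x ^ 2 := by
      intro x
      by_cases hx : x ∈ Metric.ball x₀ ε
      · have hxU : x + σ • v ∈ U := by
          have h1 : dist (x + σ • v) x ≤ s := by
            rw [dist_self_add_left, norm_smul, Real.norm_of_nonneg hσ.1]
            exact (mul_le_of_le_one_right hσ.1 hv).trans hσ.2
          have h2 : dist x x₀ < R - dist x₀ c - s :=
            (Metric.mem_ball.1 hx).trans_le (min_le_right _ _)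
          have h3 := dist_triangle (x + σ • v) x c
          have h4 := dist_triangle x x₀ c
          rw [Metric.mem_closedBall]; linarith
        rw [hf, indicator_of_mem hxU, norm_mul, Real.norm_eq_abs, Real.norm_eq_abs]
        set a := (pd v)^[n] F (x + σ • v)
        have h5 := sq_nonneg (|a| - D * |ψ x|)
        have h6 : (2 * D)⁻¹ * a ^ 2 + D / 2 * ψ x ^ 2 - |a| * |ψ x| =
            (2 * D)⁻¹ * (|a| - D * |ψ x|) ^ 2 := by
          rw [← sq_abs a, ← sq_abs (ψ x)]; field_simp; ring
        have h7 : 0 ≤ (2 * D)⁻¹ * (|a| - D * |ψ x|) ^ 2 := by positivity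
        linarith
      · rw [hψ0 x hx]
        have : 0 ≤ f (x + σ • v) := indicator_nonneg (fun y _ => sq_nonneg _) _
        simp only [mul_zero, norm_zero]
        positivity
    have h1 : |m n σ| ≤ (2 * D)⁻¹ * (∫ x, f (x + σ • v)) + D / 2 * C := by
      rw [← Real.norm_eq_abs]
      refine (norm_integral_le_of_norm_le ((hfi'.const_mul _).add (hψ2.const_mul _))
        (Eventually.of_forall hpt)).trans (le_of_eq ?_)
      have := integral_add (hfi'.const_mul ((2 * D)⁻¹)) (hψ2.const_mul (D / 2))
      rw [integral_const_mul, integral_const_mul] at this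
      exact this
    have h2 : ∫ x, f (x + σ • v) ≤ A * D ^ 2 := by
      rw [integral_add_right_eq_self f, hf,
        integral_indicator Metric.isClosed_closedBall.measurableSet, hD, ← pow_mul, mul_comm n 2]
      exact hA n hn
    calc |m n σ| ≤ (2 * D)⁻¹ * (A * D ^ 2) + D / 2 * C := h1.trans (by gcongr)
      _ = _ := by field_simp
  have hsmall : ∀ n : ℕ, 0 < n → |m 0 s| ≤ (A + C) / 2 * (Real.exp 1 * (q * s)) ^ n := by
    intro n hn
    have h1 := abs_le_of_taylor (g := m) (n := n) (fun k _ => hder k) (fun k _ => hzero k)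
      (hbound n hn) s ⟨hs, le_rfl⟩
    have hAC : 0 ≤ (A + C) / 2 * (n * q) ^ n :=
      (abs_nonneg _).trans (hbound n hn s ⟨hs, le_rfl⟩)
    have hn' : (0 : ℝ) < n := by exact_mod_cast hn
    have hAC' : 0 ≤ (A + C) / 2 := nonneg_of_mul_nonneg_left hAC (by positivity)
    have h2 : (n : ℝ) ^ n / n.factorial ≤ Real.exp 1 ^ n := by
      rw [← Real.exp_nat_mul, mul_one]
      exact Real.pow_div_factorial_le_exp n hn'.le n
    calc |m 0 s| ≤ (A + C) / 2 * (n * q) ^ n * (s ^ n / n.factorial) := h1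
      _ = (A + C) / 2 * ((n : ℝ) ^ n / n.factorial * (q * s) ^ n) := by ring
      _ ≤ (A + C) / 2 * (Real.exp 1 ^ n * (q * s) ^ n) := by gcongr
      _ = _ := by rw [mul_pow (Real.exp 1)]
  have hm0 : m 0 s = 0 := by
    -- As `n ^ n / n!` is at most `exp n`, the Taylor remainder is geometric with ratio `exp 1 * q *
    -- s`; the constant in `3 * (q * s) ≤ 1` makes it less than one.
    have he : Real.exp 1 * (q * s) < 1 := by
      rcases (mul_nonneg hq.le hs).eq_or_lt with h | h
      · rw [← h]; simp
      · have := Real.exp_one_lt_d9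
        nlinarith
    have hlim := (tendsto_pow_atTop_nhds_zero_of_lt_one (by positivity) he).const_mul ((A + C) / 2)
    rw [mul_zero] at hlim
    refine abs_nonpos_iff.1 (ge_of_tendsto hlim ?_)
    filter_upwards [eventually_gt_atTop 0] with n hn using hsmall n hn
  by_contra hne
  have hpos : 0 < ∫ x, F (x + s • v) * ψ x := by
    refine Continuous.integral_pos_of_hasCompactSupport_nonneg_nonzero (x := x₀)
      (hcont 0 s) hψs.mul_left (fun x => ?_) ?_
    · rw [hψdef]; simp only
      rw [← mul_assoc]
      exact mul_nonneg (mul_self_nonneg _) β.nonneg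
    · rw [hψdef]; simp only
      rw [β.one_of_mem_closedBall (Metric.mem_closedBall_self (by exact β.rIn_pos.le)), mul_one]
      exact mul_self_ne_zero.2 hne
  exact hpos.ne' hm0

end UniqueContinuation
-- Unique continuation in a connected domain
section UniqueContinuation

variable {d : ℕ} {Ω : Set (Space d)}

/-- Mollifiers supported in small balls recover the function almost everywhere. -/
theorem exists_mollifier_seq (hΩo : IsOpen Ω) (hΩ : Bornology.IsBounded Ω) (f : L2 Ω) :
    ∃ (ε : ℕ → ℝ) (ρ : ℕ → Space d → ℝ), Tendsto ε atTop (𝓝 0) ∧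
      (∀ n, 0 < ε n) ∧ (∀ n, IsTestFunction (Metric.ball 0 (ε n)) (ρ n)) ∧
      ∀ᵐ x : Space d, Tendsto (fun n => mol f (ρ n) x) atTop (𝓝 (zext f x)) := by
  let φ : ℕ → ContDiffBump (0 : Space d) := fun n =>
    ⟨1 / ((n : ℝ) + 1) / 2, 1 / ((n : ℝ) + 1), by positivity, half_lt_self (by positivity)⟩
  have h0 : Tendsto (fun n => (φ n).rOut) atTop (𝓝 0) := tendsto_one_div_add_atTop_nhds_zero_nat
  refine ⟨fun n => 2 * (φ n).rOut, fun n => (φ n).normed volume, by simpa using h0.const_mul 2,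
    fun n => mul_pos two_pos (φ n).rOut_pos, fun n => ⟨(φ n).contDiff_normed,
      (φ n).hasCompactSupport_normed, ?_⟩, ?_⟩
  · rw [(φ n).tsupport_normed_eq]
    exact Metric.closedBall_subset_ball (by linarith [(φ n).rOut_pos])
  · filter_upwards [ContDiffBump.ae_convolution_tendsto_right_of_locallyIntegrable (φ := φ)
      (K := 2) h0 (Eventually.of_forall fun n => by simp only [φ]; linarith)
      (integrable_zext hΩo hΩ f).locallyIntegrable] with x hx
    refine hx.congr fun n => ?_
    rw [convolution_lsmul_swap, mol, convolution_def]
    simp [mul_comm]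

/-- Local unique continuation for `S t x`. -/
theorem exists_propagation (hΩo : IsOpen Ω) (hΩ : Bornology.IsBounded Ω)
    {G : L2 Ω →L[ℝ] L2 Ω} {S : ℝ → L2 Ω →L[ℝ] L2 Ω} (hG : IsGreenOperator G)
    (hS : IsHeatSemigroup G S)
    (hlap : ∀ v φ, ∀ hφ : IsTestFunction Ω φ, ⟪G v, hφ.lap.toL2⟫ = -⟪v, hφ.toL2⟫)
    {t : ℝ} (ht : 0 < t) (x : L2 Ω) {c : Space d} (hc : c ∈ Ω) :
    ∃ κ > 0, ∀ x₀ ∈ Metric.ball c κ,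
      (∃ ε > 0, ∀ᵐ y : Space d, y ∈ Metric.ball x₀ ε → zext (S t x) y = 0) →
      ∀ᵐ y : Space d, y ∈ Metric.ball c κ → zext (S t x) y = 0 := by
  obtain ⟨R₀, hR₀, hball⟩ := Metric.isOpen_iff.1 hΩo c hc
  set R : ℝ := R₀ / 3 with hRdef
  have hR : 0 < R := by positivity
  have hball' : Metric.ball c (3 * R) ⊆ Ω := by
    rwa [show 3 * R = R₀ by rw [hRdef]; ring]
  obtain ⟨q, hq, hbound⟩ := exists_analytic_bound hΩo hΩ hG hS hlap ht x hR hball'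
  -- Two points of the ball of radius `κ` are less than `2κ` apart. The bound `R / 4` keeps `dist x₀
  -- c + 2κ` below `R`, and `1 / (6q)` gives `3 * (q * (2κ)) ≤ 1`.
  set κ : ℝ := min (R / 4) (1 / (6 * q)) with hκ
  have hκ0 : 0 < κ := lt_min (by positivity) (by positivity)
  have hκR : κ ≤ R / 4 := min_le_left _ _
  have hκq : q * κ ≤ 1 / 6 := by
    calc q * κ ≤ q * (1 / (6 * q)) := by gcongr; exact min_le_right _ _
      _ = 1 / 6 := by field_simp
  refine ⟨κ, hκ0, ?_⟩
  rintro x₀ hx₀ ⟨δ, hδ, hzero⟩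
  obtain ⟨ε, ρ, hε, hε0, hρ, hae⟩ := exists_mollifier_seq hΩo hΩ (S t x)
  have hev : ∀ᶠ n in atTop, ε n < min R (δ / 2) :=
    hε.eventually (gt_mem_nhds (lt_min hR (by positivity)))
  filter_upwards [hae] with y hy hyc
  -- The mollifications converge to `S t x` at `y`, so it suffices that they vanish at `y` for small
  -- `ε n`. They vanish on the ball of radius `δ / 2` about `x₀`, and the uniform rate `q` carries
  -- this to `y`.
  refine tendsto_nhds_unique hy (tendsto_const_nhds.congr' ?_)
  filter_upwards [hev] with n hn
  have hnR : ε n ≤ R := (hn.trans_le (min_le_left _ _)).le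
  have hnδ : ε n < δ / 2 := hn.trans_le (min_le_right _ _)
  obtain ⟨A, hA⟩ := hbound (ε n) (ρ n) hnR (hρ n)
  set v : Space d := (2 * κ)⁻¹ • (y - x₀) with hv
  have hx₀c := Metric.mem_ball.1 hx₀
  have hyc' := Metric.mem_ball.1 hyc
  have hv1 : ‖v‖ ≤ 1 := by
    rw [hv, norm_smul, Real.norm_of_nonneg (by positivity), inv_mul_le_iff₀ (by positivity),
      ← dist_eq_norm]
    have := dist_triangle_right y x₀ c
    linarith
  have hyv : y = x₀ + (2 * κ) • v := by
    rw [hv, smul_smul, mul_inv_cancel₀ (by positivity), one_smul, add_sub_cancel]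
  rw [hyv]
  symm
  refine eq_zero_of_analytic_bound (isSmooth_mol hΩo hΩ _ (hρ n).smooth (hρ n).compactSupport)
    (fun k => ?_) hv1 (half_pos hδ) (fun w hw => ?_) (by positivity)
    (show dist x₀ c + 2 * κ < R by linarith) hq (by linarith) fun k hk => hA k v hk hv1
  · rw [iterate_pd_mol hΩo hΩ _ (hρ n)]
    exact ⟨_, abs_mol_le hΩo _ ((hρ n).iterate_pd v k)⟩
  · rw [mol, convolution_def]
    refine integral_eq_zero_of_ae ?_
    filter_upwards [hzero] with a ha
    by_cases haw : a ∈ Metric.ball x₀ δ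
    · simp [ha haw]
    · have : ρ n (w - a) = 0 := by
        refine image_eq_zero_of_notMem_tsupport fun h => haw ?_
        have h1 := mem_ball_zero_iff.1 ((hρ n).support_subset h)
        rw [← dist_eq_norm] at h1
        have h2 := Metric.mem_ball.1 hw
        have h3 := dist_triangle_left a x₀ w
        rw [Metric.mem_ball]; linarith
      simp [this]

/-- Unique continuation: if `S t x` vanishes on a nonempty open set for some `t > 0`, then
`x = 0`. -/
theorem eq_zero_of_vanishes (hΩo : IsOpen Ω) (hΩ : Bornology.IsBounded Ω)
    (hΩc : IsPreconnected Ω) {G : L2 Ω →L[ℝ] L2 Ω} {S : ℝ → L2 Ω →L[ℝ] L2 Ω}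
    (hG : IsGreenOperator G) (hS : IsHeatSemigroup G S)
    (hlap : ∀ v φ, ∀ hφ : IsTestFunction Ω φ, ⟪G v, hφ.lap.toL2⟫ = -⟪v, hφ.toL2⟫)
    {ω : Set (Space d)} (hω : IsOpen ω) (hω' : ω.Nonempty) (hωΩ : ω ⊆ Ω)
    {t : ℝ} (ht : 0 < t) {x : L2 Ω} (h : chi Ω hω.measurableSet (S t x) = 0) : x = 0 := by
  refine hS.injective ht.le ?_
  set U : Set (Space d) :=
    {x₀ | ∃ ε > 0, ∀ᵐ y : Space d, y ∈ Metric.ball x₀ ε → zext (S t x) y = 0} with hU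
  have hball : ∀ (c : Space d) (κ : ℝ),
      (∀ᵐ y : Space d, y ∈ Metric.ball c κ → zext (S t x) y = 0) → Metric.ball c κ ⊆ U := by
    intro c κ hc z hz
    refine ⟨κ - dist z c, sub_pos.2 (Metric.mem_ball.1 hz), ?_⟩
    filter_upwards [hc] with y hy hyz
    exact hy (Metric.ball_subset_ball' (by linarith) hyz)
  have hUo : IsOpen U := Metric.isOpen_iff.2 fun z ⟨ε, hε, hz⟩ => ⟨ε, hε, hball z ε hz⟩
  have hωU : ω ⊆ U := by
    intro z hz
    obtain ⟨ε, hε, hzε⟩ := Metric.isOpen_iff.1 hω z hz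
    refine ⟨ε, hε, ?_⟩
    have h1 := (ae_restrict_iff' hω.measurableSet).1
      (ae_eq_zero_of_chi hω.measurableSet hωΩ h)
    filter_upwards [h1] with y hy hyz
    rw [zext, indicator_of_mem (hωΩ (hzε hyz)), hy (hzε hyz)]
  -- The radius `κ` at `c` does not depend on the zero ball about `x₀`. Thus a limit in `Ω` of
  -- points of the open set `U` is in `U`, and connectedness applies.
  have hΩU : Ω ⊆ U := by
    refine hΩc.subset_of_closure_inter_subset hUo ?_ ?_
    · obtain ⟨z, hz⟩ := hω'
      exact ⟨z, hωΩ hz, hωU hz⟩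
    · rintro c ⟨hcU, hcΩ⟩
      obtain ⟨κ, hκ, hprop⟩ := exists_propagation hΩo hΩ hG hS hlap ht x hcΩ
      obtain ⟨x₀, hx₀U, hx₀⟩ := Metric.mem_closure_iff.1 hcU κ hκ
      rw [dist_comm] at hx₀
      exact ⟨κ, hκ, hprop x₀ hx₀ hx₀U⟩
  have hnull : volume {y ∈ Ω | S t x y ≠ 0} = 0 := by
    refine measure_null_of_locally_null _ fun z hz => ?_
    obtain ⟨ε, hε, hzε⟩ := hΩU hz.1
    refine ⟨Metric.ball z ε ∩ {y ∈ Ω | S t x y ≠ 0},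
      inter_mem (mem_nhdsWithin_of_mem_nhds (Metric.ball_mem_nhds z hε)) self_mem_nhdsWithin, ?_⟩
    refine measure_mono_null ?_ (ae_iff.1 hzε)
    rintro y ⟨hy1, hy2, hy3⟩ hy
    have := hy hy1
    rw [zext, indicator_of_mem hy2] at this
    exact hy3 this
  rw [Lp.eq_zero_iff_ae_eq_zero]
  refine (ae_restrict_iff' hΩo.measurableSet).2 (ae_iff.2 (measure_mono_null ?_ hnull))
  intro y hy
  simpa using hy

end UniqueContinuation
-- Abstract time optimal control in Hilbert spaces
section Hilbert

variable {H U : Type*} [NormedAddCommGroup H] [InnerProductSpace ℝ H] [NormedAddCommGroup U]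
  [InnerProductSpace ℝ U]

theorem norm_le_of_forall_inner_le {y : H} {r : ℝ} (hr : 0 ≤ r)
    (h : ∀ η, ⟪y, η⟫ ≤ r * ‖η‖) : ‖y‖ ≤ r := by
  have := h y
  rw [real_inner_self_eq_norm_sq] at this
  rcases (norm_nonneg y).eq_or_lt with h0 | h0
  · rwa [← h0]
  · nlinarith

theorem norm_le_iff_forall_inner_le {y : H} {r : ℝ} (hr : 0 ≤ r) :
    ‖y‖ ≤ r ↔ ∀ η, ⟪y, η⟫ ≤ r * ‖η‖ :=
  ⟨fun h η => (real_inner_le_norm y η).trans (by gcongr), norm_le_of_forall_inner_le hr⟩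

theorem norm_midpoint_lt {a b : U} {M : ℝ} (ha : ‖a‖ ≤ M) (hb : ‖b‖ ≤ M) (hab : a ≠ b) :
    ‖(1 / 2 : ℝ) • (a + b)‖ < M := by
  have hM : 0 ≤ M := (norm_nonneg a).trans ha
  have h1 := parallelogram_law_with_norm ℝ a b
  have h2 : 0 < ‖a - b‖ := norm_pos_iff.2 (sub_ne_zero.2 hab)
  rw [norm_smul, Real.norm_of_nonneg (by norm_num)]
  have h3 : ‖a‖ * ‖a‖ ≤ M * M := by gcongr
  have h4 : ‖b‖ * ‖b‖ ≤ M * M := by gcongr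
  by_contra hc
  have h5 : 2 * M ≤ ‖a + b‖ := by linarith
  have h6 : 2 * M * (2 * M) ≤ ‖a + b‖ * ‖a + b‖ := by gcongr
  have h7 : 0 < ‖a - b‖ * ‖a - b‖ := by positivity
  linarith

variable [CompleteSpace U]

/-- Bounded sequences have weak limits along ultrafilters. -/
theorem exists_weak_limit {M : ℝ} {u : ℕ → U} (hu : ∀ n, ‖u n‖ ≤ M) :
    ∃ x : U, ‖x‖ ≤ M ∧ ∀ w, Tendsto (fun n => ⟪u n, w⟫) (hyperfilter ℕ : Filter ℕ) (𝓝 ⟪x, w⟫) := by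
  have hK := WeakDual.isCompact_closedBall (𝕜 := ℝ) (E := U) 0 M
  set φ : ℕ → WeakDual ℝ U := fun n => StrongDual.toWeakDual (InnerProductSpace.toDual ℝ U (u n))
    with hφ
  obtain ⟨x, hx, hlim⟩ := hK.ultrafilter_le_nhds ((hyperfilter ℕ).map φ) (by
    rw [le_principal_iff, Ultrafilter.coe_map, mem_map]
    refine univ_mem' fun n => ?_
    simpa [hφ] using hu n)
  refine ⟨(InnerProductSpace.toDual ℝ U).symm (WeakDual.toStrongDual x), ?_, fun w => ?_⟩
  · rw [LinearIsometryEquiv.norm_map]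
    simpa using hx
  · rw [InnerProductSpace.toDual_symm_apply]
    have h1 : Tendsto φ (hyperfilter ℕ : Filter ℕ) (𝓝 x) := hlim
    have h2 := ((WeakDual.eval_continuous w).tendsto x).comp h1
    exact h2

/-- The data of an abstract control system `y(t) = a t + Λ t u`, whose input maps `Λ t` have the
adjoints `ψ t`. -/
structure IsControlSystem (a : ℝ → H) (Λ : ℝ → U →ₗ[ℝ] H) (ψ : ℝ → H → U) : Prop where
  inner_eq : ∀ t, 0 ≤ t → ∀ u η, ⟪Λ t u, η⟫ = ⟪u, ψ t η⟫
  continuousOn_adj : ∀ η, ContinuousOn (fun t => ψ t η) (Ici 0)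
  continuousOn : ∀ u, ContinuousOn (fun t => a t + Λ t u) (Ici 0)
  adj_ne_zero : ∀ t, 0 < t → ∀ η, η ≠ 0 → ψ t η ≠ 0
  zero : ∀ u, Λ 0 u = 0

variable {a : ℝ → H} {Λ : ℝ → U →ₗ[ℝ] H} {ψ : ℝ → H → U}

/-- Membership of the ball is a family of linear inequalities, so it passes to weak limits. Strong
continuity of the adjoints in time handles the product of weakly converging controls and moving
input maps. -/
theorem IsControlSystem.exists_optimal (h : IsControlSystem a Λ ψ) {r M : ℝ} (hr : 0 ≤ r)
    (hne : {t : ℝ | 0 < t ∧ ∃ u, ‖u‖ ≤ M ∧ ‖a t + Λ t u‖ ≤ r}.Nonempty) :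
    ∃ u, ‖u‖ ≤ M ∧ ‖a (sInf {t : ℝ | 0 < t ∧ ∃ u, ‖u‖ ≤ M ∧ ‖a t + Λ t u‖ ≤ r}) +
      Λ (sInf {t : ℝ | 0 < t ∧ ∃ u, ‖u‖ ≤ M ∧ ‖a t + Λ t u‖ ≤ r}) u‖ ≤ r := by
  set A : Set ℝ := {t : ℝ | 0 < t ∧ ∃ u, ‖u‖ ≤ M ∧ ‖a t + Λ t u‖ ≤ r} with hA
  have hbdd : BddBelow A := ⟨0, fun t ht => ht.1.le⟩
  obtain ⟨t, -, ht, htA⟩ := exists_seq_tendsto_sInf hne hbdd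
  set T := sInf A
  have hT : 0 ≤ T := le_csInf hne fun t ht => ht.1.le
  choose ht0 u hu hur using htA
  obtain ⟨x, hx, hlim⟩ := exists_weak_limit hu
  refine ⟨x, hx, norm_le_of_forall_inner_le hr fun η => ?_⟩
  have htT : Tendsto t (hyperfilter ℕ : Filter ℕ) (𝓝[Ici 0] T) := by
    refine tendsto_nhdsWithin_iff.2 ⟨ht.mono_left Nat.hyperfilter_le_atTop,
      Eventually.of_forall fun n => (ht0 n).le⟩
  have ha : Tendsto (fun n => a (t n)) (hyperfilter ℕ : Filter ℕ) (𝓝 (a T)) := by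
    have h1 := (h.continuousOn 0 T hT).tendsto.comp htT
    simpa [Function.comp_def] using h1
  have hψ : Tendsto (fun n => ψ (t n) η) (hyperfilter ℕ : Filter ℕ) (𝓝 (ψ T η)) :=
    (h.continuousOn_adj η T hT).tendsto.comp htT
  have hd : Tendsto (fun n => ⟪u n, ψ (t n) η - ψ T η⟫) (hyperfilter ℕ : Filter ℕ) (𝓝 0) := by
    have h0 : Tendsto (fun n => M * ‖ψ (t n) η - ψ T η‖) (hyperfilter ℕ : Filter ℕ) (𝓝 0) := by
      simpa using ((tendsto_iff_norm_sub_tendsto_zero.1 hψ).const_mul M)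
    refine squeeze_zero_norm (fun n => ?_) h0
    exact (abs_real_inner_le_norm _ _).trans (by gcongr; exact hu n)
  have hsum : Tendsto (fun n => ⟪a (t n) + Λ (t n) (u n), η⟫) (hyperfilter ℕ : Filter ℕ)
      (𝓝 ⟪a T + Λ T x, η⟫) := by
    have h1 := (ha.inner (tendsto_const_nhds (x := η))).add ((hlim (ψ T η)).add hd)
    rw [add_zero, ← h.inner_eq T hT, ← inner_add_left] at h1
    refine h1.congr fun n => ?_
    rw [inner_add_left, h.inner_eq _ (ht0 n).le, inner_sub_right]
    ring
  refine le_of_tendsto hsum (Eventually.of_forall fun n => ?_)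
  exact (norm_le_iff_forall_inner_le hr).1 (hur n) η

-- Minimality of `T` makes every admissible final state at time `T` have norm at least `r`, while
-- the midpoint of two different optimal controls leaves room in the norm bound for a descent step.
-- The equality holds in all of `U`, because any difference, even one without effect at time `T`,
-- creates this room.
omit [CompleteSpace U] in
theorem IsControlSystem.optimal_unique (h : IsControlSystem a Λ ψ) {r M : ℝ} (hr : 0 < r)
    (ha : r < ‖a 0‖) {u v : U} {T : ℝ}
    (hT : IsGLB {t : ℝ | 0 < t ∧ ∃ u, ‖u‖ ≤ M ∧ ‖a t + Λ t u‖ ≤ r} T)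
    (hu : ‖u‖ ≤ M) (hur : ‖a T + Λ T u‖ ≤ r) (hv : ‖v‖ ≤ M) (hvr : ‖a T + Λ T v‖ ≤ r) :
    u = v := by
  by_contra huv
  have hT0 : 0 ≤ T := hT.2 fun t ht => ht.1.le
  have hTpos : 0 < T := by
    refine hT0.lt_of_ne fun h0 => ?_
    rw [← h0, h.zero, add_zero] at hur
    linarith
  have key : ∀ w, ‖w‖ ≤ M → r ≤ ‖a T + Λ T w‖ := by
    intro w hw
    by_contra hlt
    rw [not_le] at hlt
    have hev := ((h.continuousOn w T hT0).norm).eventually_lt_const hlt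
    have hev2 : ∀ᶠ t in 𝓝[<] T, ‖a t + Λ t w‖ < r ∧ 0 < t := by
      have h1 : Ioo 0 T ∈ 𝓝[<] T := Ioo_mem_nhdsLT hTpos
      have h2 : 𝓝[Ioo 0 T] T ≤ 𝓝[Ici 0] T := nhdsWithin_mono _ fun x hx => hx.1.le
      have h3 : 𝓝[<] T = 𝓝[Ioo 0 T] T := (nhdsWithin_Ioo_eq_nhdsLT hTpos).symm
      have h4 : ∀ᶠ t in 𝓝[<] T, ‖a t + Λ t w‖ < r := (h3.le.trans h2) hev
      exact h4.and (mem_of_superset h1 fun x hx => hx.1)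
    obtain ⟨t, ⟨ht1, ht2⟩, ht3⟩ := (hev2.and self_mem_nhdsWithin).exists
    exact (not_le.2 ht3) (hT.1 ⟨ht2, w, hw, ht1.le⟩)
  set w : U := (1 / 2 : ℝ) • (u + v) with hw
  have hwM : ‖w‖ < M := norm_midpoint_lt hu hv huv
  set e : H := a T + Λ T w with he
  have hwr : ‖e‖ ≤ r := by
    have : e = (1 / 2 : ℝ) • (a T + Λ T u) + (1 / 2 : ℝ) • (a T + Λ T v) := by
      rw [he, hw, map_smul, map_add]; module
    rw [this]
    refine (norm_add_le _ _).trans ?_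
    rw [norm_smul, norm_smul, Real.norm_of_nonneg (by norm_num)]
    linarith
  have her : ‖e‖ = r := le_antisymm hwr (key w hwM.le)
  have he0 : e ≠ 0 := fun h0 => by rw [h0, norm_zero] at her; linarith
  set p : U := ψ T e with hp
  have hp0 : 0 < ‖p‖ := norm_pos_iff.2 (h.adj_ne_zero T hTpos e he0)
  -- The first bound keeps the perturbed control within norm `M`; the second makes the quadratic
  -- term `lam² ‖Λ T p‖²` at most half of the first-order gain `2 lam ‖p‖²`.
  set lam : ℝ := min ((M - ‖w‖) / ‖p‖) (‖p‖ ^ 2 / (‖Λ T p‖ ^ 2 + 1)) with hlam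
  have hlam0 : 0 < lam := lt_min (div_pos (by linarith) hp0) (by positivity)
  have hlam1 : lam * ‖p‖ ≤ M - ‖w‖ := (le_div_iff₀ hp0).1 (min_le_left _ _)
  have hlam2 : lam * (‖Λ T p‖ ^ 2 + 1) ≤ ‖p‖ ^ 2 :=
    (le_div_iff₀ (by positivity)).1 (min_le_right _ _)
  have hnorm : ‖w - lam • p‖ ≤ M := by
    refine (norm_sub_le _ _).trans ?_
    rw [norm_smul lam, Real.norm_of_nonneg hlam0.le]
    linarith
  have h1 := key _ hnorm
  have h2 : a T + Λ T (w - lam • p) = e - lam • Λ T p := by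
    rw [he, map_sub (Λ T) w, map_smul (Λ T) lam p]; abel
  rw [h2] at h1
  have h3 : ‖e - lam • Λ T p‖ ^ 2 = r ^ 2 - 2 * lam * ‖p‖ ^ 2 + lam ^ 2 * ‖Λ T p‖ ^ 2 := by
    rw [norm_sub_sq_real, inner_smul_right, real_inner_comm, h.inner_eq T hT0,
      real_inner_self_eq_norm_sq, norm_smul lam, Real.norm_of_nonneg hlam0.le, her]
    ring
  have h4 : r ^ 2 ≤ ‖e - lam • Λ T p‖ ^ 2 := by gcongr
  have h5 : lam * (lam * ‖Λ T p‖ ^ 2) ≤ lam * ‖p‖ ^ 2 := by gcongr; nlinarith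
  have h6 : 0 < lam * ‖p‖ ^ 2 := by positivity
  nlinarith

end Hilbert
-- The heat equation as an abstract control system
section HeatControlSystem

variable {d : ℕ} {Ω ω : Set (Space d)} {G : L2 Ω →L[ℝ] L2 Ω} {S : ℝ → L2 Ω →L[ℝ] L2 Ω}

/-- The kernel `χ_{(0,t)}(s) χ_ω S(t - s) η`. -/
noncomputable def adjFun (S : ℝ → L2 Ω →L[ℝ] L2 Ω) (hω : MeasurableSet ω) (t : ℝ) (η : L2 Ω) :
    ℝ → L2 Ω :=
  (Ioo 0 t).indicator fun s => chi Ω hω (S (t - s) η)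

theorem norm_adjFun_le (hS : IsHeatSemigroup G S) (hω : MeasurableSet ω) (t : ℝ) (η : L2 Ω)
    (s : ℝ) : ‖adjFun S hω t η s‖ ≤ ‖η‖ :=
  (norm_indicator_le_norm_self _ _).trans ((norm_chi_le hω _).trans (hS.norm_le _ _))

theorem memLp_adjFun (hS : IsHeatSemigroup G S) (hω : MeasurableSet ω) (t : ℝ) (η : L2 Ω) :
    MemLp (adjFun S hω t η) 2 (volume.restrict (Ioi (0 : ℝ))) := by
  rw [adjFun, memLp_indicator_iff_restrict measurableSet_Ioo,
    Measure.restrict_restrict measurableSet_Ioo,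
    inter_eq_left.mpr (Ioo_subset_Ioi_self : Ioo (0 : ℝ) t ⊆ Ioi 0)]
  refine MemLp.of_bound ?_ ‖η‖
    (Eventually.of_forall fun s => (norm_chi_le hω _).trans (hS.norm_le _ _))
  exact ((chi Ω hω).continuous.comp ((hS.continuous η).comp
    (continuous_const.sub continuous_id))).aestronglyMeasurable

/-- The adjoint of the input map of the heat equation at time `t`. -/
noncomputable def adj (hS : IsHeatSemigroup G S) (hω : MeasurableSet ω) (t : ℝ) (η : L2 Ω) :
    Control Ω :=
  (memLp_adjFun hS hω t η).toLp _

theorem inner_adj (hS : IsHeatSemigroup G S) (hω : MeasurableSet ω) (u : Control Ω) (t : ℝ)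
    (η : L2 Ω) : ⟪u, adj hS hω t η⟫ = ∫ s in Ioo 0 t, ⟪u s, chi Ω hω (S (t - s) η)⟫ := by
  rw [L2.inner_def, ← inter_eq_left.mpr (Ioo_subset_Ioi_self : Ioo (0 : ℝ) t ⊆ Ioi 0),
    ← Measure.restrict_restrict measurableSet_Ioo, ← integral_indicator measurableSet_Ioo]
  refine integral_congr_ae ?_
  filter_upwards [(memLp_adjFun hS hω t η).coeFn_toLp] with s hs
  rw [adj, hs, adjFun]
  by_cases h : s ∈ Ioo 0 t <;> simp [h]

theorem inner_duhamel_forcing (hS : IsHeatSemigroup G S) (hω : MeasurableSet ω) (u : Control Ω)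
    {t : ℝ} (ht : 0 ≤ t) (η : L2 Ω) :
    ⟪duhamel S (forcing hω u) t, η⟫ = ⟪u, adj hS hω t η⟫ := by
  rw [hS.inner_duhamel (MemLp.integrableOn_Ioc (memLp_forcing hω u)) ht, inner_adj,
    intervalIntegral.integral_of_le ht, integral_Ioc_eq_integral_Ioo]
  simp only [forcing, chi_symm]

/-- The input map of the heat equation at time `t` (at time `0` if `t < 0`). -/
noncomputable def inputMap (hS : IsHeatSemigroup G S) (hω : MeasurableSet ω) (t : ℝ) :
    Control Ω →ₗ[ℝ] L2 Ω where
  toFun u := duhamel S (forcing hω u) (max t 0)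
  map_add' u v := ext_inner_right ℝ fun η => by
    rw [inner_add_left]
    simp only [inner_duhamel_forcing hS hω _ (le_max_right t 0), inner_add_left]
  map_smul' c u := ext_inner_right ℝ fun η => by
    rw [RingHom.id_apply, inner_smul_left]
    simp only [inner_duhamel_forcing hS hω _ (le_max_right t 0), inner_smul_left]

theorem inputMap_apply (hS : IsHeatSemigroup G S) (hω : MeasurableSet ω) {t : ℝ} (ht : 0 ≤ t)
    (u : Control Ω) : inputMap hS hω t u = duhamel S (forcing hω u) t := by
  change duhamel S (forcing hω u) (max t 0) = _
  rw [max_eq_left ht]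

/-- Dominated convergence in `L²`: the kernels converge at every `s ≠ T`, and along a convergent
sequence of times they are supported in a common bounded interval with norms at most `‖η‖`. -/
theorem continuousOn_adj (hS : IsHeatSemigroup G S) (hω : MeasurableSet ω) (η : L2 Ω) :
    ContinuousOn (fun t => adj hS hω t η) (Ici 0) := by
  intro T hT
  refine tendsto_of_seq_tendsto fun t ht => ?_
  have htT : Tendsto t atTop (𝓝 T) := ht.mono_right nhdsWithin_le_nhds
  obtain ⟨B, hB⟩ := htT.bddAbove_range
  have hTB : T ≤ B := le_of_tendsto htT (Eventually.of_forall fun n => hB ⟨n, rfl⟩)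
  refine tendsto_toLp_of_dominated (fun n => memLp_adjFun hS hω (t n) η) (memLp_adjFun hS hω T η)
    (b := (Ioo 0 B).indicator fun _ => 2 * ‖η‖) ?_ (fun n => Eventually.of_forall fun s => ?_) ?_
  · refine memLp_indicator_const 2 measurableSet_Ioo _ (Or.inr ?_)
    exact ((Measure.restrict_apply_le _ _).trans_lt measure_Ioo_lt_top).ne
  · by_cases hs : s ∈ Ioo 0 B
    · rw [indicator_of_mem hs, two_mul]
      exact (norm_sub_le _ _).trans
        (add_le_add (norm_adjFun_le hS hω _ _ _) (norm_adjFun_le hS hω _ _ _))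
    · have h1 : ∀ t' ≤ B, adjFun S hω t' η s = 0 := fun t' ht' =>
        indicator_of_notMem (fun h => hs ⟨h.1, h.2.trans_le ht'⟩) _
      rw [h1 _ (hB ⟨n, rfl⟩), h1 _ hTB, sub_zero, norm_zero]
      exact indicator_nonneg (fun _ _ => by positivity) _
  · have h0 : ∀ᵐ s ∂(volume.restrict (Ioi (0 : ℝ))), s ≠ T :=
      ae_restrict_of_ae (Measure.ae_ne volume T)
    filter_upwards [h0, ae_restrict_mem measurableSet_Ioi] with s hsT hs0
    rcases hsT.lt_or_gt with h | h
    · have hlim : Tendsto (fun n => chi Ω hω (S (t n - s) η)) atTop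
          (𝓝 (chi Ω hω (S (T - s) η))) :=
        (((chi Ω hω).continuous.comp (hS.continuous η)).tendsto _).comp (htT.sub_const s)
      rw [adjFun, indicator_of_mem (show s ∈ Ioo 0 T from ⟨hs0, h⟩)]
      refine hlim.congr' ?_
      filter_upwards [htT.eventually (lt_mem_nhds h)] with n hn
      rw [adjFun, indicator_of_mem (show s ∈ Ioo 0 (t n) from ⟨hs0, hn⟩)]
    · rw [adjFun, indicator_of_notMem fun hs => (lt_asymm h hs.2)]
      refine tendsto_const_nhds.congr' ?_
      filter_upwards [htT.eventually (gt_mem_nhds h)] with n hn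
      rw [adjFun, indicator_of_notMem fun hs => (lt_asymm hn hs.2)]

/-- For `adj_ne_zero`, if the kernel vanishes almost everywhere on `(0, t)`, then `χ_ω S (t - s) η =
0` for some `s < t`, and unique continuation gives `η = 0`. -/
theorem isControlSystem_heat (hS : IsHeatSemigroup G S) (hω : MeasurableSet ω)
    (huc : ∀ t, 0 < t → ∀ x, chi Ω hω (S t x) = 0 → x = 0) (y₀ : L2 Ω) :
    IsControlSystem (fun t => S t y₀) (inputMap hS hω) (adj hS hω) where
  inner_eq t ht u η := by rw [inputMap_apply hS hω ht, inner_duhamel_forcing hS hω u ht]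
  continuousOn_adj := continuousOn_adj hS hω
  continuousOn u := (hS.continuousOn_mild (memLp_forcing hω u) y₀).congr fun t ht => by
    simp only [inputMap_apply hS hω ht, mild]
  zero u := by rw [inputMap_apply hS hω le_rfl, duhamel, intervalIntegral.integral_same]
  adj_ne_zero t ht η hη h := hη (by
    have h1 : ∀ᵐ s ∂(volume.restrict (Ioo 0 t)), adjFun S hω t η s = 0 := by
      refine ae_restrict_of_ae_restrict_of_subset (Ioo_subset_Ioi_self : Ioo 0 t ⊆ Ioi 0) ?_
      have := Lp.coeFn_zero (L2 Ω) 2 (volume.restrict (Ioi (0 : ℝ)))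
      rw [← h] at this
      exact (memLp_adjFun hS hω t η).coeFn_toLp.symm.trans this
    have h2 : (ae (volume.restrict (Ioo 0 t))).NeBot := by
      rw [ae_restrict_neBot, Real.volume_Ioo]
      simpa using ht
    obtain ⟨s, hs, hst⟩ := (h1.and (ae_restrict_mem measurableSet_Ioo)).exists
    rw [adjFun, indicator_of_mem hst] at hs
    exact huc _ (sub_pos.2 hst.2) _ hs)

end HeatControlSystem

/-! ### Truncation of controls -/

section Restriction

variable {d : ℕ} {Ω ω : Set (Space d)}

theorem norm_zeroExtension {T : ℝ} (v : ControlOn Ω T) : ‖zeroExtension v‖ = ‖v‖ := by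
  rw [zeroExtension, Lp.norm_toLp, eLpNorm_indicator_eq_eLpNorm_restrict measurableSet_Ioo,
    Measure.restrict_restrict measurableSet_Ioo,
    inter_eq_left.mpr (Ioo_subset_Ioi_self : Ioo (0 : ℝ) T ⊆ Ioi 0), Lp.norm_def]

theorem norm_restrictControl_le (T : ℝ) (u : Control Ω) : ‖restrictControl T u‖ ≤ ‖u‖ := by
  rw [restrictControl, Lp.norm_toLp, Lp.norm_def]
  exact ENNReal.toReal_mono (Lp.memLp u).2.ne
    (eLpNorm_mono_measure _ (Measure.restrict_mono Ioo_subset_Ioi_self le_rfl))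

theorem coeFn_restrictControl (T : ℝ) (u : Control Ω) :
    restrictControl T u =ᵐ[volume.restrict (Ioo 0 T)] u :=
  MemLp.coeFn_toLp _

theorem coeFn_zeroExtension_restrictControl (T : ℝ) (u : Control Ω) :
    zeroExtension (restrictControl T u) =ᵐ[volume.restrict (Ioi 0)]
      (Ioo 0 T).indicator fun t => u t := by
  refine (MemLp.coeFn_toLp _).trans ?_
  have h := (ae_restrict_iff' measurableSet_Ioo).1 (coeFn_restrictControl T u)
  filter_upwards [ae_restrict_of_ae h] with t ht
  by_cases hs : t ∈ Ioo 0 T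
  · rw [indicator_of_mem hs, indicator_of_mem hs, ht hs]
  · rw [indicator_of_notMem hs, indicator_of_notMem hs]

theorem inner_zeroExtension_restrictControl_adj {G : L2 Ω →L[ℝ] L2 Ω}
    {S : ℝ → L2 Ω →L[ℝ] L2 Ω} (hS : IsHeatSemigroup G S) (hω : MeasurableSet ω) (T : ℝ)
    (u : Control Ω) (η : L2 Ω) :
    ⟪zeroExtension (restrictControl T u), adj hS hω T η⟫ = ⟪u, adj hS hω T η⟫ := by
  rw [inner_adj, inner_adj]
  refine integral_congr_ae ?_
  filter_upwards [ae_restrict_of_ae_restrict_of_subset Ioo_subset_Ioi_self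
    (coeFn_zeroExtension_restrictControl T u), ae_restrict_mem measurableSet_Ioo] with s hs hsT
  rw [hs, indicator_of_mem hsT]

theorem inputMap_zeroExtension_restrictControl {G : L2 Ω →L[ℝ] L2 Ω}
    {S : ℝ → L2 Ω →L[ℝ] L2 Ω} (hS : IsHeatSemigroup G S) (hω : MeasurableSet ω) {T : ℝ}
    (hT : 0 ≤ T) (u : Control Ω) :
    inputMap hS hω T (zeroExtension (restrictControl T u)) = inputMap hS hω T u := by
  refine ext_inner_right ℝ fun η => ?_
  rw [inputMap_apply hS hω hT, inputMap_apply hS hω hT, inner_duhamel_forcing hS hω _ hT,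
    inner_duhamel_forcing hS hω _ hT, inner_zeroExtension_restrictControl_adj]

end Restriction

/-! ### The space of sampled controls -/

section Sampled

variable {d : ℕ} {Ω : Set (Space d)}

theorem Ioc_subset_Ioi_of_sampling {δ : ℝ} (hδ : 0 < δ) (i : ℕ) :
    Ioc ((i : ℝ) * δ) (((i : ℝ) + 1) * δ) ⊆ Ioi 0 := fun t ht =>
  lt_of_le_of_lt (by positivity) ht.1

theorem IsSampled.add {δ : ℝ} (hδ : 0 < δ) {u v : Control Ω} (hu : IsSampled δ u)
    (hv : IsSampled δ v) : IsSampled δ (u + v) := by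
  obtain ⟨c, hc⟩ := hu
  obtain ⟨e, he⟩ := hv
  refine ⟨fun i => c i + e i, fun i => ?_⟩
  filter_upwards [hc i, he i, ae_restrict_of_ae_restrict_of_subset
    (Ioc_subset_Ioi_of_sampling hδ i) (Lp.coeFn_add u v)] with t h1 h2 h3
  rw [h3, Pi.add_apply, h1, h2]

theorem IsSampled.smul {δ : ℝ} (hδ : 0 < δ) {u : Control Ω} (hu : IsSampled δ u) (a : ℝ) :
    IsSampled δ (a • u) := by
  obtain ⟨c, hc⟩ := hu
  refine ⟨fun i => a • c i, fun i => ?_⟩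
  filter_upwards [hc i, ae_restrict_of_ae_restrict_of_subset
    (Ioc_subset_Ioi_of_sampling hδ i) (Lp.coeFn_smul a u)] with t h1 h2
  rw [h2, Pi.smul_apply, h1]

theorem isSampled_zero {δ : ℝ} (hδ : 0 < δ) : IsSampled δ (0 : Control Ω) :=
  ⟨fun _ => 0, fun i => ae_restrict_of_ae_restrict_of_subset
    (Ioc_subset_Ioi_of_sampling hδ i) (Lp.coeFn_zero _ _ _)⟩

/-- The condition is imposed cell by cell. On one cell it says that the restriction belongs to the
constants, and these form a closed subspace because `c ↦ Lp.const 2 μ c` multiplies norms by `√δ`.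
-/
theorem isClosed_isSampled {δ : ℝ} (hδ : 0 < δ) : IsClosed {u : Control Ω | IsSampled δ u} := by
  have h1 : {u : Control Ω | IsSampled δ u} =
      ⋂ i : ℕ, {u : Control Ω | ∃ c : L2 Ω,
        ∀ᵐ t ∂(volume.restrict (Ioc ((i : ℝ) * δ) (((i : ℝ) + 1) * δ))), u t = c} := by
    ext u
    simp only [IsSampled, mem_ofPred_eq, mem_iInter]
    exact ⟨fun ⟨c, hc⟩ i => ⟨c i, hc i⟩, fun h => by choose c hc using h; exact ⟨c, hc⟩⟩
  rw [h1]
  refine isClosed_iInter fun i => ?_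
  set J : Set ℝ := Ioc ((i : ℝ) * δ) (((i : ℝ) + 1) * δ) with hJ
  set μ : Measure ℝ := (volume.restrict (Ioi (0 : ℝ))).restrict J with hμ
  have hμJ : μ = volume.restrict J := by
    rw [hμ, Measure.restrict_restrict measurableSet_Ioc,
      inter_eq_left.2 (Ioc_subset_Ioi_of_sampling hδ i)]
  have hfin : IsFiniteMeasure μ := by rw [hμJ, hJ]; infer_instance
  have hreal : μ.real univ = δ := by
    rw [hμJ, measureReal_def, Measure.restrict_apply_univ, hJ, Real.volume_Ioc,
      ENNReal.toReal_ofReal (by linarith)]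
    ring
  have hrange : IsClosed (range (Lp.const (E := L2 Ω) 2 μ)) := by
    have hb : ∀ c : L2 Ω, ‖Lp.const 2 μ c‖ = δ ^ (1 / (2 : ℝ≥0∞).toReal) * ‖c‖ := fun c => by
      rw [Lp.norm_const' 2 μ c (by norm_num) (by norm_num), hreal, mul_comm]
    have hδ' : 0 < δ ^ (1 / (2 : ℝ≥0∞).toReal) := Real.rpow_pos_of_pos hδ _
    refine AntilipschitzWith.isClosed_range (K := (δ ^ (1 / (2 : ℝ≥0∞).toReal))⁻¹.toNNReal)
      (AddMonoidHomClass.antilipschitz_of_bound _ fun c => ?_)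
      (AddMonoidHomClass.uniformContinuous_of_bound _ (δ ^ (1 / (2 : ℝ≥0∞).toReal))
        fun c => (hb c).le)
    rw [hb, Real.coe_toNNReal _ (by positivity), inv_mul_cancel_left₀ hδ'.ne']
  have h2 : {u : Control Ω | ∃ c : L2 Ω, ∀ᵐ t ∂(volume.restrict J), u t = c} =
      (fun u : Control Ω => LpToLpRestrictCLM ℝ (L2 Ω) ℝ (volume.restrict (Ioi (0 : ℝ))) 2 J u) ⁻¹'
        range (Lp.const (E := L2 Ω) 2 μ) := by
    ext u
    have hu := LpToLpRestrictCLM_coeFn ℝ J u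
    simp only [mem_ofPred_eq, mem_preimage, mem_range]
    refine exists_congr fun c => ?_
    rw [← hμJ]
    constructor
    · intro h
      apply Lp.ext
      filter_upwards [h, hu, Lp.coeFn_const 2 μ c] with t h1 h2 h3
      rw [h2, h3, h1]; rfl
    · intro h
      filter_upwards [hu, Lp.coeFn_const 2 μ c] with t h2 h3
      rw [← h2, ← h, h3]; rfl
  rw [h2]
  exact hrange.preimage (ContinuousLinearMap.continuous _)

/-- The cut falls at a cell boundary, so each cell is kept or deleted entirely. The endpoint `kδ`,
missing from the open interval, is a null set. -/
theorem IsSampled.zeroExtension_restrictControl {δ : ℝ} (hδ : 0 < δ) {u : Control Ω}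
    (hu : IsSampled δ u) (k : ℕ) :
    IsSampled δ (zeroExtension (restrictControl (k * δ) u)) := by
  obtain ⟨c, hc⟩ := hu
  refine ⟨fun i => if i < k then c i else 0, fun i => ?_⟩
  filter_upwards [hc i, ae_restrict_of_ae_restrict_of_subset (Ioc_subset_Ioi_of_sampling hδ i)
    (coeFn_zeroExtension_restrictControl (k * δ) u), ae_restrict_mem measurableSet_Ioc,
    ae_restrict_of_ae (Measure.ae_ne volume ((k : ℝ) * δ))] with t h1 h2 h3 h4
  rw [h2]
  split_ifs with hik
  · have : ((i : ℝ) + 1) * δ ≤ k * δ := by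
      gcongr
      exact_mod_cast hik
    rw [indicator_of_mem (show t ∈ Ioo 0 (k * δ) from
      ⟨Ioc_subset_Ioi_of_sampling hδ i h3, (h3.2.trans this).lt_of_ne h4⟩), h1]
  · have : (k : ℝ) * δ ≤ i * δ := by
      gcongr
      exact_mod_cast not_lt.1 hik
    exact indicator_of_notMem (fun h => absurd h.2 (not_lt.2 (this.trans h3.1.le))) _

end Sampled
-- Controls of minimal norm
section MinimalNorm

/-- A nonempty closed convex set in a Hilbert space has a unique element of minimal norm. -/
theorem exists_minimal_norm {U : Type*} [NormedAddCommGroup U] [InnerProductSpace ℝ U]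
    [CompleteSpace U] {K : Set U} (hne : K.Nonempty) (hcl : IsClosed K) (hconv : Convex ℝ K) :
    ∃ x ∈ K, ∀ y ∈ K, ‖x‖ ≤ ‖y‖ ∧ (‖y‖ ≤ ‖x‖ → y = x) := by
  obtain ⟨x, hx, hmin⟩ := exists_norm_eq_iInf_of_complete_convex hne hcl.isComplete hconv 0
  have hle : ∀ y ∈ K, ‖x‖ ≤ ‖y‖ := fun y hy => by
    have h := ciInf_le (f := fun w : K => ‖(0 : U) - w‖)
      ⟨0, forall_mem_range.2 fun _ => norm_nonneg _⟩ ⟨y, hy⟩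
    rw [← hmin] at h
    simpa using h
  refine ⟨x, hx, fun y hy => ⟨hle y hy, fun hyx => ?_⟩⟩
  by_contra hne
  have h1 := norm_midpoint_lt hyx le_rfl hne
  have h2 : (1 / 2 : ℝ) • (y + x) ∈ K := by
    rw [smul_add]
    exact hconv hy hx (by norm_num) (by norm_num) (by norm_num)
  exact absurd (hle _ h2) (not_le.2 h1)

variable {d : ℕ} {Ω ω : Set (Space d)} {G : L2 Ω →L[ℝ] L2 Ω} {S : ℝ → L2 Ω →L[ℝ] L2 Ω}

/-- Among the sampled controls that steer `y₀` to the ball at time `T`, there is a unique one of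
minimal norm. -/
theorem exists_minimal_norm_sampled (hS : IsHeatSemigroup G S) (hω : MeasurableSet ω) {r : ℝ}
    (hr : 0 ≤ r) (y₀ : L2 Ω) {δ : ℝ} (hδ : 0 < δ) {T : ℝ} (hT : 0 ≤ T)
    (hne : {u : Control Ω | IsSampled δ u ∧ ‖S T y₀ + inputMap hS hω T u‖ ≤ r}.Nonempty) :
    ∃ x : Control Ω, (IsSampled δ x ∧ ‖S T y₀ + inputMap hS hω T x‖ ≤ r) ∧
      ∀ y : Control Ω, IsSampled δ y → ‖S T y₀ + inputMap hS hω T y‖ ≤ r →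
        ‖x‖ ≤ ‖y‖ ∧ (‖y‖ ≤ ‖x‖ → y = x) := by
  -- The admissible set is an intersection of closed half-spaces, so its closedness needs no bound
  -- on the operator norm of the input map.
  have hinner : ∀ u : Control Ω, ‖S T y₀ + inputMap hS hω T u‖ ≤ r ↔
      ∀ η, ⟪S T y₀, η⟫ + ⟪u, adj hS hω T η⟫ ≤ r * ‖η‖ := fun u => by
    rw [norm_le_iff_forall_inner_le hr]
    simp only [inner_add_left, inputMap_apply hS hω hT, inner_duhamel_forcing hS hω u hT]
  have hcl : IsClosed {u : Control Ω | IsSampled δ u ∧ ‖S T y₀ + inputMap hS hω T u‖ ≤ r} := by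
    refine (isClosed_isSampled hδ).inter
      (s₂ := {u : Control Ω | ‖S T y₀ + inputMap hS hω T u‖ ≤ r}) ?_
    have : {u : Control Ω | ‖S T y₀ + inputMap hS hω T u‖ ≤ r} =
        ⋂ η, {u : Control Ω | ⟪S T y₀, η⟫ + ⟪u, adj hS hω T η⟫ ≤ r * ‖η‖} := by
      ext u
      rw [mem_iInter]
      exact hinner u
    rw [this]
    exact isClosed_iInter fun η => isClosed_le (by fun_prop) continuous_const
  have hconv :
      Convex ℝ {u : Control Ω | IsSampled δ u ∧ ‖S T y₀ + inputMap hS hω T u‖ ≤ r} := by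
    rintro u ⟨hu, hur⟩ v ⟨hv, hvr⟩ a b ha hb hab
    refine ⟨(hu.smul hδ a).add hδ (hv.smul hδ b), ?_⟩
    have : S T y₀ + inputMap hS hω T (a • u + b • v) =
        a • (S T y₀ + inputMap hS hω T u) + b • (S T y₀ + inputMap hS hω T v) := by
      rw [map_add, map_smul, map_smul, smul_add, smul_add, add_add_add_comm, ← add_smul, hab,
        one_smul]
    have hball := convex_closedBall (0 : L2 Ω) r (mem_closedBall_zero_iff.2 hur)
      (mem_closedBall_zero_iff.2 hvr) ha hb hab
    rw [mem_closedBall_zero_iff, ← this] at hball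
    exact hball
  obtain ⟨x, hx, h⟩ := exists_minimal_norm hne hcl hconv
  exact ⟨x, hx, fun y hy hyr => h y ⟨hy, hyr⟩⟩

end MinimalNorm

/-! ### The time optimal and norm optimal problems -/

section Problems

variable {d : ℕ} {Ω ω : Set (Space d)} {G : L2 Ω →L[ℝ] L2 Ω} {S : ℝ → L2 Ω →L[ℝ] L2 Ω}

/-- The optimal time of the sampled-data problem is attained. -/
theorem exists_optTimeSampled_eq {r M δ : ℝ} (hδ : 0 < δ) {y₀ : L2 Ω}
    (hne : ∃ k : ℕ, 1 ≤ k ∧ ∃ u : Control Ω, IsSampled δ u ∧ ‖u‖ ≤ M ∧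
      Reaches ω r y₀ u (k * δ)) :
    ∃ k : ℕ, 1 ≤ k ∧ optTimeSampled ω r M δ y₀ = k * δ ∧
      ∃ u : Control Ω, IsSampled δ u ∧ ‖u‖ ≤ M ∧ Reaches ω r y₀ u (k * δ) := by
  classical
  obtain ⟨h1, h2⟩ := Nat.find_spec hne
  refine ⟨Nat.find hne, h1, IsLeast.csInf_eq ⟨⟨_, h1, rfl, h2⟩, ?_⟩, h2⟩
  rintro t ⟨k, hk, rfl, hu⟩
  gcongr
  exact_mod_cast Nat.find_min' hne ⟨hk, hu⟩

theorem restrictControl_eq_iff {T : ℝ} {u v : Control Ω} :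
    restrictControl T u = restrictControl T v ↔
      zeroExtension (restrictControl T u) = zeroExtension (restrictControl T v) := by
  refine ⟨fun h => by rw [h], fun h => ?_⟩
  apply Lp.ext
  have h1 := ae_restrict_of_ae_restrict_of_subset (Ioo_subset_Ioi_self : Ioo 0 T ⊆ Ioi 0)
    (coeFn_zeroExtension_restrictControl T u)
  have h2 := ae_restrict_of_ae_restrict_of_subset (Ioo_subset_Ioi_self : Ioo 0 T ⊆ Ioi 0)
    (coeFn_zeroExtension_restrictControl T v)
  rw [h] at h1
  filter_upwards [h1, h2, coeFn_restrictControl T u, coeFn_restrictControl T v,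
    ae_restrict_mem measurableSet_Ioo] with t a1 a2 a3 a4 a5
  rw [indicator_of_mem a5] at a1 a2
  rw [a3, a4, ← a1, ← a2]

/-- The sampled-data problems, in terms of the sampled control of minimal norm. -/
theorem sampled_problems (hS : IsHeatSemigroup G S) (hω : MeasurableSet ω) {r M δ : ℝ}
    (hr : 0 ≤ r) (hδ : 0 < δ) {y₀ : L2 Ω}
    (hreach : ∀ (u : Control Ω) (t : ℝ), 0 ≤ t →
      (Reaches ω r y₀ u t ↔ ‖S t y₀ + inputMap hS hω t u‖ ≤ r))
    {k : ℕ} (hk : optTimeSampled ω r M δ y₀ = k * δ)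
    (hne : ∃ u : Control Ω, IsSampled δ u ∧ ‖u‖ ≤ M ∧ Reaches ω r y₀ u (k * δ)) :
    (∃ u : Control Ω, IsMinNormTimeOptimalSampled ω r M δ y₀ u ∧
      ∀ v : Control Ω, IsMinNormTimeOptimalSampled ω r M δ y₀ v →
        restrictControl (optTimeSampled ω r M δ y₀) v =
          restrictControl (optTimeSampled ω r M δ y₀) u) ∧
    ∀ u : Control Ω, IsMinNormTimeOptimalSampled ω r M δ y₀ u →
      IsNormOptimalSampled ω r δ (optTimeSampled ω r M δ y₀) y₀
        (restrictControl (optTimeSampled ω r M δ y₀) u) := by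
  unfold IsMinNormTimeOptimalSampled IsTimeOptimalSampled
  rw [hk]
  set T : ℝ := k * δ with hTdef
  have hT : 0 ≤ T := by positivity
  simp only [hreach _ T hT] at hne ⊢
  set P : Control Ω → Control Ω := fun u => zeroExtension (restrictControl T u) with hP
  have hPn : ∀ u, ‖P u‖ = ‖restrictControl T u‖ := fun u => norm_zeroExtension _
  have hPle : ∀ u, ‖P u‖ ≤ ‖u‖ := fun u => (hPn u).trans_le (norm_restrictControl_le T u)
  have hPs : ∀ u, IsSampled δ u → IsSampled δ (P u) := fun u hu =>
    hu.zeroExtension_restrictControl hδ k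
  have hPi : ∀ u, inputMap hS hω T (P u) = inputMap hS hω T u :=
    inputMap_zeroExtension_restrictControl hS hω hT
  obtain ⟨u₁, hu₁s, hu₁M, hu₁r⟩ := hne
  obtain ⟨x, ⟨hxs, hxr⟩, hmin⟩ :=
    exists_minimal_norm_sampled hS hω hr y₀ hδ hT ⟨u₁, hu₁s, hu₁r⟩
  -- The truncation of the minimiser is a competitor of no larger norm, so it is the minimiser
  -- itself. Norms over `(0, T)` and over the half-line therefore agree at `x`.
  have hPx : P x = x := (hmin (P x) (hPs x hxs) (by rwa [hPi])).2 (hPle x)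
  have hle : ∀ v, IsSampled δ v → ‖S T y₀ + inputMap hS hω T v‖ ≤ r →
      ‖restrictControl T x‖ ≤ ‖restrictControl T v‖ := fun v hv hvr => by
    rw [← hPn, ← hPn, hPx]
    exact (hmin (P v) (hPs v hv) (by rwa [hPi])).1
  -- The minimisation ignores the bound `M`; the bound is inherited from the admissible control
  -- `u₁`.
  have hxM : ‖x‖ ≤ M := ((hmin u₁ hu₁s hu₁r).1).trans hu₁M
  have huniq : ∀ v, IsSampled δ v → ‖S T y₀ + inputMap hS hω T v‖ ≤ r →
      ‖restrictControl T v‖ ≤ ‖restrictControl T x‖ →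
      restrictControl T v = restrictControl T x := fun v hv hvr hvx => by
    rw [← hPn, ← hPn, hPx] at hvx
    have h1 := (hmin (P v) (hPs v hv) (by rwa [hPi])).2 hvx
    exact restrictControl_eq_iff.2 (h1.trans hPx.symm)
  refine ⟨⟨x, ⟨⟨hxs, hxM, hxr⟩, fun v hv => hle v hv.1 hv.2.2⟩, fun v hv =>
    huniq v hv.1.1 hv.1.2.2 (hv.2 x ⟨hxs, hxM, hxr⟩)⟩, ?_⟩
  rintro u ⟨⟨hus, -, hur⟩, humin⟩
  have hux : restrictControl T u = restrictControl T x := huniq u hus hur (humin x ⟨hxs, hxM, hxr⟩)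
  have hadm : IsNormAdmissibleSampled ω r δ T y₀ (restrictControl T u) :=
    ⟨⟨u, hus, rfl⟩, (hreach _ T hT).2 (by
      have := hPi u
      simp only [hP] at this
      rwa [this])⟩
  refine ⟨hadm, (IsLeast.csInf_eq (a := ‖restrictControl T u‖) (s := {a : ℝ | ∃ v : ControlOn Ω T,
    IsNormAdmissibleSampled ω r δ T y₀ v ∧ a = ‖v‖}) ⟨⟨_, hadm, rfl⟩, ?_⟩).symm⟩
  rintro b ⟨v, ⟨⟨f, hf, rfl⟩, hvr⟩, rfl⟩
  rw [hux]
  have := (hreach _ T hT).1 hvr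
  have h2 := hPi f
  simp only [hP] at h2
  rw [h2] at this
  exact hle f hf this

/-- The time optimal problem with distributed controls. -/
theorem distributed_problem (hS : IsHeatSemigroup G S) (hω : MeasurableSet ω)
    (huc : ∀ t, 0 < t → ∀ x, chi Ω hω (S t x) = 0 → x = 0) {r M : ℝ} (hr : 0 < r) {y₀ : L2 Ω}
    (hy₀ : r < ‖y₀‖)
    (hreach : ∀ (u : Control Ω) (t : ℝ), 0 ≤ t →
      (Reaches ω r y₀ u t ↔ ‖S t y₀ + inputMap hS hω t u‖ ≤ r))
    (hne : ∃ t, 0 < t ∧ ∃ u : Control Ω, ‖u‖ ≤ M ∧ ‖S t y₀ + inputMap hS hω t u‖ ≤ r) :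
    ∃ u : Control Ω, IsTimeOptimal ω r M y₀ u ∧
      ∀ v : Control Ω, IsTimeOptimal ω r M y₀ v → v = u := by
  have hsys := isControlSystem_heat hS hω huc y₀
  have hset : {t : ℝ | 0 < t ∧ ∃ u : Control Ω, ‖u‖ ≤ M ∧ Reaches ω r y₀ u t} =
      {t : ℝ | 0 < t ∧ ∃ u : Control Ω, ‖u‖ ≤ M ∧ ‖S t y₀ + inputMap hS hω t u‖ ≤ r} := by
    ext t
    exact and_congr_right fun ht => by simp only [hreach _ t ht.le]
  have hopt : optTime ω r M y₀ = sInf {t : ℝ | 0 < t ∧ ∃ u : Control Ω, ‖u‖ ≤ M ∧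
      ‖S t y₀ + inputMap hS hω t u‖ ≤ r} := by rw [optTime, hset]
  obtain ⟨u, hu, hur⟩ := hsys.exists_optimal (M := M) hr.le hne
  have hglb := isGLB_csInf (s := {t : ℝ | 0 < t ∧ ∃ u : Control Ω, ‖u‖ ≤ M ∧
    ‖S t y₀ + inputMap hS hω t u‖ ≤ r}) hne ⟨0, fun t ht => ht.1.le⟩
  have hT : 0 ≤ optTime ω r M y₀ := hopt ▸ le_csInf hne fun t ht => ht.1.le
  rw [← hopt] at hur hglb
  refine ⟨u, ⟨hu, (hreach _ _ hT).2 hur⟩, fun v hv => ?_⟩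
  exact hsys.optimal_unique hr (by simpa only [hS.zero] using hy₀) hglb hv.1
    ((hreach _ _ hT).1 hv.2) hu hur

end Problems
end HeatControl

theorem mainTheorem4 (d : ℕ) (hd : 1 ≤ d) (Ω ω : Set (Space d))
    (hΩ_open : IsOpen Ω) (hΩ_conn : IsConnected Ω) (hΩ_bdd : Bornology.IsBounded Ω)
    (hΩ_C2 : HasC2Boundary Ω)
    (hω_open : IsOpen ω) (hω_ne : ω.Nonempty) (hω_sub : ω ⊆ Ω)
    (r : ℝ) (hr : 0 < r) (y₀ : L2 Ω) (hy₀ : y₀ ∉ Metric.closedBall (0 : L2 Ω) r)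
    (M : ℝ) (hM : 0 ≤ M) :
    -- (i) existence and uniqueness, on `(0, T(M, y₀))`, of the optimal control
    (∃ u : Control Ω, IsTimeOptimal ω r M y₀ u ∧
      ∀ v : Control Ω, IsTimeOptimal ω r M y₀ v →
        restrictControl (optTime ω r M y₀) v = restrictControl (optTime ω r M y₀) u) ∧
    ∀ δ : ℝ, 0 < δ →
      -- (ii) existence and uniqueness, on `(0, T_δ(M, y₀))`, of the optimal control with the
      -- minimal norm
      (∃ u : Control Ω, IsMinNormTimeOptimalSampled ω r M δ y₀ u ∧
        ∀ v : Control Ω, IsMinNormTimeOptimalSampled ω r M δ y₀ v →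
          restrictControl (optTimeSampled ω r M δ y₀) v =
            restrictControl (optTimeSampled ω r M δ y₀) u) ∧
      -- (iii) `T_δ(M, y₀)` is a positive multiple of `δ`, and the restriction of that control is
      -- optimal for the norm optimal control problem
      (∃ k : ℕ, 1 ≤ k ∧ optTimeSampled ω r M δ y₀ = k * δ) ∧
      ∀ u : Control Ω, IsMinNormTimeOptimalSampled ω r M δ y₀ u →
        IsNormOptimalSampled ω r δ (optTimeSampled ω r M δ y₀) y₀
          (restrictControl (optTimeSampled ω r M δ y₀) u) ∧
        ‖restrictControl (optTimeSampled ω r M δ y₀) u‖ =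
          optNormSampled ω r δ (optTimeSampled ω r M δ y₀) y₀ := by
  obtain ⟨G, S, hG, hS, hlap, hsol⟩ := exists_heatSemigroup hd hΩ_open hΩ_bdd
  have hω := hω_open.measurableSet
  have huc : ∀ t, 0 < t → ∀ x, chi Ω hω (S t x) = 0 → x = 0 := fun t ht x h =>
    eq_zero_of_vanishes hΩ_open hΩ_bdd hΩ_conn.isPreconnected hG hS hlap hω_open hω_ne hω_sub ht h
  have hreach : ∀ (u : Control Ω) (t : ℝ), 0 ≤ t →
      (Reaches ω r y₀ u t ↔ ‖S t y₀ + inputMap hS hω t u‖ ≤ r) := fun u t ht => by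
    obtain ⟨h1, h2⟩ := hsol ω hω hω_sub y₀ u
    rw [inputMap_apply hS hω ht]
    constructor
    · rintro ⟨y, hy, hyr⟩
      rwa [h2 y hy t ht, mem_closedBall_zero_iff] at hyr
    · exact fun h => ⟨_, h1, mem_closedBall_zero_iff.2 h⟩
  -- The free solution enters the ball eventually, so the zero control makes both time optimal
  -- problems feasible for every `M ≥ 0`.
  have hdecay : ∀ᶠ t in atTop, ‖S t y₀‖ < r := by
    have h := (hS.tendsto_zero hG y₀).norm
    rw [norm_zero] at h
    exact h.eventually_lt_const hr
  rw [mem_closedBall_zero_iff, not_le] at hy₀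
  refine ⟨?_, fun δ hδ => ?_⟩
  · obtain ⟨t, ht, ht0⟩ := (hdecay.and (eventually_gt_atTop 0)).exists
    obtain ⟨u, hu, huniq⟩ := distributed_problem hS hω huc (M := M) hr hy₀ hreach
      ⟨t, ht0, 0, by simpa using hM, by simpa using ht.le⟩
    exact ⟨u, hu, fun v hv => by rw [huniq v hv]⟩
  · have hlim : Tendsto (fun k : ℕ => (k : ℝ) * δ) atTop atTop :=
      tendsto_natCast_atTop_atTop.atTop_mul_const hδ
    obtain ⟨k₀, hk₀, hk₀1⟩ := ((hlim.eventually hdecay).and (eventually_ge_atTop 1)).exists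
    obtain ⟨k, hk1, hk, hne⟩ := exists_optTimeSampled_eq (ω := ω) (r := r) (M := M) hδ (y₀ := y₀)
      ⟨k₀, hk₀1, 0, isSampled_zero hδ, by simpa using hM,
        (hreach _ _ (by positivity)).2 (by simpa using hk₀.le)⟩
    obtain ⟨h1, h2⟩ := sampled_problems hS hω hr.le hδ hreach hk hne
    exact ⟨h1, ⟨k, hk1, hk⟩, fun u hu => ⟨h2 u hu, (h2 u hu).2⟩⟩
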